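/- Let $G$ be a (real, finite-dimensional) Lie group with Lie algebra $\mathfrak g=T_eG$. *Conventions.* A symmetric (respectively skew-symmetric) generalized complex structure on $G$ is a smooth field $\mathcal J$ of endomorphisms of $TG\oplus T^*G$ with $\mathcal J^2=-\mathrm{Id}$ which is symmetric (respectively skew-symmetric) with respect to $g_{\mathrm{can}}(X+\xi,Y+\eta)=\tfrac12(\xi(Y)+\eta(X))$; no Courant integrability is assumed. Let $\tau$ denote the standard conjugations of $\mathfrak g^{\mathbb C}$, of $T^{\mathbb C}G$ and of $\mathbb C$ in the symmetric case, and the identity maps in the skew-symmetric case. The holomorphic bundle ($i$-eigenbundle) $L$ of $\mathcal J$ is, at each point, of the form $L^\tau(E,\alpha)=\{X+\xi : X\in E,\ \xi|_{\tau(E)}=\alpha(X,\cdot)\}$, where $E\subset T^{\mathbb C}G$ is the projection of $L$ and $\alpha$ is a complex bilinear form on $E\times\tau(E)$. A linear connection $D$ on $G$ is left-invariant if $D_XY$ is left-invariant whenever $X$ and $Y$ are. It induces a decomposition $T(T^*G)=H^D\oplus T^{\mathrm{vert}}(T^*G)\cong\pi^*(TG\oplus T^*G)$, where $\pi:T^*G\to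 G$, and $J^{\mathcal J,D}:=\pi^*\mathcal J$ is the resulting almost complex structure on $T^*G$; it is integrable if its $i$-eigenbundle is involutive. A symmetric (respectively skew-symmetric) $\mathfrak g$-admissible triple is a triple $(\mathfrak k,\mathcal D,\epsilon)$ such that: 1. $\mathfrak k\subset\mathfrak g^{\mathbb C}$ is a complex subalgebra with $\mathfrak k+\bar{\mathfrak k}=\mathfrak g^{\mathbb C}$; 2. $\mathcal D:\mathfrak g\times\mathfrak g\to\mathfrak g$, $(X,Y)\mapsto\mathcal D_XY$, is a bilinear map whose complex bilinear extension satisfies $\mathcal D_{\mathfrak k}\tau(\mathfrak k)\subset\tau(\mathfrak k)$ and $-\mathcal D_X\mathcal D_YZ+\mathcal D_Y\mathcal D_XZ+\mathcal D_{[X,Y]}Z=0$ for all $X,Y\in\mathfrak k$, $Z\in\tau(\mathfrak k)$; 3. $\epsilon:\mathfrak k\times\tau(\mathfrak k)\to\mathbb C$ is complex bilinear, with $\epsilon(X,\tau(Y))+\tau(\epsilon(Y,\tau(X)))=0$ and $\epsilon(X,\mathcal D_Y\tau(Z))-\epsilon(Y,\mathcal D_X\tau(Z))=\epsilon([X,Y],\tau(Z))$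 for all $X,Y,Z\in\mathfrak k$, and $\mathrm{Im}(\epsilon|_{\Delta})$ is non-degenerate on $\Delta=\mathfrak g\cap\mathfrak k\cap\bar{\mathfrak k}$. **Proposition.** For each of the two types (symmetric, respectively skew-symmetric), there is a bijection between i) pairs $(\mathcal J,D)$ formed by a left-invariant generalized complex structure $\mathcal J$ of this type and a left-invariant connection $D$ on $G$ such that $J^{\mathcal J,D}$ is integrable on $T^*G$, and ii) $\mathfrak g$-admissible triples $(\mathfrak k,\mathcal D,\epsilon)$ of this type. In this correspondence, $\mathfrak k=E_e$, $\mathcal D$ is the restriction of $D$ to the space of left-invariant vector fields (identified with $\mathfrak g$), and $\epsilon=\alpha|_{\mathfrak k\times\tau(\mathfrak k)}$, where $L^\tau(E,\alpha)$ is the holomorphic bundle of $\mathcal J$. -/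

import Mathlib

open scoped Manifold ContDiff TensorProduct

noncomputable section

namespace GenCplx

/-! ## Linear algebra -/

/-- The two types of generalized complex structures: symmetric, or skew-symmetric, with respect
to the canonical metric of `V ⊕ V*`. -/
inductive Kind where
  | symmetric
  | skewSymmetric

section Linear

variable {V : Type*} [AddCommGroup V] [Module ℝ V]

/-- The standard conjugation `c ⊗ v ↦ conj c ⊗ v` of `V^ℂ = ℂ ⊗ V`. -/
def conj : ℂ ⊗[ℝ] V →ₛₗ[starRingEnd ℂ] ℂ ⊗[ℝ] V where
  toFun := TensorProduct.map (Complex.conjAe.toLinearMap) LinearMap.id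
  map_add' := map_add _
  map_smul' c x := by
    induction x using TensorProduct.induction_on with
    | zero => simp
    | tmul a v => simp [TensorProduct.smul_tmul']
    | add x y hx hy => simp only [smul_add, map_add, hx, hy]

/-- The map `τ` on `V^ℂ`: the conjugation in the symmetric case, the identity in the
skew-symmetric case. -/
def tau : Kind → ℂ ⊗[ℝ] V → ℂ ⊗[ℝ] V
  | .symmetric, x => conj x
  | .skewSymmetric, x => x

/-- The map `τ` on `ℂ`: the conjugation in the symmetric case, the identity in the
skew-symmetric case. -/
def tauScalar : Kind → ℂ → ℂ
  | .symmetric, z => (starRingEnd ℂ) z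
  | .skewSymmetric, z => z

/-- The image `τ(F)` of a complex subspace `F` of `V^ℂ`, again a complex subspace. -/
def tauSubmodule : Kind → Submodule ℂ (ℂ ⊗[ℝ] V) → Submodule ℂ (ℂ ⊗[ℝ] V)
  | .symmetric, F => F.map conj
  | .skewSymmetric, F => F

theorem tau_mem (s : Kind) {F : Submodule ℂ (ℂ ⊗[ℝ] V)} {x : ℂ ⊗[ℝ] V} (hx : x ∈ F) :
    tau s x ∈ tauSubmodule s F := by
  cases s
  · exact Submodule.mem_map_of_mem hx
  · exact hx

/-- The real part `Δ = {v ∈ V | 1 ⊗ v ∈ F ∩ conj F}` of `F ∩ conj F`. -/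
def realPart (F : Submodule ℂ (ℂ ⊗[ℝ] V)) : Set V :=
  {v | (1 : ℂ) ⊗ₜ[ℝ] v ∈ F ∧ (1 : ℂ) ⊗ₜ[ℝ] v ∈ F.map conj}

theorem mem_of_mem_realPart {F : Submodule ℂ (ℂ ⊗[ℝ] V)} {v : V} (hv : v ∈ realPart F) :
    (1 : ℂ) ⊗ₜ[ℝ] v ∈ F := hv.1

theorem tau_mem_of_mem_realPart (s : Kind) {F : Submodule ℂ (ℂ ⊗[ℝ] V)} {v : V}
    (hv : v ∈ realPart F) : (1 : ℂ) ⊗ₜ[ℝ] v ∈ tauSubmodule s F := by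
  cases s
  · exact hv.2
  · exact hv.1

/-- The complex bilinear extension to `V^ℂ` of a real bilinear map `V × V → V`. -/
def complexify (B : V →ₗ[ℝ] V →ₗ[ℝ] V) : ℂ ⊗[ℝ] V →ₗ[ℂ] ℂ ⊗[ℝ] V →ₗ[ℂ] ℂ ⊗[ℝ] V :=
  LinearMap.liftBaseChange ℂ ((LinearMap.baseChangeHom ℝ ℂ V V) ∘ₗ B)

end Linear

section GeneralizedTangent

variable (V : Type*) [AddCommGroup V] [Module ℝ V] [TopologicalSpace V]

/-- `V ⊕ V*`. -/
abbrev DoubleSpace : Type _ := V × (V →L[ℝ] ℝ)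

variable {V}

/-- The canonical metric `½ (ξ(Y) + η(X))` of `V ⊕ V*`. -/
def gCan (a b : DoubleSpace V) : ℝ := (1 / 2) * (a.2 b.1 + b.2 a.1)

/-- `𝒥` is a symmetric, respectively skew-symmetric, generalized complex structure on `V`. -/
structure IsGenCplx (s : Kind) (𝒥 : DoubleSpace V →ₗ[ℝ] DoubleSpace V) : Prop where
  sq : ∀ a, 𝒥 (𝒥 a) = -a
  compat : match s with
    | .symmetric => ∀ a b, gCan (𝒥 a) b = gCan a (𝒥 b)
    | .skewSymmetric => ∀ a b, gCan (𝒥 a) b = -gCan a (𝒥 b)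

/-- The holomorphic space of `𝒥`: the `i`-eigenspace of its complex linear extension. -/
def holSpace (𝒥 : DoubleSpace V →ₗ[ℝ] DoubleSpace V) : Submodule ℂ (ℂ ⊗[ℝ] DoubleSpace V) :=
  Module.End.eigenspace (𝒥.baseChange ℂ) Complex.I

/-- The projection `(V ⊕ V*)^ℂ → V^ℂ`. -/
def proj₁ : ℂ ⊗[ℝ] DoubleSpace V →ₗ[ℂ] ℂ ⊗[ℝ] V :=
  (LinearMap.fst ℝ V (V →L[ℝ] ℝ)).baseChange ℂ

/-- The projection `(V ⊕ V*)^ℂ → (V*)^ℂ = (V^ℂ)*`. -/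
def proj₂ : ℂ ⊗[ℝ] DoubleSpace V →ₗ[ℂ] Module.Dual ℂ (ℂ ⊗[ℝ] V) :=
  LinearMap.liftBaseChange ℂ
    ((Module.Dual.baseChange ℂ) ∘ₗ (ContinuousLinearMap.coeLM ℝ) ∘ₗ
      (LinearMap.snd ℝ V (V →L[ℝ] ℝ)))

/-- `L^τ(F, α) = {X + ξ ∈ F ⊕ (V^ℂ)* | ξ = α(X, ·) on τ(F)}`. -/
def LTau (s : Kind) (F : Submodule ℂ (ℂ ⊗[ℝ] V)) (α : F →ₗ[ℂ] tauSubmodule s F →ₗ[ℂ] ℂ) :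
    Set (ℂ ⊗[ℝ] DoubleSpace V) :=
  {w | ∃ h : proj₁ w ∈ F, ∀ Y : tauSubmodule s F, proj₂ w Y = α ⟨proj₁ w, h⟩ Y}

end GeneralizedTangent

/-! ## Admissible triples -/

/-- A (symmetric, respectively skew-symmetric) `𝔤`-admissible triple `(𝔨, 𝒟, ε)`. -/
@[ext]
structure AdmissibleTriple (s : Kind) (𝔤 : Type*) [LieRing 𝔤] [LieAlgebra ℝ 𝔤] where
  /-- The complex subalgebra `𝔨` of `𝔤^ℂ`. -/
  𝔨 : LieSubalgebra ℂ (ℂ ⊗[ℝ] 𝔤)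
  /-- The bilinear map `𝒟`, with `𝒟 X Y = 𝒟_X Y`. -/
  𝒟 : 𝔤 →ₗ[ℝ] 𝔤 →ₗ[ℝ] 𝔤
  /-- The complex bilinear form `ε` on `𝔨 × τ(𝔨)`. -/
  ε : 𝔨.toSubmodule →ₗ[ℂ] tauSubmodule s 𝔨.toSubmodule →ₗ[ℂ] ℂ
  sup_conj : 𝔨.toSubmodule ⊔ 𝔨.toSubmodule.map conj = ⊤
  𝒟_mem : ∀ X ∈ 𝔨.toSubmodule, ∀ W ∈ tauSubmodule s 𝔨.toSubmodule,
    complexify 𝒟 X W ∈ tauSubmodule s 𝔨.toSubmodule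
  curv : ∀ X ∈ 𝔨.toSubmodule, ∀ Y ∈ 𝔨.toSubmodule, ∀ Z ∈ tauSubmodule s 𝔨.toSubmodule,
    -complexify 𝒟 X (complexify 𝒟 Y Z) + complexify 𝒟 Y (complexify 𝒟 X Z)
      + complexify 𝒟 ⁅X, Y⁆ Z = 0
  ε_tau : ∀ X Y : 𝔨.toSubmodule,
    ε X ⟨tau s Y, tau_mem s Y.2⟩ + tauScalar s (ε Y ⟨tau s X, tau_mem s X.2⟩) = 0
  ε_eq : ∀ X Y Z : 𝔨.toSubmodule,
    ε X ⟨complexify 𝒟 Y (tau s Z), 𝒟_mem Y Y.2 _ (tau_mem s Z.2)⟩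
      - ε Y ⟨complexify 𝒟 X (tau s Z), 𝒟_mem X X.2 _ (tau_mem s Z.2)⟩
      = ε ⟨⁅(X : ℂ ⊗[ℝ] 𝔤), (Y : ℂ ⊗[ℝ] 𝔤)⁆, 𝔨.lie_mem X.2 Y.2⟩ ⟨tau s Z, tau_mem s Z.2⟩
  /-- `Im (ε|_Δ)` is non-degenerate. -/
  nondegenerate : ∀ (x : 𝔤) (hx : x ∈ realPart 𝔨.toSubmodule),
    (∀ (y : 𝔤) (hy : y ∈ realPart 𝔨.toSubmodule),
      (ε ⟨(1 : ℂ) ⊗ₜ[ℝ] x, mem_of_mem_realPart hx⟩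
        ⟨(1 : ℂ) ⊗ₜ[ℝ] y, tau_mem_of_mem_realPart s hy⟩).im = 0) → x = 0

/-! ## Smooth manifolds -/

section Manifold

variable (E : Type*) [NormedAddCommGroup E] [NormedSpace ℝ E]
  (M : Type*) [TopologicalSpace M] [ChartedSpace E M] [IsManifold 𝓘(ℝ, E) ∞ M]

/-- Smooth vector fields on `M`. -/
abbrev VField : Type _ := Cₛ^∞⟮𝓘(ℝ, E); E, fun x : M => TangentSpace 𝓘(ℝ, E) x⟯

/-- Smooth 1-forms on `M`. -/
abbrev OneForm : Type _ :=
  Cₛ^∞⟮𝓘(ℝ, E); E →L[ℝ] ℝ, fun x : M => TangentSpace 𝓘(ℝ, E) x →L[ℝ] ℝ⟯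

/-- A smooth field `𝒥` of endomorphisms of `TM ⊕ T*M` which at any point is a symmetric,
respectively skew-symmetric, generalized complex structure. Smoothness is expressed by the
condition that `𝒥` maps smooth sections of `TM ⊕ T*M` to smooth sections. -/
@[ext]
structure GenCplxStructure (s : Kind) where
  /-- The field of endomorphisms. -/
  toFun : ∀ x : M, DoubleSpace (TangentSpace 𝓘(ℝ, E) x) →ₗ[ℝ] DoubleSpace (TangentSpace 𝓘(ℝ, E) x)
  isGenCplx : ∀ x, IsGenCplx s (toFun x)
  smooth_fst : ∀ (X : VField E M) (ξ : OneForm E M),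
    ContMDiff 𝓘(ℝ, E) (𝓘(ℝ, E).prod 𝓘(ℝ, E)) ∞
      (fun x => Bundle.TotalSpace.mk' E (E := fun x : M => TangentSpace 𝓘(ℝ, E) x) x
        (toFun x (X x, ξ x)).1)
  smooth_snd : ∀ (X : VField E M) (ξ : OneForm E M),
    ContMDiff 𝓘(ℝ, E) (𝓘(ℝ, E).prod 𝓘(ℝ, E →L[ℝ] ℝ)) ∞
      (fun x => Bundle.TotalSpace.mk' (E →L[ℝ] ℝ)
        (E := fun x : M => TangentSpace 𝓘(ℝ, E) x →L[ℝ] ℝ) x (toFun x (X x, ξ x)).2)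

/-- A linear connection `D` on `M`: `D Y x v` is the value at `x` of the covariant derivative
`D_v Y` of the vector field `Y` in the direction `v ∈ T_x M`. -/
@[ext]
structure LinearConnection where
  /-- The covariant derivative. -/
  toFun : VField E M → ∀ x : M, TangentSpace 𝓘(ℝ, E) x →L[ℝ] TangentSpace 𝓘(ℝ, E) x
  add : ∀ (Y Z : VField E M) (x : M), toFun (Y + Z) x = toFun Y x + toFun Z x
  /-- `D_v (f Y) = df(v) Y + f D_v Y`. -/
  leibniz : ∀ (f : M → ℝ), ContMDiff 𝓘(ℝ, E) 𝓘(ℝ, ℝ) ∞ f →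
    ∀ Y Z : VField E M, (∀ x, Z x = f x • Y x) →
    ∀ (x : M) (v : TangentSpace 𝓘(ℝ, E) x),
      toFun Z x v = (mvfderiv 𝓘(ℝ, E) f x v) • Y x + f x • toFun Y x v
  /-- `D_X Y` is smooth. -/
  smooth : ∀ X Y : VField E M,
    ContMDiff 𝓘(ℝ, E) (𝓘(ℝ, E).prod 𝓘(ℝ, E)) ∞
      (fun x => Bundle.TotalSpace.mk' E (E := fun x : M => TangentSpace 𝓘(ℝ, E) x) x
        (toFun Y x (X x)))

/-- The cotangent manifold `T*M`. -/
abbrev Cotangent : Type _ :=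
  Bundle.TotalSpace (E →L[ℝ] ℝ) (fun x : M => TangentSpace 𝓘(ℝ, E) x →L[ℝ] ℝ)

/-- The model with corners (without boundary) of the cotangent manifold. -/
abbrev cotModel : ModelWithCorners ℝ (E × (E →L[ℝ] ℝ)) (ModelProd E (E →L[ℝ] ℝ)) :=
  𝓘(ℝ, E).prod 𝓘(ℝ, E →L[ℝ] ℝ)

end Manifold

section CotangentManifold

variable {E : Type*} [NormedAddCommGroup E] [NormedSpace ℝ E]
  {M : Type*} [TopologicalSpace M] [ChartedSpace E M] [IsManifold 𝓘(ℝ, E) ∞ M]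

/-- The differential `T_γ(T*M) → T_{π γ} M` of the projection `π : T*M → M`. -/
def dProj (γ : Cotangent E M) : TangentSpace (cotModel E) γ →L[ℝ] TangentSpace 𝓘(ℝ, E) γ.1 :=
  mfderiv (cotModel E) 𝓘(ℝ, E) (fun δ : Cotangent E M => δ.1) γ

/-- The vertical vector at `γ ∈ T*M` determined by a covector `ξ` at `π(γ)`: the velocity at
`t = 0` of the curve `t ↦ γ + t ξ`. -/
def vertLift (γ : Cotangent E M) (ξ : TangentSpace 𝓘(ℝ, E) γ.1 →L[ℝ] ℝ) :
    TangentSpace (cotModel E) γ :=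
  mfderiv 𝓘(ℝ, ℝ) (cotModel E)
    (fun t : ℝ => (⟨γ.1, γ.2 + t • ξ⟩ : Cotangent E M)) 0 (1 : ℝ)

/-- The fibrewise linear function `δ ↦ δ(Y)` on `T*M` defined by a vector field `Y` on `M`. -/
def fibLin (Y : VField E M) (δ : Cotangent E M) : ℝ := δ.2 (Y δ.1)

/-- `h ∈ T_γ(T*M)` is the `D`-horizontal lift of `X ∈ T_{π γ} M`: it projects to `X`, and it
differentiates the function `δ ↦ δ(Y)` to `γ(D_X Y)`, for any vector field `Y`. As the connection
induced on 1-forms is `(D_X ω)(Y) = X(ω(Y)) - ω(D_X Y)`, the differential of a 1-form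
`ω : M → T*M` maps `X` to a horizontal vector precisely when `D_X ω = 0` at the point. -/
def IsHorLift (D : LinearConnection E M) (γ : Cotangent E M)
    (X : TangentSpace 𝓘(ℝ, E) γ.1) (h : TangentSpace (cotModel E) γ) : Prop :=
  dProj γ h = X ∧
    ∀ Y : VField E M, mvfderiv (cotModel E) (fibLin Y) γ h = γ.2 (D.toFun Y γ.1 X)

/-- `v ∈ T_γ(T*M)` corresponds to `X + ξ` under the identification
`T_γ(T*M) = H^D_γ ⊕ T^vert_γ(T*M) = T_{π γ} M ⊕ T*_{π γ} M` determined by `D`. -/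
def Corresponds (D : LinearConnection E M) (γ : Cotangent E M)
    (v : TangentSpace (cotModel E) γ) (a : DoubleSpace (TangentSpace 𝓘(ℝ, E) γ.1)) : Prop :=
  ∃ h, IsHorLift D γ a.1 h ∧ v = h + vertLift γ a.2

/-- The almost complex structure `J^{𝒥, D} = π^*(𝒥)` on `T*M`: it maps a vector which corresponds
to `a = X + ξ` to the (unique) vector which corresponds to `𝒥 a`. -/
def cotACS {s : Kind} (𝒥 : GenCplxStructure E M s) (D : LinearConnection E M)
    (γ : Cotangent E M) (v : TangentSpace (cotModel E) γ) : TangentSpace (cotModel E) γ :=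
  Classical.epsilon fun w => ∃ a, Corresponds D γ v a ∧ Corresponds D γ w (𝒥.toFun γ.1 a)

end CotangentManifold

/-- Integrability of an almost complex structure `J` on a manifold `N`: its holomorphic bundle
(the `i`-eigenbundle of `J` in `T^ℂ N`) is involutive. A complex vector field is written `A + i B`
with `A`, `B` real vector fields; it is a section of the holomorphic bundle when `J A = -B` and
`J B = A`, and the bracket is extended complex bilinearly. -/
def IsIntegrable {E H N : Type*} [NormedAddCommGroup E] [NormedSpace ℝ E] [TopologicalSpace H]
    (I : ModelWithCorners ℝ E H) [TopologicalSpace N] [ChartedSpace H N] [IsManifold I ∞ N]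
    (J : ∀ p : N, TangentSpace I p → TangentSpace I p) : Prop :=
  ∀ A B A' B' : Cₛ^∞⟮I; E, fun p : N => TangentSpace I p⟯,
    (∀ p, J p (A p) = -B p ∧ J p (B p) = A p) →
    (∀ p, J p (A' p) = -B' p ∧ J p (B' p) = A' p) →
    ∀ p,
      J p (VectorField.mlieBracket I A A' p - VectorField.mlieBracket I B B' p)
          = -(VectorField.mlieBracket I A B' p + VectorField.mlieBracket I B A' p) ∧
        J p (VectorField.mlieBracket I A B' p + VectorField.mlieBracket I B A' p)
          = VectorField.mlieBracket I A A' p - VectorField.mlieBracket I B B' p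

/-! ## Lie groups -/

section LieGroups

variable {E : Type*} [NormedAddCommGroup E] [NormedSpace ℝ E]
  {G : Type*} [TopologicalSpace G] [ChartedSpace E G] [Group G] [LieGroup 𝓘(ℝ, E) ∞ G]

/-- A smooth Lie group has the regularity under which Mathlib defines its Lie algebra. -/
instance instLieGroupMinSmoothness : LieGroup 𝓘(ℝ, E) (minSmoothness ℝ 3) G := by
  rw [minSmoothness_of_isRCLikeNormedField]
  infer_instance

/-- The differential at `h` of the left translation by `g`. -/
def dLeft (g h : G) : TangentSpace 𝓘(ℝ, E) h →L[ℝ] TangentSpace 𝓘(ℝ, E) (g * h) :=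
  mfderiv 𝓘(ℝ, E) 𝓘(ℝ, E) (fun x : G => g * x) h

/-- Left-invariant vector fields. -/
def IsLeftInvariantVField (X : VField E G) : Prop := ∀ g h : G, dLeft g h (X h) = X (g * h)

/-- `𝒥` is left-invariant: it commutes with the action of left translations on `TG ⊕ T*G`. Here
`a ∈ T_h G ⊕ T*_h G` and `b ∈ T_{gh} G ⊕ T*_{gh} G` correspond to each other under the translation
by `g` when `b.1` is the image of `a.1` and `a.2` is the pull-back of `b.2`. -/
def IsLeftInvariantGenCplx {s : Kind} (𝒥 : GenCplxStructure E G s) : Prop :=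
  ∀ (g h : G) (X : TangentSpace 𝓘(ℝ, E) h) (η : TangentSpace 𝓘(ℝ, E) (g * h) →L[ℝ] ℝ),
    (𝒥.toFun (g * h) (dLeft g h X, η)).1 = dLeft g h (𝒥.toFun h (X, η.comp (dLeft g h))).1 ∧
      (𝒥.toFun (g * h) (dLeft g h X, η)).2.comp (dLeft g h)
        = (𝒥.toFun h (X, η.comp (dLeft g h))).2

/-- `D` is left-invariant: `D_X Y` is left-invariant when `X` and `Y` are so. -/
def IsLeftInvariantConnection (D : LinearConnection E G) : Prop :=
  ∀ X Y : VField E G, IsLeftInvariantVField X → IsLeftInvariantVField Y →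
    ∀ g h : G, dLeft g h (D.toFun Y h (X h)) = D.toFun Y (g * h) (X (g * h))

variable (E G) in
/-- Pairs `(𝒥, D)` formed by a left-invariant (symmetric, respectively skew-symmetric) generalized
complex structure and a left-invariant connection on `G`, such that `J^{𝒥, D}` is an integrable
almost complex structure on `T*G`. -/
@[ext]
structure IntegrablePair (s : Kind) where
  /-- The generalized complex structure. -/
  𝒥 : GenCplxStructure E G s
  /-- The connection. -/
  D : LinearConnection E G
  leftInvariant_𝒥 : IsLeftInvariantGenCplx 𝒥
  leftInvariant_D : IsLeftInvariantConnection D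
  integrable : IsIntegrable (cotModel E) (cotACS 𝒥 D)

end LieGroups

end GenCplx

end

/-! Left translation identifies T*G with G × 𝔤*. It turns `D` into a constant bilinear map `Γ` (the
values D_u v on left-invariant fields) and `𝒥` into a single endomorphism `J` of 𝔤 ⊕ 𝔤*. Each
element X + ξ of 𝔤 ⊕ 𝔤* defines a vector field on T*G: the horizontal lift of X plus the constant
vertical field ξ. In this frame J^{𝒥,D} is the constant endomorphism `J` (`frameCoord_cotACS`). At
momentum p the frame has the bracket [X + ξ, Y + η]_p = [X,Y] + ξ∘Γ_Y − η∘Γ_X + p∘([Γ_X,Γ_Y] −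
Γ_[X,Y]), whose last term is the curvature (`frameCoord_mlieBracket`). As `J` is constant, the
derivative terms in the bracket of two arbitrary sections of the i-eigenbundle remain in that
bundle. So integrability means exactly that the i-eigenspace L of `J` is closed, for every p, under
the complex bilinear extension of this bracket.

Write L = L^τ(𝔨, ε). The vector part of closedness says that 𝔨 is a subalgebra. The covector part,
evaluated on Z in τ(𝔨), reads ξ(Γ_Y Z) − η(Γ_X Z) + p(R(X,Y)Z) = ε([X,Y], Z). L contains every
covector that annihilates τ(𝔨). Taking Y = 0 and η such a covector gives Γ_𝔨 τ(𝔨) ⊂ τ(𝔨); varying p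
gives R = 0 on τ(𝔨); the rest is the equation for ε. The argument reverses (`exists_triple`,
`isClosedUnder_of_triple`).

The remainder is linear algebra at the identity. Compatibility of `J` with the metric makes L
isotropic up to τ, which is the skewness of ε, and subspaces of the form L^τ with ε skew are maximal
isotropic. When 𝔨 and its conjugate span, non-degeneracy of Im ε on Δ says that L contains no
nonzero real vector; then L is the graph {a − iJa} of a unique `J`
(`imNondegenerate_of_holSpace_eq`, `exists_isGenCplx`). -/

noncomputable section

namespace GenCplx

open Bundle

/-! ### Left trivialization of the tangent bundle -/

section Sections

set_option linter.unusedSectionVars false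

variable {E : Type*} [NormedAddCommGroup E] [NormedSpace ℝ E]
  {G : Type*} [TopologicalSpace G] [ChartedSpace E G] [Group G] [LieGroup 𝓘(ℝ, E) ∞ G]
  {EN HN N : Type*} [NormedAddCommGroup EN] [NormedSpace ℝ EN] [TopologicalSpace HN]
  {IN : ModelWithCorners ℝ EN HN} [TopologicalSpace N] [ChartedSpace HN N]

/-- Left translation of the tangent space at `1` to the tangent space at `g`, read in the model
space. -/
def ofLie (g : G) : E →L[ℝ] TangentSpace 𝓘(ℝ, E) g :=
  (mfderiv 𝓘(ℝ, E) 𝓘(ℝ, E) (fun x : G => g * x) 1 :)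

/-- The Maurer-Cartan form, read in the model space. -/
def toLie (g : G) : TangentSpace 𝓘(ℝ, E) g →L[ℝ] E :=
  (mfderiv 𝓘(ℝ, E) 𝓘(ℝ, E) (fun x : G => g⁻¹ * x) g :)

theorem mdifferentiableAt_mul_left (g h : G) :
    MDifferentiableAt 𝓘(ℝ, E) 𝓘(ℝ, E) (fun x : G => g * x) h :=
  (contMDiff_mul_left (I := 𝓘(ℝ, E)) (n := ∞)).mdifferentiableAt (by simp)

/-- Chain rule for a composite of left translations. The two sides live over the points `g * (h *
k)` and `g * h * k`, which are equal but not definitionally so; the equation is therefore read in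
`E`, to which every fibre unfolds. -/
theorem dLeft_dLeft (g h k : G) (v : TangentSpace 𝓘(ℝ, E) k) :
    (dLeft g (h * k) (dLeft h k v) : E) = (dLeft (g * h) k v : E) := by
  have := mfderiv_comp_apply (I := 𝓘(ℝ, E)) (I' := 𝓘(ℝ, E)) (I'' := 𝓘(ℝ, E)) k
    (mdifferentiableAt_mul_left (E := E) g (h * k)) (mdifferentiableAt_mul_left h k) v
  have h2 : (fun x : G => g * x) ∘ (fun x : G => h * x) = fun x => g * h * x := by
    ext x; simp [mul_assoc]
  rw [h2] at this
  exact this.symm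

theorem dLeft_one_apply (h : G) (v : TangentSpace 𝓘(ℝ, E) h) :
    (dLeft 1 h v : E) = v := by
  have h2 : (fun x : G => 1 * x) = id := by ext x; simp
  unfold dLeft
  rw [h2, mfderiv_id]
  rfl

theorem dLeft_congr (E : Type*) [NormedAddCommGroup E] [NormedSpace ℝ E] {G : Type*}
    [TopologicalSpace G] [ChartedSpace E G] [Group G] {g g' h h' : G} (hg : g = g') (hh : h = h') (v : E) :
    (dLeft g h (v : TangentSpace 𝓘(ℝ, E) h) : E) = (dLeft g' h' (v : TangentSpace 𝓘(ℝ, E) h') : E) := by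
  subst hg hh; rfl

theorem toLie_ofLie (g : G) (v : E) : toLie g (ofLie g v) = v := by
  have h1 := dLeft_dLeft (E := E) g⁻¹ g 1 v
  have h2 : (dLeft g⁻¹ (g * 1) (dLeft g 1 (v : TangentSpace 𝓘(ℝ, E) (1 : G))) : E)
    = toLie g (ofLie g v) := dLeft_congr E rfl (mul_one g) _
  rw [← h2, h1, dLeft_congr E (inv_mul_cancel g) rfl]
  exact dLeft_one_apply _ _

theorem ofLie_toLie (g : G) (v : TangentSpace 𝓘(ℝ, E) g) : ofLie (E := E) g (toLie g v) = v := by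
  have h1 := dLeft_dLeft (E := E) g g⁻¹ g v
  have h2 : (dLeft g (g⁻¹ * g) (dLeft g⁻¹ g v) : E)
    = ofLie (E := E) g (toLie g v) := dLeft_congr E rfl (inv_mul_cancel g) _
  have h3 := h2.symm.trans (h1.trans (dLeft_congr E (mul_inv_cancel g) rfl v))
  exact h3.trans (dLeft_one_apply _ _)

theorem dLeft_ofLie (g h : G) (v : E) : dLeft g h (ofLie h v) = ofLie (g * h) v := by
  have h1 := dLeft_dLeft (E := E) g h 1 v
  have h2 : (dLeft g (h * 1) (dLeft h 1 (v : TangentSpace 𝓘(ℝ, E) (1 : G))) : E)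
    = dLeft g h (ofLie h v) := dLeft_congr E rfl (mul_one h) _
  exact h2.symm.trans h1

theorem toLie_dLeft (g h : G) (v : TangentSpace 𝓘(ℝ, E) h) :
    toLie (g * h) (dLeft g h v) = toLie h v := by
  conv_lhs => rw [← ofLie_toLie h v]
  rw [dLeft_ofLie, toLie_ofLie]

theorem ofLie_one (v : E) : (ofLie (1 : G) v : E) = v := dLeft_one_apply (G := G) _ _

theorem toLie_one (v : TangentSpace 𝓘(ℝ, E) (1 : G)) : toLie (E := E) (1 : G) v = v :=
  (dLeft_congr E inv_one rfl v).trans (dLeft_one_apply _ _)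

theorem ofLie_injective (g : G) : Function.Injective (ofLie (E := E) g) :=
  Function.LeftInverse.injective (toLie_ofLie g)

theorem toLie_injective (g : G) : Function.Injective (toLie (E := E) g) :=
  Function.LeftInverse.injective (ofLie_toLie g)

/-- A map into the fibre of the tangent bundle over a fixed point is smooth precisely when it is
smooth as a map into the model space. -/
theorem contMDiffAt_fibre_iff {g : G} {w : N → E} {x₀ : N} {n : WithTop ℕ∞} :
    ContMDiffAt IN (𝓘(ℝ, E).prod 𝓘(ℝ, E)) n
      (fun x => TotalSpace.mk' E (E := fun x : G => TangentSpace 𝓘(ℝ, E) x) g (w x)) x₀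
      ↔ ContMDiffAt IN 𝓘(ℝ, E) n w x₀ := by
  rw [contMDiffAt_totalSpace]
  have : ∀ x, ((trivializationAt E (fun x : G => TangentSpace 𝓘(ℝ, E) x) g)
      (TotalSpace.mk' E (E := fun x : G => TangentSpace 𝓘(ℝ, E) x) g (w x))).2 = w x := by
    intro x
    exact (tangentBundleCore 𝓘(ℝ, E) G).coordChange_self (achart E g) g (mem_achart_source E g) _
  simp only [this]
  exact ⟨fun h => h.2, fun h => ⟨contMDiffAt_const, h⟩⟩

/-- Joint smoothness holds because translating `v` by `a` is the tangent map of the multiplication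
applied to the pair of the zero vector at `a` and `v`. -/
theorem contMDiffAt_dLeft {a b : N → G} {v : ∀ x, TangentSpace 𝓘(ℝ, E) (b x)} {x₀ : N}
    (ha : ContMDiffAt IN 𝓘(ℝ, E) ∞ a x₀)
    (hv : ContMDiffAt IN (𝓘(ℝ, E).prod 𝓘(ℝ, E)) ∞
      (fun x => TotalSpace.mk' E (E := fun x : G => TangentSpace 𝓘(ℝ, E) x) (b x) (v x)) x₀) :
    ContMDiffAt IN (𝓘(ℝ, E).prod 𝓘(ℝ, E)) ∞
      (fun x => TotalSpace.mk' E (E := fun x : G => TangentSpace 𝓘(ℝ, E) x) (a x * b x)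
        (dLeft (a x) (b x) (v x))) x₀ := by
  have h0 : ContMDiffAt IN (𝓘(ℝ, E).prod 𝓘(ℝ, E)) ∞
      (fun x => TotalSpace.mk' E (E := fun x : G => TangentSpace 𝓘(ℝ, E) x) (a x) 0) x₀ :=
    (contMDiff_zeroSection ℝ (fun x : G => TangentSpace 𝓘(ℝ, E) x)).contMDiffAt.comp x₀ ha
  have h1 := (contMDiff_equivTangentBundleProd_symm (I := 𝓘(ℝ, E)) (I' := 𝓘(ℝ, E)) (M := G)
    (M' := G) (n := ∞)).contMDiffAt.comp x₀ (h0.prodMk hv)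
  have h2 : ContMDiff _ _ ∞ (tangentMap (𝓘(ℝ, E).prod 𝓘(ℝ, E)) 𝓘(ℝ, E)
      (fun p : G × G => p.1 * p.2)) :=
    (contMDiff_mul 𝓘(ℝ, E) ∞).contMDiff_tangentMap (by simp)
  refine (h2.contMDiffAt.comp x₀ h1).congr_of_eventuallyEq (Filter.Eventually.of_forall fun x => ?_)
  simp only [Function.comp_apply, tangentMap]
  have h3 := mfderiv_prod_eq_add_apply (I := 𝓘(ℝ, E)) (I' := 𝓘(ℝ, E)) (I'' := 𝓘(ℝ, E))
    (p := (a x, b x)) (v := ((0, v x) : E × E))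
    ((contMDiff_mul 𝓘(ℝ, E) (G := G) ∞).mdifferentiableAt (by simp))
  have h4 : (dLeft (a x) (b x) (v x) : E) = mfderiv (𝓘(ℝ, E).prod 𝓘(ℝ, E)) 𝓘(ℝ, E)
      (fun p : G × G => p.1 * p.2) (a x, b x) ((0, v x) : E × E) := by
    refine Eq.trans ?_ h3.symm
    refine Eq.trans ?_ (congrArg₂ (· + ·) (map_zero _).symm rfl)
    exact (zero_add _).symm
  exact congrArg (TotalSpace.mk' E (a x * b x)) h4

theorem mk_congr {g h : G} (e : g = h) (w : E) :
    TotalSpace.mk' E (E := fun x : G => TangentSpace 𝓘(ℝ, E) x) g w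
      = TotalSpace.mk' E (E := fun x : G => TangentSpace 𝓘(ℝ, E) x) h w := by
  subst e; rfl

theorem contMDiffAt_ofLie {b : N → G} {w : N → E} {x₀ : N}
    (hb : ContMDiffAt IN 𝓘(ℝ, E) ∞ b x₀) (hw : ContMDiffAt IN 𝓘(ℝ, E) ∞ w x₀) :
    ContMDiffAt IN (𝓘(ℝ, E).prod 𝓘(ℝ, E)) ∞
      (fun x => TotalSpace.mk' E (E := fun x : G => TangentSpace 𝓘(ℝ, E) x) (b x)
        (ofLie (b x) (w x))) x₀ := by
  refine (contMDiffAt_dLeft hb (contMDiffAt_fibre_iff (g := (1 : G)).2 hw)).congr_of_eventuallyEq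
    (Filter.Eventually.of_forall fun x => ?_)
  exact mk_congr (mul_one (b x)).symm _

theorem contMDiffAt_toLie {b : N → G} {v : ∀ x, TangentSpace 𝓘(ℝ, E) (b x)} {x₀ : N}
    (hv : ContMDiffAt IN (𝓘(ℝ, E).prod 𝓘(ℝ, E)) ∞
      (fun x => TotalSpace.mk' E (E := fun x : G => TangentSpace 𝓘(ℝ, E) x) (b x) (v x)) x₀) :
    ContMDiffAt IN 𝓘(ℝ, E) ∞ (fun x => toLie (b x) (v x)) x₀ := by
  have hb : ContMDiffAt IN 𝓘(ℝ, E) ∞ b x₀ := (contMDiffAt_totalSpace.1 hv).1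
  rw [← contMDiffAt_fibre_iff (g := (1 : G))]
  -- Translation by `(b x)⁻¹` brings every vector into the single fibre over `1`, where smoothness
  -- is ordinary smoothness in `E`.
  refine (contMDiffAt_dLeft hb.inv hv).congr_of_eventuallyEq
    (Filter.Eventually.of_forall fun x => ?_)
  exact mk_congr (inv_mul_cancel (b x)).symm _

end Sections

end GenCplx

namespace GenCplx

open Bundle

/-! ### Left trivialization of the cotangent bundle -/

section OneForms

set_option linter.unusedSectionVars false

variable {E : Type*} [NormedAddCommGroup E] [NormedSpace ℝ E]
  {G : Type*} [TopologicalSpace G] [ChartedSpace E G] [Group G] [LieGroup 𝓘(ℝ, E) ∞ G]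
  {EN HN N : Type*} [NormedAddCommGroup EN] [NormedSpace ℝ EN] [TopologicalSpace HN]
  {IN : ModelWithCorners ℝ EN HN} [TopologicalSpace N] [ChartedSpace HN N]

/-- A basis of `F` identifies the linear maps on `F` with finite tuples in `F'`, so smoothness can
be checked on the basis vectors. -/
theorem contMDiffAt_clm_of_apply {F F' : Type*} [NormedAddCommGroup F] [NormedSpace ℝ F]
    [FiniteDimensional ℝ F] [NormedAddCommGroup F'] [NormedSpace ℝ F'] {n : WithTop ℕ∞}
    {f : N → F →L[ℝ] F'} {x₀ : N}
    (h : ∀ y, ContMDiffAt IN 𝓘(ℝ, F') n (fun x => f x y) x₀) :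
    ContMDiffAt IN 𝓘(ℝ, F →L[ℝ] F') n f x₀ := by
  let d := Module.finrank ℝ F
  have hd : d = Module.finrank ℝ (Fin d → ℝ) := (Module.finrank_fin_fun ℝ).symm
  let e₁ := ContinuousLinearEquiv.ofFinrankEq hd
  let e₂ := (e₁.arrowCongr (1 : F' ≃L[ℝ] F')).trans (ContinuousLinearEquiv.piRing (Fin d))
  have h1 : ContMDiffAt IN 𝓘(ℝ, Fin d → F') n (fun x => e₂ (f x)) x₀ := by
    rw [contMDiffAt_pi_space]
    exact fun i => h _
  have h2 := (e₂.symm.contDiff (n := n)).contMDiff.contMDiffAt.comp x₀ h1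
  refine h2.congr_of_eventuallyEq (Filter.Eventually.of_forall fun x => ?_)
  simp

theorem contMDiffAt_comp_toLie {b : N → G} {p : N → E →L[ℝ] ℝ} {x₀ : N} [IsManifold IN 1 N]
    (hb : ContMDiffAt IN 𝓘(ℝ, E) ∞ b x₀) (hp : ContMDiffAt IN 𝓘(ℝ, E →L[ℝ] ℝ) ∞ p x₀) :
    ContMDiffAt IN (𝓘(ℝ, E).prod 𝓘(ℝ, E →L[ℝ] ℝ)) ∞
      (fun x => TotalSpace.mk' (E →L[ℝ] ℝ)
        (E := fun x : G => TangentSpace 𝓘(ℝ, E) x →L[ℝ] ℝ) (b x) ((p x).comp (toLie (b x)))) x₀ := by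
  rw [contMDiffAt_hom_bundle]
  refine ⟨hb, ?_⟩
  -- `toLie (b x)` is the derivative at `y = b x` of the family `y ↦ (b x)⁻¹ * y`; joint smoothness
  -- of the family makes that derivative smooth in `x`.
  have h1 : ContMDiffAt (IN.prod 𝓘(ℝ, E)) 𝓘(ℝ, E) ∞
      (Function.uncurry fun (x : N) (y : G) => (b x)⁻¹ * y) (x₀, b x₀) := by
    have hb' : ContMDiffAt (IN.prod 𝓘(ℝ, E)) 𝓘(ℝ, E) ∞ (fun z : N × G => b z.1) (x₀, b x₀) :=
      ContMDiffAt.comp (I' := IN) (g := b) (x₀, b x₀) hb contMDiffAt_fst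
    exact hb'.inv.mul contMDiffAt_snd
  have h2 := ContMDiffAt.mfderiv (m := ∞) (fun (x : N) (y : G) => (b x)⁻¹ * y) b h1 hb (by simp)
  have h3 : ContMDiffAt IN 𝓘(ℝ, E →L[ℝ] ℝ) ∞ (fun x => (p x).comp
      (inTangentCoordinates 𝓘(ℝ, E) 𝓘(ℝ, E) b (fun x => (b x)⁻¹ * b x) (fun x => mfderiv 𝓘(ℝ, E) 𝓘(ℝ, E) (fun y : G => (b x)⁻¹ * y) (b x)) x₀ x)) x₀ :=
    hp.clm_comp h2
  refine h3.congr_of_eventuallyEq (Filter.Eventually.of_forall fun x => ?_)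
  ext v
  simp only [ContinuousLinearMap.inCoordinates, inTangentCoordinates,
    ContinuousLinearMap.comp_apply]
  -- The translated point is always `1`, so the target trivialization is evaluated at its own base
  -- point, where it is the identity.
  have h4 : ∀ {g h : G} (_ : g = h) (_ : g = 1) (w : E),
      ((trivializationAt E (TangentSpace 𝓘(ℝ, E)) h).continuousLinearMapAt ℝ g w : E) = w := by
    intro g h e _ w
    subst e
    rw [TangentBundle.continuousLinearMapAt_trivializationAt_eq_core (mem_chart_source E g)]
    exact (tangentBundleCore 𝓘(ℝ, E) G).coordChange_self (achart E g) g (mem_achart_source E g) _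
  have h5 : ∀ (g h : G) (y : ℝ),
      (trivializationAt ℝ (Trivial G ℝ) g).continuousLinearMapAt ℝ h y = y := by
    intro g h y
    exact DFunLike.congr_fun (Trivial.continuousLinearMapAt_trivialization ℝ G ℝ h) y
  refine (h5 _ _ _).trans ?_
  exact congrArg (p x) (h4 ((inv_mul_cancel (b x)).trans (inv_mul_cancel (b x₀)).symm)
    (inv_mul_cancel _) _).symm

theorem contMDiffAt_comp_ofLie [FiniteDimensional ℝ E]
    {b : N → G} {ξ : ∀ x, TangentSpace 𝓘(ℝ, E) (b x) →L[ℝ] ℝ} {x₀ : N}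
    (hξ : ContMDiffAt IN (𝓘(ℝ, E).prod 𝓘(ℝ, E →L[ℝ] ℝ)) ∞
      (fun x => TotalSpace.mk' (E →L[ℝ] ℝ)
        (E := fun x : G => TangentSpace 𝓘(ℝ, E) x →L[ℝ] ℝ) (b x) (ξ x)) x₀) :
    ContMDiffAt IN 𝓘(ℝ, E →L[ℝ] ℝ) ∞ (fun x => (ξ x).comp (ofLie (b x))) x₀ := by
  have hb : ContMDiffAt IN 𝓘(ℝ, E) ∞ b x₀ := (contMDiffAt_totalSpace.1 hξ).1
  refine contMDiffAt_clm_of_apply fun v => ?_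
  have h1 := ContMDiffAt.clm_bundle_apply (E₂ := Trivial G ℝ) hξ
    (contMDiffAt_ofLie hb (contMDiffAt_const (c := v)))
  exact (contMDiffAt_totalSpace.1 h1).2

end OneForms

end GenCplx

namespace GenCplx

open Bundle VectorField

/-! ### Vector fields as derivations on a manifold -/

section Derivation

variable {EN HN N : Type*} [NormedAddCommGroup EN] [NormedSpace ℝ EN] [TopologicalSpace HN]
  {IN : ModelWithCorners ℝ EN HN} [TopologicalSpace N] [ChartedSpace HN N]
  {F F' : Type*} [NormedAddCommGroup F] [NormedSpace ℝ F] [NormedAddCommGroup F']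
  [NormedSpace ℝ F']

theorem mvfderiv_clm_apply {f : N → F →L[ℝ] F'} {y : N → F} {x : N}
    (hf : MDifferentiableAt IN 𝓘(ℝ, F →L[ℝ] F') f x) (hy : MDifferentiableAt IN 𝓘(ℝ, F) y x)
    (v : TangentSpace IN x) :
    mvfderiv IN (fun z => f z (y z)) x v = mvfderiv IN f x v (y x) + f x (mvfderiv IN y x v) := by
  let A : EN →L[ℝ] F := mvfderiv IN y x
  let B : EN →L[ℝ] F →L[ℝ] F' := mvfderiv IN f x
  have h : HasMFDerivAt IN 𝓘(ℝ, F') (fun z => f z (y z)) x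
      ((f x).comp A + B.flip (y x)) :=
by
    refine ⟨hf.continuousAt.clm_apply hy.continuousAt, ?_⟩
    have h3 := hf.hasMFDerivAt.2.clm_apply hy.hasMFDerivAt.2
    -- The product rule is applied in the chart at `x`, so the values of `f` and `y` appear at the
    -- round trip of `x` through the chart.
    change HasFDerivWithinAt _ ((f ((extChartAt IN x).symm (extChartAt IN x x))).comp A
      + B.flip (y ((extChartAt IN x).symm (extChartAt IN x x)))) _ _ at h3
    rw [extChartAt_to_inv] at h3
    exact h3
  have h2 := congrArg (fun L : TangentSpace IN x →L[ℝ] F' => L v) h.mfderiv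
  refine Eq.trans h2 ?_
  exact add_comm _ _

theorem mvfderiv_clm_comp (L : F →L[ℝ] F') {f : N → F} {x : N}
    (hf : MDifferentiableAt IN 𝓘(ℝ, F) f x) (v : TangentSpace IN x) :
    mvfderiv IN (fun z => L (f z)) x v = L (mvfderiv IN f x v) := by
  rw [mvfderiv_clm_apply (f := fun _ => L) mdifferentiableAt_const hf, mvfderiv_const]
  simp

theorem mvfderiv_comp_mfderiv {EM HM M : Type*} [NormedAddCommGroup EM] [NormedSpace ℝ EM]
    [TopologicalSpace HM] {IM : ModelWithCorners ℝ EM HM} [TopologicalSpace M] [ChartedSpace HM M]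
    {f : M → F} {b : N → M} {x : N} (hf : MDifferentiableAt IM 𝓘(ℝ, F) f (b x))
    (hb : MDifferentiableAt IN IM b x) (v : TangentSpace IN x) :
    mvfderiv IN (fun z => f (b z)) x v = mvfderiv IM f (b x) (mfderiv IN IM b x v) :=
  mfderiv_comp_apply x hf hb v

theorem contMDiffAt_mvfderiv_apply [IsManifold IN ∞ N] {f : N → F}
    {V : ∀ x : N, TangentSpace IN x} {x : N}
    (hf : ContMDiffAt IN 𝓘(ℝ, F) ∞ f x)
    (hV : ContMDiffAt IN (IN.prod 𝓘(ℝ, EN)) ∞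
      (fun x => TotalSpace.mk' EN (E := fun x : N => TangentSpace IN x) x (V x)) x) :
    ContMDiffAt IN 𝓘(ℝ, F) ∞ (fun x => mvfderiv IN f x (V x)) x := by
  have h1 := hf.mfderiv_const (m := ∞) (by simp)
  have h2 := ContMDiffAt.clm_apply_of_inCoordinates (b₁ := id) (b₂ := f) h1 hV hf
  exact (contMDiff_snd_tangentBundle_modelSpace F 𝓘(ℝ, F)).contMDiffAt.comp x h2

variable [CompleteSpace EN] [IsManifold IN ∞ N]

/-- The Leibniz rule is needed as an equality of germs, since its right side gets bracketed once
more. -/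
theorem mlieBracket_smul_right_smooth {f : N → ℝ} {V U : ∀ x : N, TangentSpace IN x} {x : N}
    (hf : ContMDiffAt IN 𝓘(ℝ, ℝ) ∞ f x)
    (hU : ContMDiff IN (IN.prod 𝓘(ℝ, EN)) ∞
      (fun x => TotalSpace.mk' EN (E := fun x : N => TangentSpace IN x) x (U x))) :
    mlieBracket IN V (f • U) =ᶠ[nhds x]
      (fun x => mvfderiv IN f x (V x)) • U + f • mlieBracket IN V U := by
  have h2 : ContMDiffAt IN 𝓘(ℝ, ℝ) 1 f x := hf.of_le (by simp)
  filter_upwards [(contMDiffAt_iff_contMDiffAt_nhds (by simp)).1 h2] with y hy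
  exact mlieBracket_smul_right (hy.mdifferentiableAt (by simp)) (hU.mdifferentiableAt (by simp))

/-- The commutator formula is a consequence of the Jacobi identity: expand it for `V`, `W`, `f • U`
by the Leibniz rule and subtract `f` times the identity for `V`, `W`, `U`. Only the second
derivatives of `f` times `U` are left. -/
theorem mvfderiv_mlieBracket_smul {f : N → ℝ} {V W U : ∀ x : N, TangentSpace IN x} {x : N}
    (hf : ContMDiffAt IN 𝓘(ℝ, ℝ) ∞ f x)
    (hV : ContMDiff IN (IN.prod 𝓘(ℝ, EN)) ∞
      (fun x => TotalSpace.mk' EN (E := fun x : N => TangentSpace IN x) x (V x)))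
    (hW : ContMDiff IN (IN.prod 𝓘(ℝ, EN)) ∞
      (fun x => TotalSpace.mk' EN (E := fun x : N => TangentSpace IN x) x (W x)))
    (hU : ContMDiff IN (IN.prod 𝓘(ℝ, EN)) ∞
      (fun x => TotalSpace.mk' EN (E := fun x : N => TangentSpace IN x) x (U x))) :
    mvfderiv IN f x (mlieBracket IN V W x) • U x
      = (mvfderiv IN (fun y => mvfderiv IN f y (W y)) x (V x)
        - mvfderiv IN (fun y => mvfderiv IN f y (V y)) x (W x)) • U x := by
  have hM3 : IsManifold IN (minSmoothness ℝ 3) N := by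
    rw [minSmoothness_of_isRCLikeNormedField]; exact IsManifold.of_le (n := ∞) (WithTop.coe_le_coe.2 (le_top : (3 : ℕ∞) ≤ ⊤))
  have hM : IsManifold IN ((⊤ : ℕ∞) + 1) N := by simpa using! ‹IsManifold IN ∞ N›
  have le2 : minSmoothness ℝ 2 ≤ ∞ := by
    rw [minSmoothness_of_isRCLikeNormedField]; exact WithTop.coe_le_coe.2 (le_top : (2 : ℕ∞) ≤ ⊤)
  have hfU : ContMDiffAt IN (IN.prod 𝓘(ℝ, EN)) ∞
      (fun x => TotalSpace.mk' EN (E := fun x : N => TangentSpace IN x) x ((f • U) x)) x :=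
    hf.smul_section hU.contMDiffAt
  have br : ∀ {A B : ∀ x : N, TangentSpace IN x},
      ContMDiff IN (IN.prod 𝓘(ℝ, EN)) ∞
        (fun x => TotalSpace.mk' EN (E := fun x : N => TangentSpace IN x) x (A x)) →
      ContMDiff IN (IN.prod 𝓘(ℝ, EN)) ∞
        (fun x => TotalSpace.mk' EN (E := fun x : N => TangentSpace IN x) x (B x)) →
      ContMDiff IN (IN.prod 𝓘(ℝ, EN)) ∞
        (fun x => TotalSpace.mk' EN (E := fun x : N => TangentSpace IN x) x
          (mlieBracket IN A B x)) := fun hA hB =>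
    ContDiff.mlieBracket_vectorField (m := ⊤) (n := ⊤) hA hB (by simp)
  have hd : ∀ {A : ∀ x : N, TangentSpace IN x},
      ContMDiff IN (IN.prod 𝓘(ℝ, EN)) ∞
        (fun x => TotalSpace.mk' EN (E := fun x : N => TangentSpace IN x) x (A x)) →
      ContMDiffAt IN 𝓘(ℝ, ℝ) ∞ (fun x => mvfderiv IN f x (A x)) x := fun hA =>
    contMDiffAt_mvfderiv_apply hf hA.contMDiffAt
  have second : ∀ {A B : ∀ x : N, TangentSpace IN x},
      ContMDiff IN (IN.prod 𝓘(ℝ, EN)) ∞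
        (fun x => TotalSpace.mk' EN (E := fun x : N => TangentSpace IN x) x (A x)) →
      ContMDiff IN (IN.prod 𝓘(ℝ, EN)) ∞
        (fun x => TotalSpace.mk' EN (E := fun x : N => TangentSpace IN x) x (B x)) →
      mlieBracket IN A (mlieBracket IN B (f • U)) x
        = (mvfderiv IN (fun y => mvfderiv IN f y (B y)) x (A x) • U x
          + mvfderiv IN f x (B x) • mlieBracket IN A U x)
        + (mvfderiv IN f x (A x) • mlieBracket IN B U x
          + f x • mlieBracket IN A (mlieBracket IN B U) x) := by
    intro A B hA hB
    rw [Filter.EventuallyEq.mlieBracket_vectorField_eq (Filter.EventuallyEq.refl _ A)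
      (mlieBracket_smul_right_smooth (V := B) hf hU), mlieBracket_add_right,
      mlieBracket_smul_right, mlieBracket_smul_right]
    · exact hf.mdifferentiableAt (by simp)
    · exact (br hB hU).mdifferentiableAt (by simp)
    · exact (hd hB).mdifferentiableAt (by simp)
    · exact hU.mdifferentiableAt (by simp)
    · exact ((hd hB).smul_section hU.contMDiffAt).mdifferentiableAt (by simp)
    · exact (hf.smul_section (br hB hU).contMDiffAt).mdifferentiableAt (by simp)
  have j1 := leibniz_identity_mlieBracket_apply (I := IN) (U := V) (V := W) (W := f • U) (x := x)
    (hV.contMDiffAt.of_le le2) (hW.contMDiffAt.of_le le2) (hfU.of_le le2)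
  have j2 := leibniz_identity_mlieBracket_apply (I := IN) (U := V) (V := W) (W := U) (x := x)
    (hV.contMDiffAt.of_le le2) (hW.contMDiffAt.of_le le2) (hU.contMDiffAt.of_le le2)
  rw [second hV hW, second hW hV, (mlieBracket_smul_right_smooth hf hU).eq_of_nhds, j2] at j1
  simp only [Pi.add_apply, Pi.smul_apply', smul_add] at j1
  rw [sub_smul]
  generalize mvfderiv IN (fun y => mvfderiv IN f y (W y)) x (V x) • U x = a at *
  generalize mvfderiv IN (fun y => mvfderiv IN f y (V y)) x (W x) • U x = b at *
  rw [← sub_eq_zero] at j1 ⊢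
  rw [← neg_eq_zero, ← j1]
  abel

/-- Vector fields act on functions as derivations, and the Lie bracket acts as their commutator. -/
theorem mvfderiv_mlieBracket {f : N → ℝ} {V W : ∀ x : N, TangentSpace IN x} {x : N}
    (hf : ContMDiffAt IN 𝓘(ℝ, ℝ) ∞ f x)
    (hV : ContMDiff IN (IN.prod 𝓘(ℝ, EN)) ∞
      (fun x => TotalSpace.mk' EN (E := fun x : N => TangentSpace IN x) x (V x)))
    (hW : ContMDiff IN (IN.prod 𝓘(ℝ, EN)) ∞
      (fun x => TotalSpace.mk' EN (E := fun x : N => TangentSpace IN x) x (W x))) :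
    mvfderiv IN f x (mlieBracket IN V W x)
      = mvfderiv IN (fun y => mvfderiv IN f y (W y)) x (V x)
        - mvfderiv IN (fun y => mvfderiv IN f y (V y)) x (W x) := by
  -- The auxiliary field `U` must not vanish at `x` to be cancelled; `V` or `W` serves, and if both
  -- vanish at `x` then so does their bracket.
  by_cases h1 : V x = 0
  · by_cases h2 : W x = 0
    · rw [← mlieBracketWithin_univ, mlieBracketWithin_eq_zero_of_eq_zero h1 h2, h1, h2]
      simp
    · exact smul_left_injective ℝ h2 (mvfderiv_mlieBracket_smul hf hV hW hW)
  · exact smul_left_injective ℝ h1 (mvfderiv_mlieBracket_smul hf hV hW hV)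

/-- The commutator formula for functions with values in a normed space. -/
theorem mvfderiv_mlieBracket_vector {f : N → F} {V W : ∀ x : N, TangentSpace IN x} {x : N}
    (hf : ContMDiffAt IN 𝓘(ℝ, F) ∞ f x)
    (hV : ContMDiff IN (IN.prod 𝓘(ℝ, EN)) ∞
      (fun x => TotalSpace.mk' EN (E := fun x : N => TangentSpace IN x) x (V x)))
    (hW : ContMDiff IN (IN.prod 𝓘(ℝ, EN)) ∞
      (fun x => TotalSpace.mk' EN (E := fun x : N => TangentSpace IN x) x (W x))) :
    mvfderiv IN f x (mlieBracket IN V W x)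
      = mvfderiv IN (fun y => mvfderiv IN f y (W y)) x (V x)
        - mvfderiv IN (fun y => mvfderiv IN f y (V y)) x (W x) := by
  -- Continuous linear functionals separate points and commute with differentiation, which reduces
  -- the claim to real-valued functions.
  refine (SeparatingDual.eq_iff_forall_dual_eq (R := ℝ)).2 fun L => ?_
  have hL : ContMDiffAt IN 𝓘(ℝ, ℝ) ∞ (fun z => L (f z)) x :=
    L.contMDiff.contMDiffAt.comp x hf
  have h := mvfderiv_mlieBracket hL hV hW
  have key : ∀ {A B : ∀ x : N, TangentSpace IN x},
      ContMDiff IN (IN.prod 𝓘(ℝ, EN)) ∞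
        (fun x => TotalSpace.mk' EN (E := fun x : N => TangentSpace IN x) x (A x)) →
      mvfderiv IN (fun y => mvfderiv IN (fun z => L (f z)) y (A y)) x (B x)
        = L (mvfderiv IN (fun y => mvfderiv IN f y (A y)) x (B x)) := by
    intro A B hA
    have hev : (fun y => mvfderiv IN (fun z => L (f z)) y (A y))
        =ᶠ[nhds x] fun y => L (mvfderiv IN f y (A y)) := by
      have h2 : ContMDiffAt IN 𝓘(ℝ, F) 1 f x := hf.of_le (by simp)
      filter_upwards [(contMDiffAt_iff_contMDiffAt_nhds (by simp)).1 h2] with y hy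
      exact mvfderiv_clm_comp L (hy.mdifferentiableAt (by simp)) _
    rw [← mvfderiv_clm_comp L
      ((contMDiffAt_mvfderiv_apply hf hA.contMDiffAt).mdifferentiableAt (by simp))]
    unfold mvfderiv at hev ⊢
    exact congrArg (fun T : TangentSpace IN x →L[ℝ] ℝ => T (B x)) hev.mfderiv_eq
  rw [key hW, key hV, mvfderiv_clm_comp L (hf.mdifferentiableAt (by simp))] at h
  rw [h, map_sub]

end Derivation

end GenCplx

namespace GenCplx

open Bundle VectorField

/-! ### The Maurer-Cartan equation for maps into the group -/

section MaurerCartan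

set_option linter.unusedSectionVars false

variable {E : Type*} [NormedAddCommGroup E] [NormedSpace ℝ E] [FiniteDimensional ℝ E]
  {G : Type*} [TopologicalSpace G] [ChartedSpace E G] [Group G] [LieGroup 𝓘(ℝ, E) ∞ G]
  {EN HN N : Type*} [NormedAddCommGroup EN] [NormedSpace ℝ EN] [TopologicalSpace HN]
  {IN : ModelWithCorners ℝ EN HN} [TopologicalSpace N] [ChartedSpace HN N]
  [CompleteSpace EN] [IsManifold IN ∞ N]

theorem mvfderiv_congr {F : Type*} [NormedAddCommGroup F] [NormedSpace ℝ F] {f f' : N → F} {x : N}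
    (h : f =ᶠ[nhds x] f') (v : TangentSpace IN x) : mvfderiv IN f x v = mvfderiv IN f' x v := by
  unfold mvfderiv
  exact congrArg (fun T : TangentSpace IN x →L[ℝ] F => T v) h.mfderiv_eq

variable (G) in
/-- The Lie bracket of the Lie algebra of `G`, read in the model space. -/
def lieE (u v : E) : E :=
  Bracket.bracket (L := GroupLieAlgebra 𝓘(ℝ, E) G) (M := GroupLieAlgebra 𝓘(ℝ, E) G) u v

theorem contMDiff_leftInvariant (v : E) : ContMDiff 𝓘(ℝ, E) (𝓘(ℝ, E).prod 𝓘(ℝ, E)) ∞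
    (fun g => TotalSpace.mk' E (E := fun x : G => TangentSpace 𝓘(ℝ, E) x) g (ofLie g v)) :=
  fun _ => contMDiffAt_ofLie contMDiffAt_id contMDiffAt_const

theorem mlieBracket_ofLie (u v : E) (g : G) :
    mlieBracket 𝓘(ℝ, E) (fun g : G => ofLie g u) (fun g : G => ofLie g v) g
      = ofLie g (lieE G u v) :=
  (congrFun (mulInvariantVector_mlieBracket (I := 𝓘(ℝ, E)) (G := G) u v) g).symm

/-- The Maurer-Cartan form pulled back by `b : N → G`, evaluated on a vector field. -/
def pullMC (E : Type*) [NormedAddCommGroup E] [NormedSpace ℝ E] {G : Type*} [TopologicalSpace G]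
    [ChartedSpace E G] [Group G] (IN : ModelWithCorners ℝ EN HN) (b : N → G) (A : ∀ x : N, TangentSpace IN x) (x : N) :
    E :=
  toLie (b x) (mfderiv IN 𝓘(ℝ, E) b x (A x))

theorem contMDiff_pullMC {b : N → G} {A : ∀ x : N, TangentSpace IN x}
    (hb : ContMDiff IN 𝓘(ℝ, E) ∞ b)
    (hA : ContMDiff IN (IN.prod 𝓘(ℝ, EN)) ∞
      (fun x => TotalSpace.mk' EN (E := fun x : N => TangentSpace IN x) x (A x))) :
    ContMDiff IN 𝓘(ℝ, E) ∞ (pullMC E IN b A) := fun x =>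
  contMDiffAt_toLie (b := b) ((hb.contMDiff_tangentMap (m := ∞) (by simp)).comp hA).contMDiffAt

/-- The Maurer-Cartan equation. -/
theorem pullMC_mlieBracket {b : N → G} {A B : ∀ x : N, TangentSpace IN x}
    (hb : ContMDiff IN 𝓘(ℝ, E) ∞ b)
    (hA : ContMDiff IN (IN.prod 𝓘(ℝ, EN)) ∞
      (fun x => TotalSpace.mk' EN (E := fun x : N => TangentSpace IN x) x (A x)))
    (hB : ContMDiff IN (IN.prod 𝓘(ℝ, EN)) ∞
      (fun x => TotalSpace.mk' EN (E := fun x : N => TangentSpace IN x) x (B x))) (x : N) :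
    pullMC E IN b (mlieBracket IN A B) x
      = mvfderiv IN (pullMC E IN b B) x (A x) - mvfderiv IN (pullMC E IN b A) x (B x)
        + lieE G (pullMC E IN b A x) (pullMC E IN b B x) := by
  have hcE : CompleteSpace E := FiniteDimensional.complete ℝ E
  set φ : G → E := ⇑(extChartAt 𝓘(ℝ, E) (b x)) with hφdef
  have hφ : ContMDiffAt 𝓘(ℝ, E) 𝓘(ℝ, E) ∞ φ (b x) := contMDiffAt_extChartAt
  have hφb : ContMDiffAt IN 𝓘(ℝ, E) ∞ (fun y => φ (b y)) x := hφ.comp x hb.contMDiffAt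
  -- `P` expresses the left-invariant frame in the chart `φ`, so the derivative of `φ ∘ b` along a
  -- field is `P` applied to the pulled-back Maurer-Cartan form. Both sides of the equation are
  -- compared after applying `P (b x)`.
  let P : G → E →L[ℝ] E := fun g => (mvfderiv 𝓘(ℝ, E) φ g).comp (ofLie g)
  have hP : ContMDiffAt 𝓘(ℝ, E) 𝓘(ℝ, E →L[ℝ] E) ∞ P (b x) :=
    contMDiffAt_clm_of_apply fun v =>
      contMDiffAt_mvfderiv_apply hφ (contMDiff_leftInvariant v).contMDiffAt
  have hPd : MDifferentiableAt 𝓘(ℝ, E) 𝓘(ℝ, E →L[ℝ] E) P (b x) := hP.mdifferentiableAt (by simp)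
  have hbd : ∀ y, MDifferentiableAt IN 𝓘(ℝ, E) b y := fun y => hb.mdifferentiableAt (by simp)
  have hφ1 : ∀ᶠ y in nhds x, MDifferentiableAt 𝓘(ℝ, E) 𝓘(ℝ, E) φ (b y) := by
    have h2 : ContMDiffAt 𝓘(ℝ, E) 𝓘(ℝ, E) 1 φ (b x) := hφ.of_le (by simp)
    have h3 := (contMDiffAt_iff_contMDiffAt_nhds (by simp)).1 h2
    filter_upwards [hb.continuous.continuousAt.eventually h3] with y hy
    exact hy.mdifferentiableAt (by simp)
  have first : ∀ (C : ∀ x : N, TangentSpace IN x),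
      (fun y => mvfderiv IN (fun z => φ (b z)) y (C y)) =ᶠ[nhds x]
        fun y => P (b y) (pullMC E IN b C y) := by
    intro C
    filter_upwards [hφ1] with y hy
    rw [mvfderiv_comp_mfderiv hy (hbd y)]
    exact congrArg (mvfderiv 𝓘(ℝ, E) φ (b y)) (ofLie_toLie _ _).symm
  have second : ∀ {C C' : ∀ x : N, TangentSpace IN x},
      ContMDiff IN (IN.prod 𝓘(ℝ, EN)) ∞
        (fun x => TotalSpace.mk' EN (E := fun x : N => TangentSpace IN x) x (C x)) →
      mvfderiv IN (fun y => mvfderiv IN (fun z => φ (b z)) y (C y)) x (C' x)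
        = mvfderiv 𝓘(ℝ, E) P (b x) (ofLie (b x) (pullMC E IN b C' x)) (pullMC E IN b C x)
          + P (b x) (mvfderiv IN (pullMC E IN b C) x (C' x)) := by
    intro C C' hC
    rw [mvfderiv_congr (first C),
      mvfderiv_clm_apply (f := fun y => P (b y)) (hPd.comp x (hbd x))
        ((contMDiff_pullMC hb hC).mdifferentiableAt (by simp)),
      mvfderiv_comp_mfderiv hPd (hbd x)]
    congr 3
    exact (ofLie_toLie _ _).symm
  -- The commutator formula on `G` itself, for two left-invariant fields: the antisymmetrized
  -- derivative of `P` is the Lie bracket.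
  have third : ∀ u v : E, P (b x) (lieE G u v)
      = mvfderiv 𝓘(ℝ, E) P (b x) (ofLie (b x) u) v - mvfderiv 𝓘(ℝ, E) P (b x) (ofLie (b x) v) u := by
    intro u v
    have h := mvfderiv_mlieBracket_vector hφ (contMDiff_leftInvariant u)
      (contMDiff_leftInvariant v)
    rw [mlieBracket_ofLie] at h
    have h4 : ∀ u v : E, mvfderiv 𝓘(ℝ, E) (fun y => mvfderiv 𝓘(ℝ, E) φ y (ofLie y v)) (b x)
        (ofLie (b x) u) = mvfderiv 𝓘(ℝ, E) P (b x) (ofLie (b x) u) v := by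
      intro u v
      have := mvfderiv_clm_apply hPd (mdifferentiableAt_const (c := v)) (ofLie (b x) u)
      rw [mvfderiv_const] at this
      refine this.trans ?_
      simp
    rw [h4, h4] at h
    exact h
  have main := mvfderiv_mlieBracket_vector hφb hA hB
  rw [second hA, second hB, (first _).eq_of_nhds] at main
  have hinj : Function.Injective (P (b x)) := by
    have h1 : Function.Injective (mvfderiv 𝓘(ℝ, E) φ (b x)) :=
      (isInvertible_mfderiv_extChartAt (I := 𝓘(ℝ, E)) (mem_extChartAt_source (b x))).injective
    exact h1.comp (ofLie_injective _)
  apply hinj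
  rw [main, map_add, map_sub, third]
  abel

end MaurerCartan

end GenCplx

namespace GenCplx

open Bundle VectorField

/-! ### The cotangent manifold as `G × 𝔤*` -/

section CotangentTriv

set_option linter.unusedSectionVars false

variable {E : Type*} [NormedAddCommGroup E] [NormedSpace ℝ E] [FiniteDimensional ℝ E]
  {G : Type*} [TopologicalSpace G] [ChartedSpace E G] [Group G] [LieGroup 𝓘(ℝ, E) ∞ G]

/-- The left-invariant momentum `γ ↦ γ ∘ dL_g` of a covector `γ` at `g`. -/
def momentum (γ : Cotangent E G) : E →L[ℝ] ℝ := γ.2.comp (ofLie γ.1)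

/-- The covector at `g` with momentum `p`. -/
def cotOf (z : G × (E →L[ℝ] ℝ)) : Cotangent E G := ⟨z.1, z.2.comp (toLie z.1)⟩

/-- The left trivialization `T*G → G × 𝔤*`. -/
def cotTriv (γ : Cotangent E G) : G × (E →L[ℝ] ℝ) := (γ.1, momentum γ)

theorem momentum_apply (γ : Cotangent E G) (v : E) : momentum γ v = γ.2 (ofLie γ.1 v) := rfl

theorem apply_eq_momentum (γ : Cotangent E G) (X : TangentSpace 𝓘(ℝ, E) γ.1) :
    γ.2 X = momentum γ (toLie γ.1 X) := by
  rw [momentum_apply, ofLie_toLie]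

theorem momentum_cotOf (g : G) (p : E →L[ℝ] ℝ) : momentum (cotOf (g, p)) = p := by
  ext v
  exact congrArg p (toLie_ofLie g v)

theorem cotOf_cotTriv (γ : Cotangent E G) : cotOf (cotTriv γ) = γ := by
  obtain ⟨g, ξ⟩ := γ
  refine congrArg (fun η => (⟨g, η⟩ : Cotangent E G)) ?_
  ext v
  exact congrArg ξ (ofLie_toLie g v)

theorem contMDiff_cotProj : ContMDiff (cotModel E) 𝓘(ℝ, E) ∞ (fun γ : Cotangent E G => γ.1) :=
  contMDiff_proj (fun x : G => TangentSpace 𝓘(ℝ, E) x →L[ℝ] ℝ)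

theorem contMDiff_momentum : ContMDiff (cotModel E) 𝓘(ℝ, E →L[ℝ] ℝ) ∞
    (momentum : Cotangent E G → E →L[ℝ] ℝ) := fun γ =>
  contMDiffAt_comp_ofLie (b := fun γ : Cotangent E G => γ.1) (ξ := fun γ => γ.2) (x₀ := γ)
    contMDiffAt_id

theorem contMDiff_cotTriv : ContMDiff (cotModel E) (𝓘(ℝ, E).prod 𝓘(ℝ, E →L[ℝ] ℝ)) ∞
    (cotTriv : Cotangent E G → G × (E →L[ℝ] ℝ)) :=
  contMDiff_cotProj.prodMk contMDiff_momentum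

theorem contMDiff_cotOf : ContMDiff (𝓘(ℝ, E).prod 𝓘(ℝ, E →L[ℝ] ℝ)) (cotModel E) ∞
    (cotOf : G × (E →L[ℝ] ℝ) → Cotangent E G) := fun _ =>
  contMDiffAt_comp_toLie (IN := 𝓘(ℝ, E).prod 𝓘(ℝ, E →L[ℝ] ℝ)) contMDiffAt_fst contMDiffAt_snd

/-- The differential of the momentum. -/
def dMom (γ : Cotangent E G) : TangentSpace (cotModel E) γ →L[ℝ] (E →L[ℝ] ℝ) :=
  mvfderiv (cotModel E) momentum γ

theorem mfderiv_cotTriv (γ : Cotangent E G) (v : TangentSpace (cotModel E) γ) :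
    (mfderiv (cotModel E) (𝓘(ℝ, E).prod 𝓘(ℝ, E →L[ℝ] ℝ)) cotTriv γ v : E × (E →L[ℝ] ℝ))
      = (dProj γ v, dMom γ v) := by
  have h := mfderiv_prodMk (I := cotModel E) (I' := 𝓘(ℝ, E)) (I'' := 𝓘(ℝ, E →L[ℝ] ℝ)) (x := γ)
    (contMDiff_cotProj.mdifferentiableAt (by simp))
    (contMDiff_momentum.mdifferentiableAt (by simp))
  exact congrArg (fun T : E × (E →L[ℝ] ℝ) →L[ℝ] E × (E →L[ℝ] ℝ) => T v) h

theorem isInvertible_mfderiv_cotTriv (γ : Cotangent E G) :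
    (mfderiv (cotModel E) (𝓘(ℝ, E).prod 𝓘(ℝ, E →L[ℝ] ℝ)) cotTriv γ).IsInvertible := by
  let T : E × (E →L[ℝ] ℝ) →L[ℝ] E × (E →L[ℝ] ℝ) :=
    mfderiv (cotModel E) (𝓘(ℝ, E).prod 𝓘(ℝ, E →L[ℝ] ℝ)) cotTriv γ
  let S : E × (E →L[ℝ] ℝ) →L[ℝ] E × (E →L[ℝ] ℝ) :=
    mfderiv (𝓘(ℝ, E).prod 𝓘(ℝ, E →L[ℝ] ℝ)) (cotModel E) (cotOf (G := G)) (cotTriv γ)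
  have hST : ∀ v, S (T v) = v := by
    intro v
    have h := mfderiv_comp_apply (I := cotModel E) (I' := 𝓘(ℝ, E).prod 𝓘(ℝ, E →L[ℝ] ℝ))
      (I'' := cotModel E) γ (contMDiff_cotOf.mdifferentiableAt (by simp))
      (contMDiff_cotTriv.mdifferentiableAt (by simp)) v
    have h2 : cotOf ∘ cotTriv = (id : Cotangent E G → Cotangent E G) := funext cotOf_cotTriv
    rw [h2, mfderiv_id] at h
    exact h.symm
  -- In finite dimension a left inverse of an endomorphism is enough for invertibility.
  have hinj : Function.Injective T := Function.LeftInverse.injective hST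
  exact ⟨(LinearEquiv.ofInjectiveEndo T.toLinearMap hinj).toContinuousLinearEquiv, by
    ext v
    rfl⟩

/-- The trivialization has invertible differential, and the components of that differential are the
velocities of the base point and of the momentum. -/
theorem tangent_ext {γ : Cotangent E G} {v w : TangentSpace (cotModel E) γ}
    (h1 : dProj γ v = dProj γ w) (h2 : dMom γ v = dMom γ w) : v = w := by
  apply (isInvertible_mfderiv_cotTriv γ).injective
  refine (mfderiv_cotTriv γ v).trans (Eq.trans ?_ (mfderiv_cotTriv γ w).symm)
  rw [h1, h2]

/-- The field on `G × 𝔤*` with constant first component, and second component affine in `p`. -/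
def prodField (X : E) (η : E →L[ℝ] ℝ) (B : E →L[ℝ] E) (z : G × (E →L[ℝ] ℝ)) :
    TangentSpace (𝓘(ℝ, E).prod 𝓘(ℝ, E →L[ℝ] ℝ)) z :=
  ((ofLie z.1 X, η + z.2.comp B) : E × (E →L[ℝ] ℝ))

theorem contMDiff_prodField (X : E) (η : E →L[ℝ] ℝ) (B : E →L[ℝ] E) :
    ContMDiff (𝓘(ℝ, E).prod 𝓘(ℝ, E →L[ℝ] ℝ))
      ((𝓘(ℝ, E).prod 𝓘(ℝ, E →L[ℝ] ℝ)).prod 𝓘(ℝ, E × (E →L[ℝ] ℝ))) ∞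
      (fun z : G × (E →L[ℝ] ℝ) => TotalSpace.mk' (E × (E →L[ℝ] ℝ))
        (E := fun z : G × (E →L[ℝ] ℝ) => TangentSpace (𝓘(ℝ, E).prod 𝓘(ℝ, E →L[ℝ] ℝ)) z) z
        (prodField X η B z)) := by
  have h1 : ContMDiff (𝓘(ℝ, E).prod 𝓘(ℝ, E →L[ℝ] ℝ)) (𝓘(ℝ, E).prod 𝓘(ℝ, E)) ∞
      (fun z : G × (E →L[ℝ] ℝ) => TotalSpace.mk' E (E := fun x : G => TangentSpace 𝓘(ℝ, E) x) z.1
        (ofLie z.1 X)) := (contMDiff_leftInvariant X).comp contMDiff_fst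
  have h2 : ContMDiff 𝓘(ℝ, E →L[ℝ] ℝ) (𝓘(ℝ, E →L[ℝ] ℝ).prod 𝓘(ℝ, E →L[ℝ] ℝ)) ∞
      (fun p : E →L[ℝ] ℝ => TotalSpace.mk' (E →L[ℝ] ℝ)
        (E := fun x : E →L[ℝ] ℝ => TangentSpace 𝓘(ℝ, E →L[ℝ] ℝ) x) p (η + p.comp B)) := fun p =>
    contMDiffAt_vectorSpace_iff_contDiffAt.2
      (contDiff_const.add (contDiff_id.clm_comp contDiff_const)).contDiffAt
  have h3 := h2.comp (contMDiff_snd (I := 𝓘(ℝ, E)) (M := G) (J := 𝓘(ℝ, E →L[ℝ] ℝ))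
    (N := E →L[ℝ] ℝ))
  exact (contMDiff_equivTangentBundleProd_symm (I := 𝓘(ℝ, E)) (I' := 𝓘(ℝ, E →L[ℝ] ℝ)) (M := G)
    (M' := E →L[ℝ] ℝ) (n := ∞)).comp (h1.prodMk h3)

/-- The vector field on `T*G` which corresponds to `prodField` under the left trivialization. -/
def cotField (X : E) (η : E →L[ℝ] ℝ) (B : E →L[ℝ] E) (γ : Cotangent E G) :
    TangentSpace (cotModel E) γ :=
  mpullback (cotModel E) (𝓘(ℝ, E).prod 𝓘(ℝ, E →L[ℝ] ℝ)) cotTriv (prodField X η B) γ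

theorem contMDiff_cotField (X : E) (η : E →L[ℝ] ℝ) (B : E →L[ℝ] E) :
    ContMDiff (cotModel E) ((cotModel E).prod 𝓘(ℝ, E × (E →L[ℝ] ℝ))) ∞
      (fun γ : Cotangent E G => TotalSpace.mk' (E × (E →L[ℝ] ℝ))
        (E := fun γ : Cotangent E G => TangentSpace (cotModel E) γ) γ (cotField X η B γ)) :=
  ContMDiff.mpullback_vectorField (n := ∞) (contMDiff_prodField X η B) contMDiff_cotTriv
    isInvertible_mfderiv_cotTriv (by simp)

theorem mfderiv_cotField (X : E) (η : E →L[ℝ] ℝ) (B : E →L[ℝ] E) (γ : Cotangent E G) :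
    ((dProj γ (cotField X η B γ), dMom γ (cotField X η B γ)) : E × (E →L[ℝ] ℝ))
      = (ofLie γ.1 X, η + (momentum γ).comp B) := by
  refine (mfderiv_cotTriv γ _).symm.trans ?_
  obtain ⟨e, he⟩ := isInvertible_mfderiv_cotTriv γ
  rw [cotField, mpullback_apply, ← he, ContinuousLinearMap.inverse_equiv]
  exact e.apply_symm_apply _

theorem dProj_cotField (X : E) (η : E →L[ℝ] ℝ) (B : E →L[ℝ] E) (γ : Cotangent E G) :
    dProj γ (cotField X η B γ) = ofLie γ.1 X := congrArg Prod.fst (mfderiv_cotField X η B γ)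

theorem dMom_cotField (X : E) (η : E →L[ℝ] ℝ) (B : E →L[ℝ] E) (γ : Cotangent E G) :
    dMom γ (cotField X η B γ) = η + (momentum γ).comp B :=
  congrArg Prod.snd (mfderiv_cotField X η B γ)

/-- For `vertLift`: its curve passes at time 0 through the covector `γ.2 + 0 • ξ`, which equals
`γ.2` only after rewriting. -/
theorem mfderiv_point_congr {EN HN N EM HM M : Type*} [NormedAddCommGroup EN] [NormedSpace ℝ EN]
    [TopologicalSpace HN] {IN : ModelWithCorners ℝ EN HN} [TopologicalSpace N] [ChartedSpace HN N]
    [NormedAddCommGroup EM] [NormedSpace ℝ EM] [TopologicalSpace HM]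
    {IM : ModelWithCorners ℝ EM HM} [TopologicalSpace M] [ChartedSpace HM M] (f : N → M) {x y : N}
    (h : x = y) (v : EN) :
    (mfderiv IN IM f x (v : TangentSpace IN x) : EM)
      = (mfderiv IN IM f y (v : TangentSpace IN y) : EM) := by
  subst h; rfl

/-- The curve `t ↦ γ + t ξ` is smooth. -/
theorem contMDiff_vertCurve (γ : Cotangent E G) (ξ : TangentSpace 𝓘(ℝ, E) γ.1 →L[ℝ] ℝ) :
    ContMDiff 𝓘(ℝ, ℝ) (cotModel E) ∞ (fun t : ℝ => (⟨γ.1, γ.2 + t • ξ⟩ : Cotangent E G)) := by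
  have h1 : ContMDiff 𝓘(ℝ, ℝ) 𝓘(ℝ, E →L[ℝ] ℝ) ∞
      (fun t : ℝ => momentum γ + t • (ξ.comp (ofLie γ.1) : E →L[ℝ] ℝ)) :=
    (contDiff_const.add (contDiff_id.smul contDiff_const)).contMDiff
  have h2 := (contMDiff_cotOf (G := G)).comp
    ((contMDiff_const (I := 𝓘(ℝ, ℝ)) (I' := 𝓘(ℝ, E)) (c := γ.1)).prodMk h1)
  convert! h2 using 1
  funext t
  refine congrArg (fun η => (⟨γ.1, η⟩ : Cotangent E G)) ?_
  ext v
  exact congrArg (fun w => γ.2 w + t • ξ w) (ofLie_toLie γ.1 v).symm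

theorem dProj_vertLift (γ : Cotangent E G) (ξ : TangentSpace 𝓘(ℝ, E) γ.1 →L[ℝ] ℝ) :
    dProj γ (vertLift γ ξ) = 0 := by
  have h := mfderiv_comp_apply (I := 𝓘(ℝ, ℝ)) (I' := cotModel E) (I'' := 𝓘(ℝ, E)) (0 : ℝ)
    (f := fun t : ℝ => (⟨γ.1, γ.2 + t • ξ⟩ : Cotangent E G))
    (contMDiff_cotProj.mdifferentiableAt (by simp))
    ((contMDiff_vertCurve γ ξ).mdifferentiableAt (by simp)) (1 : ℝ)
  have h2 : (fun γ : Cotangent E G => γ.1) ∘ (fun t : ℝ => (⟨γ.1, γ.2 + t • ξ⟩ : Cotangent E G))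
    = fun _ => γ.1 := rfl
  rw [h2, mfderiv_const] at h
  have h3 : (⟨γ.1, γ.2 + (0 : ℝ) • ξ⟩ : Cotangent E G) = γ := by
    rw [zero_smul, add_zero]
  exact (mfderiv_point_congr (IN := cotModel E) (IM := 𝓘(ℝ, E)) (fun γ : Cotangent E G => γ.1) h3
    (vertLift γ ξ)).symm.trans h.symm

theorem dMom_vertLift (γ : Cotangent E G) (ξ : TangentSpace 𝓘(ℝ, E) γ.1 →L[ℝ] ℝ) :
    dMom γ (vertLift γ ξ) = ξ.comp (ofLie γ.1) := by
  have h := mfderiv_comp_apply (I := 𝓘(ℝ, ℝ)) (I' := cotModel E) (I'' := 𝓘(ℝ, E →L[ℝ] ℝ)) (0 : ℝ)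
    (f := fun t : ℝ => (⟨γ.1, γ.2 + t • ξ⟩ : Cotangent E G))
    (contMDiff_momentum.mdifferentiableAt (by simp))
    ((contMDiff_vertCurve γ ξ).mdifferentiableAt (by simp)) (1 : ℝ)
  have h3 : (⟨γ.1, γ.2 + (0 : ℝ) • ξ⟩ : Cotangent E G) = γ := by
    rw [zero_smul, add_zero]
  refine (mfderiv_point_congr (IN := cotModel E) (IM := 𝓘(ℝ, E →L[ℝ] ℝ)) momentum h3
    (vertLift γ ξ)).symm.trans (h.symm.trans ?_)
  let L : E →L[ℝ] ℝ := ξ.comp (ofLie γ.1)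
  have h2 : momentum ∘ (fun t : ℝ => (⟨γ.1, γ.2 + t • ξ⟩ : Cotangent E G))
    = fun t => momentum γ + t • L := rfl
  rw [h2, mfderiv_eq_fderiv]
  have h4 : HasDerivAt (fun t : ℝ => momentum γ + t • L) ((1 : ℝ) • L) 0 :=
    ((hasDerivAt_id (0 : ℝ)).smul_const L).const_add _
  have h5 := fderiv_apply_one_eq_deriv (𝕜 := ℝ) (f := fun t : ℝ => momentum γ + t • L) (x := 0)
  exact h5.trans (h4.deriv.trans (one_smul _ _))

end CotangentTriv

end GenCplx

namespace GenCplx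

open Bundle VectorField

/-! ### Left-invariant connections and their coefficients -/

section Connections

set_option linter.unusedSectionVars false

variable {E : Type*} [NormedAddCommGroup E] [NormedSpace ℝ E] [FiniteDimensional ℝ E]
  {G : Type*} [TopologicalSpace G] [ChartedSpace E G] [Group G] [LieGroup 𝓘(ℝ, E) ∞ G]

/-- The left-invariant vector field with value `v` at the identity. -/
def leftField (v : E) : VField E G := ⟨fun g => ofLie g v, contMDiff_leftInvariant v⟩

theorem leftField_apply (v : E) (g : G) : leftField v g = ofLie g v := rfl

theorem isLeftInvariant_leftField (v : E) : IsLeftInvariantVField (leftField (G := G) v) :=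
  fun g h => dLeft_ofLie g h v

theorem IsLeftInvariantVField.apply_eq {X : VField E G} (hX : IsLeftInvariantVField X) (g : G) :
    X g = ofLie (E := E) g (X 1) := by
  have h1 : ∀ k l : G, k = l → (X k : E) = X l := by rintro k l rfl; rfl
  exact (h1 _ _ (mul_one g)).symm.trans (hX g 1).symm

theorem IsLeftInvariantVField.exists_eq {X : VField E G} (hX : IsLeftInvariantVField X) :
    ∃ u : E, X = leftField u := ⟨X 1, ContMDiffSection.ext hX.apply_eq⟩

/-- A vector field as a function with values in the Lie algebra. -/
def fieldCoord (Y : VField E G) (g : G) : E := toLie g (Y g)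

theorem contMDiff_fieldCoord (Y : VField E G) : ContMDiff 𝓘(ℝ, E) 𝓘(ℝ, E) ∞ (fieldCoord Y) :=
  fun _ => contMDiffAt_toLie (b := id) Y.contMDiff.contMDiffAt

theorem mdifferentiableAt_fieldCoord (Y : VField E G) (g : G) :
    MDifferentiableAt 𝓘(ℝ, E) 𝓘(ℝ, E) (fieldCoord Y) g :=
  (contMDiff_fieldCoord Y).mdifferentiableAt (by simp)

theorem ofLie_fieldCoord (Y : VField E G) (g : G) : ofLie g (fieldCoord Y g) = Y g :=
  ofLie_toLie g _

theorem fieldCoord_leftField (v : E) : fieldCoord (leftField (G := G) v) = fun _ => v :=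
  funext fun g => toLie_ofLie g v

/-- `Γ` is the coefficient of the connection `D` in a left-invariant frame. -/
def HasCoeff (D : LinearConnection E G) (Γ : E →L[ℝ] E →L[ℝ] E) : Prop :=
  ∀ (Y : VField E G) (g : G) (v : TangentSpace 𝓘(ℝ, E) g),
    D.toFun Y g v
      = ofLie g (mvfderiv 𝓘(ℝ, E) (fieldCoord Y) g v + Γ (toLie g v) (fieldCoord Y g))

theorem HasCoeff.apply_leftField {D : LinearConnection E G} {Γ : E →L[ℝ] E →L[ℝ] E}
    (h : HasCoeff D Γ) (w : E) (g : G) (v : TangentSpace 𝓘(ℝ, E) g) :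
    D.toFun (leftField w) g v = ofLie g (Γ (toLie g v) w) := by
  rw [h, fieldCoord_leftField, mvfderiv_const, zero_apply, zero_add]

theorem HasCoeff.isLeftInvariant {D : LinearConnection E G} {Γ : E →L[ℝ] E →L[ℝ] E}
    (h : HasCoeff D Γ) : IsLeftInvariantConnection D := by
  intro X Y hX hY g k
  obtain ⟨u, rfl⟩ := hX.exists_eq
  obtain ⟨w, rfl⟩ := hY.exists_eq
  rw [h.apply_leftField, h.apply_leftField, dLeft_ofLie, leftField_apply, leftField_apply,
    toLie_ofLie, toLie_ofLie]

theorem HasCoeff.unique {D D' : LinearConnection E G} {Γ : E →L[ℝ] E →L[ℝ] E}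
    (h : HasCoeff D Γ) (h' : HasCoeff D' Γ) : D = D' := by
  refine LinearConnection.ext ?_
  funext Y g
  ext v
  exact (h Y g v).trans (h' Y g v).symm

/-- The left-invariant connection with coefficient `Γ`. -/
def connOfCoeff (Γ : E →L[ℝ] E →L[ℝ] E) : LinearConnection E G where
  toFun Y g := (ofLie g).comp
    (mvfderiv 𝓘(ℝ, E) (fieldCoord Y) g + (Γ.flip (fieldCoord Y g)).comp (toLie g))
  add Y Z g := by
    have h : fieldCoord (Y + Z) = fieldCoord Y + fieldCoord Z := by
      funext x; exact map_add (toLie (E := E) x) (Y x) (Z x)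
    rw [h, mvfderiv_add (mdifferentiableAt_fieldCoord Y g) (mdifferentiableAt_fieldCoord Z g),
      Pi.add_apply, map_add, ← ContinuousLinearMap.comp_add]
    congr 1
    rw [ContinuousLinearMap.add_comp]
    abel
  leibniz f hf Y Z hZ g v := by
    have h : fieldCoord Z = f • fieldCoord Y := by
      funext x
      exact (congrArg (toLie (E := E) x) (hZ x)).trans (map_smul (toLie (E := E) x) (f x) (Y x))
    rw [h, mvfderiv_smul (hf.mdifferentiableAt (by simp)) (mdifferentiableAt_fieldCoord Y g)]
    have h2 := ofLie_fieldCoord Y g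
    simp only [ContinuousLinearMap.comp_apply, add_apply,
      smul_apply, ContinuousLinearMap.smulRight_apply, Pi.smul_apply',
      map_smul, map_add, h2, smul_add]
    abel
  smooth X Y := fun g => by
    refine contMDiffAt_ofLie (b := id) (w := fun g => mvfderiv 𝓘(ℝ, E) (fieldCoord Y) g (X g)
      + Γ (fieldCoord X g) (fieldCoord Y g)) contMDiffAt_id ?_
    refine (contMDiffAt_mvfderiv_apply (contMDiff_fieldCoord Y).contMDiffAt
      X.contMDiff.contMDiffAt).add ?_
    exact (((Γ.contDiff (n := ∞)).contMDiff.comp (contMDiff_fieldCoord X)).clm_apply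
      (contMDiff_fieldCoord Y)).contMDiffAt

theorem hasCoeff_connOfCoeff (Γ : E →L[ℝ] E →L[ℝ] E) :
    HasCoeff (connOfCoeff (G := G) Γ) Γ := fun _ _ _ => rfl

/-- A connection is additive in the differentiated vector field. -/
def LinearConnection.addHom (D : LinearConnection E G) (g : G) :
    VField E G →+ (TangentSpace 𝓘(ℝ, E) g →L[ℝ] TangentSpace 𝓘(ℝ, E) g) :=
  AddMonoidHom.mk' (fun Y => D.toFun Y g) fun Y Z => D.add Y Z g

theorem LinearConnection.smul_const (D : LinearConnection E G) (c : ℝ) (Y : VField E G) (g : G)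
    (v : TangentSpace 𝓘(ℝ, E) g) : D.toFun (c • Y) g v = c • D.toFun Y g v := by
  rw [D.leibniz (fun _ => c) contMDiff_const Y (c • Y) (fun x => rfl), mvfderiv_const]
  simp

theorem IsLeftInvariantConnection.apply_leftField {D : LinearConnection E G}
    (hD : IsLeftInvariantConnection D) (w : E) (g : G) (v : TangentSpace 𝓘(ℝ, E) g) :
    D.toFun (leftField w) g v
      = ofLie (E := E) g (D.toFun (leftField w) 1 (toLie (E := E) g v)) := by
  have h1 := hD (leftField (toLie g v)) (leftField w) (isLeftInvariant_leftField _)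
    (isLeftInvariant_leftField _) g 1
  have h2 : ∀ k l : G, k = l → ∀ u : E,
      (D.toFun (leftField w) k (leftField u k) : E) = D.toFun (leftField w) l (leftField u l) := by
    rintro k l rfl u; rfl
  have h3 : leftField (toLie g v) g = v := ofLie_toLie g v
  have h4 : leftField (G := G) (toLie g v) 1 = (toLie g v : E) := ofLie_one _
  have h5 := h1.trans (h2 _ _ (mul_one g) _)
  rw [h3, h4] at h5
  exact h5.symm

/-- Any field is a combination of left-invariant basis fields with function coefficients, so
additivity and the Leibniz rule determine `D` from its values on left-invariant fields; invariance
determines those from their values at `1`. -/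
theorem IsLeftInvariantConnection.exists_hasCoeff {D : LinearConnection E G}
    (hD : IsLeftInvariantConnection D) : ∃ Γ : E →L[ℝ] E →L[ℝ] E, HasCoeff D Γ := by
  have hadd : ∀ w w' : E, leftField (G := G) (w + w') = leftField w + leftField w' := fun w w' =>
    ContMDiffSection.ext fun g => map_add (ofLie g) w w'
  have hsmul : ∀ (c : ℝ) (w : E), leftField (G := G) (c • w) = c • leftField w := fun c w =>
    ContMDiffSection.ext fun g => map_smul (ofLie g) c w
  let Γ₀ : E →ₗ[ℝ] E →ₗ[ℝ] E := LinearMap.mk₂ ℝ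
    (fun u w => (D.toFun (leftField w) 1 (u : TangentSpace 𝓘(ℝ, E) (1 : G)) : E))
    (fun u u' w => map_add (D.toFun (leftField w) 1) u u')
    (fun c u w => map_smul (D.toFun (leftField w) 1) c u)
    (fun u w w' => by
      rw [hadd, D.add]; rfl)
    (fun c u w => by rw [hsmul]; exact D.smul_const c _ _ _)
  refine ⟨Γ₀.toContinuousBilinearMap, fun Y g v => ?_⟩
  let b := Module.finBasis ℝ E
  let c : Fin (Module.finrank ℝ E) → E →L[ℝ] ℝ := fun i =>
    LinearMap.toContinuousLinearMap (b.coord i)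
  have hcs : ∀ i, ContMDiff 𝓘(ℝ, E) 𝓘(ℝ, ℝ) ∞ (fun x => c i (fieldCoord Y x)) := fun i =>
    ((c i).contDiff (n := ∞)).contMDiff.comp (contMDiff_fieldCoord Y)
  have hb : ∀ w : E, ∑ i, c i w • b i = w := fun w => b.sum_repr w
  let Z : Fin (Module.finrank ℝ E) → VField E G := fun i =>
    ⟨(fun x => c i (fieldCoord Y x)) • ⇑(leftField (G := G) (b i)),
      (hcs i).smul_section (leftField (b i)).contMDiff⟩
  have hYZ : Y = ∑ i, Z i := by
    refine ContMDiffSection.ext fun x => ?_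
    have h1 : (∑ i, Z i) x = ∑ i, Z i x := by
      have h := map_sum (ContMDiffSection.coeAddHom 𝓘(ℝ, E) E ∞
        (fun x : G => TangentSpace 𝓘(ℝ, E) x)) Z Finset.univ
      exact (congrFun h x).trans (Finset.sum_apply x _ _)
    rw [h1, ← ofLie_fieldCoord Y x]
    conv_lhs => rw [← hb (fieldCoord Y x), map_sum]
    refine Finset.sum_congr rfl fun i _ => ?_
    exact map_smul (ofLie x) _ _
  have h1 : D.toFun Y g v = ∑ i, D.toFun (Z i) g v := by
    have h := map_sum (D.addHom g) Z Finset.univ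
    rw [← hYZ] at h
    exact (congrArg (fun T : TangentSpace 𝓘(ℝ, E) g →L[ℝ] TangentSpace 𝓘(ℝ, E) g => T v) h).trans
      (by rw [sum_apply]; rfl)
  have h2 : ∀ i, D.toFun (Z i) g v = ofLie g (c i (mvfderiv 𝓘(ℝ, E) (fieldCoord Y) g v) • b i
      + c i (fieldCoord Y g) • Γ₀ (toLie g v) (b i)) := by
    intro i
    rw [D.leibniz _ (hcs i) (leftField (b i)) (Z i) (fun x => rfl),
      mvfderiv_clm_comp (c i) (mdifferentiableAt_fieldCoord Y g), hD.apply_leftField (b i) g v,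
      map_add, map_smul, map_smul]
    rfl
  have h3 : Γ₀ (toLie g v) (fieldCoord Y g)
      = ∑ i, c i (fieldCoord Y g) • Γ₀ (toLie g v) (b i) := by
    conv_lhs => rw [← hb (fieldCoord Y g), map_sum]
    exact Finset.sum_congr rfl fun i _ => map_smul _ _ _
  rw [h1, Finset.sum_congr rfl fun i _ => h2 i, ← map_sum, Finset.sum_add_distrib, hb, ← h3]
  rfl

end Connections

end GenCplx

namespace GenCplx

open Bundle VectorField

/-! ### Left-invariant generalized complex structures and their symbols -/

section Symbols

set_option linter.unusedSectionVars false

variable {E : Type*} [NormedAddCommGroup E] [NormedSpace ℝ E] [FiniteDimensional ℝ E]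
  {G : Type*} [TopologicalSpace G] [ChartedSpace E G] [Group G] [LieGroup 𝓘(ℝ, E) ∞ G]
  {s : Kind}

/-- Left translation of `T_g G ⊕ T*_g G` to the identity, read in the model space. -/
def dblEquiv (g : G) : DoubleSpace (TangentSpace 𝓘(ℝ, E) g) ≃ₗ[ℝ] DoubleSpace E where
  toFun a := (toLie g a.1, a.2.comp (ofLie g))
  invFun a := (ofLie g a.1, a.2.comp (toLie g))
  map_add' _ _ := Prod.ext (map_add _ _ _) (ContinuousLinearMap.add_comp _ _ _)
  map_smul' _ _ := Prod.ext (map_smul _ _ _) (ContinuousLinearMap.smul_comp _ _ _)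
  left_inv a := Prod.ext (ofLie_toLie g a.1)
    (ContinuousLinearMap.ext fun v => congrArg a.2 (ofLie_toLie g v))
  right_inv a := Prod.ext (toLie_ofLie g a.1)
    (ContinuousLinearMap.ext fun v => congrArg a.2 (toLie_ofLie g v))

theorem dblEquiv_one (a : DoubleSpace (TangentSpace 𝓘(ℝ, E) (1 : G))) : dblEquiv (1 : G) a = a :=
  Prod.ext (toLie_one a.1) (ContinuousLinearMap.ext fun v => congrArg a.2 (ofLie_one v))

theorem gCan_dblEquiv (g : G) (a b : DoubleSpace (TangentSpace 𝓘(ℝ, E) g)) :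
    gCan (dblEquiv g a) (dblEquiv g b) = gCan a b := by
  have h : ∀ a b : DoubleSpace (TangentSpace 𝓘(ℝ, E) g),
      (dblEquiv g a).2 (dblEquiv g b).1 = a.2 b.1 := fun a b =>
    congrArg a.2 (ofLie_toLie g b.1)
  unfold gCan
  rw [h, h]

/-- `J` is the expression of `𝒥` in the left trivialization of `TG ⊕ T*G`. -/
def HasSymbol (𝒥 : GenCplxStructure E G s) (J : DoubleSpace E →ₗ[ℝ] DoubleSpace E) : Prop :=
  ∀ (g : G) (a : DoubleSpace (TangentSpace 𝓘(ℝ, E) g)),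
    dblEquiv g (𝒥.toFun g a) = J (dblEquiv g a)

theorem HasSymbol.apply_eq {𝒥 : GenCplxStructure E G s} {J : DoubleSpace E →ₗ[ℝ] DoubleSpace E}
    (h : HasSymbol 𝒥 J) (g : G) (a : DoubleSpace (TangentSpace 𝓘(ℝ, E) g)) :
    𝒥.toFun g a = (dblEquiv g).symm (J (dblEquiv g a)) := by
  rw [← h, LinearEquiv.symm_apply_apply]

theorem HasSymbol.unique {𝒥 𝒥' : GenCplxStructure E G s} {J : DoubleSpace E →ₗ[ℝ] DoubleSpace E}
    (h : HasSymbol 𝒥 J) (h' : HasSymbol 𝒥' J) : 𝒥 = 𝒥' :=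
  GenCplxStructure.ext (funext fun g => LinearMap.ext fun a =>
    (h.apply_eq g a).trans (h'.apply_eq g a).symm)

theorem HasSymbol.toFun_one {𝒥 : GenCplxStructure E G s} {J : DoubleSpace E →ₗ[ℝ] DoubleSpace E}
    (h : HasSymbol 𝒥 J) : 𝒥.toFun (1 : G) = J :=
  LinearMap.ext fun a => (dblEquiv_one (E := E) _).symm.trans
    ((h 1 a).trans (congrArg J (dblEquiv_one (E := E) a)))

theorem IsLeftInvariantGenCplx.hasSymbol {𝒥 : GenCplxStructure E G s}
    (h : IsLeftInvariantGenCplx 𝒥) : HasSymbol 𝒥 (𝒥.toFun (1 : G)) := by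
  intro g
  -- Invariance, used to translate from `1`, speaks about the point `g * 1`. A variable equal to it
  -- lets the claim be transported to `g` without casts.
  have h1 : ∀ k : G, k = g * 1 → ∀ a : DoubleSpace (TangentSpace 𝓘(ℝ, E) k),
      dblEquiv k (𝒥.toFun k a) = 𝒥.toFun (1 : G) (dblEquiv (E := E) k a) := by
    rintro k rfl a
    have h2 : ∀ u : E, (ofLie (g * 1) u : E) = dLeft g (1 : G) u := fun u =>
      (dLeft_ofLie g (1 : G) u).symm.trans (congrArg (dLeft g (1 : G)) (ofLie_one u))
    have h3 := h g 1 (toLie (E := E) (g * 1) a.1) a.2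
    have h4 : dLeft g (1 : G) (toLie (E := E) (g * 1) a.1) = a.1 :=
      (h2 _).symm.trans (ofLie_toLie (g * 1) a.1)
    have h5 : a.2.comp (dLeft g (1 : G)) = a.2.comp (ofLie (g * 1)) :=
      ContinuousLinearMap.ext fun u => congrArg a.2 (h2 u).symm
    rw [h4] at h3
    refine Prod.ext ?_ ?_
    · refine (congrArg (toLie (g * 1)) h3.1).trans ?_
      refine (toLie_dLeft g (1 : G) _).trans ((toLie_one _).trans ?_)
      rw [h5]
      rfl
    · refine Eq.trans ?_ (h3.2.trans ?_)
      · exact ContinuousLinearMap.ext fun u => congrArg (𝒥.toFun (g * 1) a).2 (h2 u)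
      · rw [h5]
        rfl
  exact h1 g (mul_one g).symm

/-- The left-invariant generalized complex structure with a given symbol. -/
def genCplxOfSymbol (J : DoubleSpace E →ₗ[ℝ] DoubleSpace E) (hJ : IsGenCplx s J) :
    GenCplxStructure E G s where
  toFun g := (dblEquiv g).symm.toLinearMap ∘ₗ J ∘ₗ (dblEquiv g).toLinearMap
  isGenCplx g :=
    { sq := fun a => by simp [hJ.sq]
      compat := by
        have key : ∀ a b : DoubleSpace (TangentSpace 𝓘(ℝ, E) g),
            gCan ((dblEquiv g).symm (J (dblEquiv g a))) b = gCan (J (dblEquiv g a)) (dblEquiv g b)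
            ∧ gCan a ((dblEquiv g).symm (J (dblEquiv g b)))
              = gCan (dblEquiv g a) (J (dblEquiv g b)) := by
          intro a b
          rw [← gCan_dblEquiv g, ← gCan_dblEquiv g, LinearEquiv.apply_symm_apply,
            LinearEquiv.apply_symm_apply]
          exact ⟨rfl, rfl⟩
        have hc := hJ.compat
        cases s
        · intro a b
          exact (key a b).1.trans ((hc _ _).trans (key a b).2.symm)
        · intro a b
          exact (key a b).1.trans ((hc _ _).trans (congrArg Neg.neg (key a b).2.symm)) }
  smooth_fst X ξ := fun g => by
    have h1 : ContMDiffAt 𝓘(ℝ, E) 𝓘(ℝ, E × (E →L[ℝ] ℝ)) ∞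
        (fun g : G => J (dblEquiv g (X g, ξ g))) g :=
      (J.toContinuousLinearMap.contDiff (n := ∞)).contMDiff.contMDiffAt.comp g
        ((contMDiff_fieldCoord X).contMDiffAt.prodMk_space
          (contMDiffAt_comp_ofLie (b := id) ξ.contMDiff.contMDiffAt))
    exact contMDiffAt_ofLie (b := id) contMDiffAt_id
      ((contDiff_fst (n := ∞)).contMDiff.contMDiffAt.comp g h1)
  smooth_snd X ξ := fun g => by
    have h1 : ContMDiffAt 𝓘(ℝ, E) 𝓘(ℝ, E × (E →L[ℝ] ℝ)) ∞
        (fun g : G => J (dblEquiv g (X g, ξ g))) g :=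
      (J.toContinuousLinearMap.contDiff (n := ∞)).contMDiff.contMDiffAt.comp g
        ((contMDiff_fieldCoord X).contMDiffAt.prodMk_space
          (contMDiffAt_comp_ofLie (b := id) ξ.contMDiff.contMDiffAt))
    exact contMDiffAt_comp_toLie (b := id) contMDiffAt_id
      ((contDiff_snd (n := ∞)).contMDiff.contMDiffAt.comp g h1)

theorem hasSymbol_genCplxOfSymbol (J : DoubleSpace E →ₗ[ℝ] DoubleSpace E) (hJ : IsGenCplx s J) :
    HasSymbol (genCplxOfSymbol (G := G) J hJ) J := fun g _ =>
  (dblEquiv g).apply_symm_apply _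

theorem HasSymbol.isLeftInvariant {𝒥 : GenCplxStructure E G s}
    {J : DoubleSpace E →ₗ[ℝ] DoubleSpace E} (h : HasSymbol 𝒥 J) : IsLeftInvariantGenCplx 𝒥 := by
  intro g k X η
  have h1 : dblEquiv (g * k) (dLeft g k X, η) = dblEquiv k (X, η.comp (dLeft g k)) :=
    Prod.ext (toLie_dLeft g k X)
      (ContinuousLinearMap.ext fun u => congrArg η (dLeft_ofLie g k u).symm)
  rw [h.apply_eq (g * k), h.apply_eq k, h1]
  refine ⟨(dLeft_ofLie g k _).symm, ?_⟩
  exact ContinuousLinearMap.ext fun u =>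
    congrArg (J (dblEquiv k (X, η.comp (dLeft g k)))).2 (toLie_dLeft g k u)

end Symbols

/-! ### The almost complex structure in the adapted frame -/

section AlmostComplex

set_option linter.unusedSectionVars false

variable {E : Type*} [NormedAddCommGroup E] [NormedSpace ℝ E] [FiniteDimensional ℝ E]
  {G : Type*} [TopologicalSpace G] [ChartedSpace E G] [Group G] [LieGroup 𝓘(ℝ, E) ∞ G]
  {s : Kind} {D : LinearConnection E G} {Γ : E →L[ℝ] E →L[ℝ] E}
  {𝒥 : GenCplxStructure E G s} {J : DoubleSpace E →ₗ[ℝ] DoubleSpace E}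

/-- In the trivialization the function is the pairing of the momentum with the coordinate of `Y`,
and the product rule applies. -/
theorem mvfderiv_fibLin (Y : VField E G) (γ : Cotangent E G) (v : TangentSpace (cotModel E) γ) :
    mvfderiv (cotModel E) (fibLin Y) γ v
      = dMom γ v (fieldCoord Y γ.1)
        + momentum γ (mvfderiv 𝓘(ℝ, E) (fieldCoord Y) γ.1 (dProj γ v)) := by
  have h1 : fibLin Y = fun δ : Cotangent E G => momentum δ (fieldCoord Y δ.1) :=
    funext fun δ => apply_eq_momentum δ (Y δ.1)
  rw [h1, mvfderiv_clm_apply (y := fun δ : Cotangent E G => fieldCoord Y δ.1)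
    (contMDiff_momentum.mdifferentiableAt (by simp))
    (((contMDiff_fieldCoord Y).comp contMDiff_cotProj).mdifferentiableAt (by simp)),
    mvfderiv_comp_mfderiv (f := fieldCoord Y) (b := fun δ : Cotangent E G => δ.1)
      (mdifferentiableAt_fieldCoord Y γ.1)
      (contMDiff_cotProj.mdifferentiableAt (by simp))]
  rfl

/-- The term differentiating `Y` occurs identically on both sides of the horizontality condition and
cancels. What remains is tensorial in `Y` and can be tested on left-invariant fields. -/
theorem isHorLift_iff (hD : HasCoeff D Γ) (γ : Cotangent E G) (X : TangentSpace 𝓘(ℝ, E) γ.1)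
    (h : TangentSpace (cotModel E) γ) :
    IsHorLift D γ X h ↔ dProj γ h = X ∧ dMom γ h = (momentum γ).comp (Γ (toLie γ.1 X)) := by
  have key : ∀ Y : VField E G, γ.2 (D.toFun Y γ.1 X)
      = momentum γ (mvfderiv 𝓘(ℝ, E) (fieldCoord Y) γ.1 X)
        + momentum γ (Γ (toLie γ.1 X) (fieldCoord Y γ.1)) := by
    intro Y
    rw [hD, ← momentum_apply, map_add]
  constructor
  · rintro ⟨rfl, h2⟩
    refine ⟨rfl, ?_⟩
    ext w
    have h3 := h2 (leftField w)
    rw [mvfderiv_fibLin, key, fieldCoord_leftField, add_comm] at h3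
    exact add_left_cancel h3
  · rintro ⟨rfl, h2⟩
    refine ⟨rfl, fun Y => ?_⟩
    rw [mvfderiv_fibLin, key, h2, add_comm]
    rfl

/-- The coordinates of a tangent vector of `T*G` in the left-invariant frame which is adapted to
the decomposition into horizontal and vertical subspaces. -/
def frameCoord (Γ : E →L[ℝ] E →L[ℝ] E) (γ : Cotangent E G) :
    TangentSpace (cotModel E) γ →L[ℝ] DoubleSpace E :=
  ((toLie γ.1).comp (dProj γ)).prod
    (dMom γ - ((ContinuousLinearMap.compL ℝ E E ℝ (momentum γ)).comp Γ).comp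
      ((toLie γ.1).comp (dProj γ)))

theorem frameCoord_fst (γ : Cotangent E G) (v : TangentSpace (cotModel E) γ) :
    (frameCoord Γ γ v).1 = toLie γ.1 (dProj γ v) := rfl

theorem frameCoord_snd (γ : Cotangent E G) (v : TangentSpace (cotModel E) γ) :
    (frameCoord Γ γ v).2
      = dMom γ v - (momentum γ).comp (Γ (toLie γ.1 (dProj γ v))) := rfl

theorem frameCoord_injective (γ : Cotangent E G) :
    Function.Injective (frameCoord Γ γ) := by
  intro v w h
  have h1 : dProj γ v = dProj γ w := toLie_injective γ.1 (congrArg Prod.fst h)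
  have h2 := congrArg Prod.snd h
  rw [frameCoord_snd, frameCoord_snd, h1] at h2
  exact tangent_ext h1 (sub_left_injective h2)

/-- These fields are the adapted frame: the momentum velocity `p ∘ Γ a.1` makes the horizontal part
a horizontal lift, and `a.2` is added vertically. -/
theorem frameCoord_cotField (a : DoubleSpace E) (γ : Cotangent E G) :
    frameCoord Γ γ (cotField a.1 a.2 (Γ a.1) γ) = a := by
  refine Prod.ext ?_ ?_
  · rw [frameCoord_fst, dProj_cotField, toLie_ofLie]
  · rw [frameCoord_snd, dProj_cotField, dMom_cotField, toLie_ofLie, add_sub_cancel_right]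

theorem corresponds_iff (hD : HasCoeff D Γ) (γ : Cotangent E G) (v : TangentSpace (cotModel E) γ)
    (a : DoubleSpace (TangentSpace 𝓘(ℝ, E) γ.1)) :
    Corresponds D γ v a ↔ frameCoord Γ γ v = dblEquiv γ.1 a := by
  have hvert : frameCoord Γ γ (vertLift γ a.2) = (0, a.2.comp (ofLie γ.1)) := by
    refine Prod.ext ?_ ?_
    · rw [frameCoord_fst, dProj_vertLift, map_zero]
    · rw [frameCoord_snd, dProj_vertLift, dMom_vertLift, map_zero, map_zero,
        ContinuousLinearMap.comp_zero, sub_zero]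
  have hhor : ∀ h, IsHorLift D γ a.1 h ↔ frameCoord Γ γ h = (toLie γ.1 a.1, 0) := by
    intro h
    rw [isHorLift_iff hD]
    constructor
    · rintro ⟨h1, h2⟩
      refine Prod.ext ?_ ?_
      · rw [frameCoord_fst, h1]
      · rw [frameCoord_snd, h1, h2, sub_self]
    · intro h1
      have h2 : dProj γ h = a.1 := toLie_injective γ.1 (congrArg Prod.fst h1)
      refine ⟨h2, ?_⟩
      have h3 := congrArg Prod.snd h1
      rw [frameCoord_snd, h2] at h3
      exact sub_eq_zero.1 h3
  have hsum : dblEquiv γ.1 a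
      = ((toLie γ.1 a.1, 0) : DoubleSpace E) + (0, a.2.comp (ofLie γ.1)) := by
    rw [Prod.mk_add_mk, add_zero, zero_add]
    rfl
  constructor
  · rintro ⟨h, hh, rfl⟩
    rw [ContinuousLinearMap.map_add, (hhor h).1 hh, hvert, hsum]
  · intro h
    refine ⟨v - vertLift γ a.2, (hhor _).2 ?_, (sub_add_cancel _ _).symm⟩
    rw [ContinuousLinearMap.map_sub, h, hvert, hsum, add_sub_cancel_right]

theorem frameCoord_cotACS (hD : HasCoeff D Γ) (hJ : HasSymbol 𝒥 J) (γ : Cotangent E G)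
    (v : TangentSpace (cotModel E) γ) :
    frameCoord Γ γ (cotACS 𝒥 D γ v) = J (frameCoord Γ γ v) := by
  -- The choice operator behind `cotACS` carries information only if some candidate exists; the
  -- frame field with coordinates `J (frameCoord Γ γ v)` is one.
  have hex : ∃ w, ∃ a, Corresponds D γ v a ∧ Corresponds D γ w (𝒥.toFun γ.1 a) := by
    refine ⟨cotField (J (frameCoord Γ γ v)).1 (J (frameCoord Γ γ v)).2
      (Γ (J (frameCoord Γ γ v)).1) γ, (dblEquiv γ.1).symm (frameCoord Γ γ v), ?_, ?_⟩
    · rw [corresponds_iff hD, LinearEquiv.apply_symm_apply]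
    · rw [corresponds_iff hD, hJ, LinearEquiv.apply_symm_apply, frameCoord_cotField]
  obtain ⟨a, h1, h2⟩ := Classical.epsilon_spec hex
  rw [corresponds_iff hD] at h1 h2
  rw [hJ, ← h1] at h2
  exact h2

end AlmostComplex

end GenCplx

namespace GenCplx

open Bundle VectorField

/-! ### Structure equations of the frame and the integrability condition -/

section Integrability

set_option linter.unusedSectionVars false

variable {E : Type*} [NormedAddCommGroup E] [NormedSpace ℝ E] [FiniteDimensional ℝ E]
  {G : Type*} [TopologicalSpace G] [ChartedSpace E G] [Group G] [LieGroup 𝓘(ℝ, E) ∞ G]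
  {s : Kind} {D : LinearConnection E G} {Γ : E →L[ℝ] E →L[ℝ] E}
  {𝒥 : GenCplxStructure E G s} {J : DoubleSpace E →ₗ[ℝ] DoubleSpace E}

variable (G) in
/-- The Lie bracket at a point with momentum `p` of the frame fields of `T*G` with coordinates `a`
and `b`. -/
def frameBracket (Γ : E →L[ℝ] E →L[ℝ] E) (p : E →L[ℝ] ℝ) (a b : DoubleSpace E) : DoubleSpace E :=
  (lieE G a.1 b.1, a.2.comp (Γ b.1) - b.2.comp (Γ a.1)
    + p.comp ((Γ a.1).comp (Γ b.1) - (Γ b.1).comp (Γ a.1) - Γ (lieE G a.1 b.1)))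

/-- The coordinates of a vector field of `T*G` in the adapted frame. -/
def fieldFrame (Γ : E →L[ℝ] E →L[ℝ] E) (A : ∀ γ : Cotangent E G, TangentSpace (cotModel E) γ)
    (γ : Cotangent E G) : DoubleSpace E :=
  frameCoord Γ γ (A γ)

variable {A B : ∀ γ : Cotangent E G, TangentSpace (cotModel E) γ}

theorem dMom_apply (γ : Cotangent E G) :
    dMom γ (A γ) = (fieldFrame Γ A γ).2 + (momentum γ).comp (Γ (fieldFrame Γ A γ).1) :=
  (sub_add_cancel _ _).symm

theorem contMDiff_dMom
    (hA : ContMDiff (cotModel E) ((cotModel E).prod 𝓘(ℝ, E × (E →L[ℝ] ℝ))) ∞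
      (fun γ => TotalSpace.mk' (E × (E →L[ℝ] ℝ))
        (E := fun γ : Cotangent E G => TangentSpace (cotModel E) γ) γ (A γ))) :
    ContMDiff (cotModel E) 𝓘(ℝ, E →L[ℝ] ℝ) ∞ (fun γ => dMom γ (A γ)) := fun _ =>
  contMDiffAt_mvfderiv_apply contMDiff_momentum.contMDiffAt hA.contMDiffAt

theorem contMDiff_fieldFrame
    (hA : ContMDiff (cotModel E) ((cotModel E).prod 𝓘(ℝ, E × (E →L[ℝ] ℝ))) ∞
      (fun γ => TotalSpace.mk' (E × (E →L[ℝ] ℝ))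
        (E := fun γ : Cotangent E G => TangentSpace (cotModel E) γ) γ (A γ))) :
    ContMDiff (cotModel E) 𝓘(ℝ, E × (E →L[ℝ] ℝ)) ∞ (fieldFrame Γ A) := by
  have h1 : ContMDiff (cotModel E) 𝓘(ℝ, E) ∞
      (pullMC E (cotModel E) (fun δ : Cotangent E G => δ.1) A) :=
    contMDiff_pullMC contMDiff_cotProj hA
  have h2 : ContMDiff (cotModel E) 𝓘(ℝ, E →L[ℝ] ℝ) ∞ (fun γ => dMom γ (A γ)
      - (momentum γ).comp (Γ (pullMC E (cotModel E) (fun δ : Cotangent E G => δ.1) A γ))) :=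
    (contMDiff_dMom hA).sub
      (contMDiff_momentum.clm_comp ((Γ.contDiff (n := ∞)).contMDiff.comp h1))
  exact h1.prodMk_space h2

theorem mvfderiv_dMom
    (hA : ContMDiff (cotModel E) ((cotModel E).prod 𝓘(ℝ, E × (E →L[ℝ] ℝ))) ∞
      (fun γ => TotalSpace.mk' (E × (E →L[ℝ] ℝ))
        (E := fun γ : Cotangent E G => TangentSpace (cotModel E) γ) γ (A γ)))
    (γ : Cotangent E G) (v : TangentSpace (cotModel E) γ) (w : E) :
    mvfderiv (cotModel E) (fun γ => dMom γ (A γ)) γ v w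
      = (mvfderiv (cotModel E) (fieldFrame Γ A) γ v).2 w
        + (dMom γ v (Γ (fieldFrame Γ A γ).1 w)
          + momentum γ (Γ (mvfderiv (cotModel E) (fieldFrame Γ A) γ v).1 w)) := by
  -- With these fixed linear maps the momentum velocity, evaluated at `w`, is `L₂` of the frame
  -- coordinates plus the momentum applied to `L₁` of them, so one product rule differentiates it.
  let L₁ : DoubleSpace E →L[ℝ] E := (Γ.flip w).comp (ContinuousLinearMap.fst ℝ E (E →L[ℝ] ℝ))
  let L₂ : DoubleSpace E →L[ℝ] ℝ :=
    (ContinuousLinearMap.apply ℝ ℝ w).comp (ContinuousLinearMap.snd ℝ E (E →L[ℝ] ℝ))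
  have hF : ContMDiff (cotModel E) 𝓘(ℝ, E × (E →L[ℝ] ℝ)) ∞ (fieldFrame Γ A) :=
    contMDiff_fieldFrame hA
  have hFd : MDifferentiableAt (cotModel E) 𝓘(ℝ, E × (E →L[ℝ] ℝ)) (fieldFrame Γ A) γ :=
    hF.mdifferentiableAt (by simp)
  have hmd : MDifferentiableAt (cotModel E) 𝓘(ℝ, E →L[ℝ] ℝ)
      (momentum : Cotangent E G → E →L[ℝ] ℝ) γ := contMDiff_momentum.mdifferentiableAt (by simp)
  have h1 := mvfderiv_clm_comp (ContinuousLinearMap.apply ℝ ℝ w)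
    ((contMDiff_dMom hA).mdifferentiableAt (x := γ) (by simp)) v
  have h2 : (fun γ => ContinuousLinearMap.apply ℝ ℝ w (dMom γ (A γ)))
      = fun γ => L₂ (fieldFrame Γ A γ) + momentum γ (L₁ (fieldFrame Γ A γ)) := by
    funext γ
    rw [dMom_apply (Γ := Γ)]
    rfl
  have hd1 : MDifferentiableAt (cotModel E) 𝓘(ℝ, ℝ) (fun γ => L₂ (fieldFrame Γ A γ)) γ :=
    ((L₂.contDiff (n := ∞)).contMDiff.comp hF).mdifferentiableAt (by simp)
  have hd2 : MDifferentiableAt (cotModel E) 𝓘(ℝ, E) (fun γ => L₁ (fieldFrame Γ A γ)) γ :=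
    ((L₁.contDiff (n := ∞)).contMDiff.comp hF).mdifferentiableAt (by simp)
  have hd3 : MDifferentiableAt (cotModel E) 𝓘(ℝ, ℝ)
      (fun γ => momentum γ (L₁ (fieldFrame Γ A γ))) γ :=
    (contMDiff_momentum.clm_apply
      ((L₁.contDiff (n := ∞)).contMDiff.comp hF)).mdifferentiableAt (by simp)
  rw [h2, mvfderiv_fun_add hd1 hd3] at h1
  refine h1.symm.trans ?_
  refine (congrArg₂ (· + ·) (mvfderiv_clm_comp L₂ hFd v)
    ((mvfderiv_clm_apply hmd hd2 v).trans (congrArg₂ (· + ·) rfl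
      (congrArg (momentum γ) (mvfderiv_clm_comp L₁ hFd v)))))

/-- The structure equations of the adapted frame of `T*G`. -/
theorem frameCoord_mlieBracket
    (hA : ContMDiff (cotModel E) ((cotModel E).prod 𝓘(ℝ, E × (E →L[ℝ] ℝ))) ∞
      (fun γ => TotalSpace.mk' (E × (E →L[ℝ] ℝ))
        (E := fun γ : Cotangent E G => TangentSpace (cotModel E) γ) γ (A γ)))
    (hB : ContMDiff (cotModel E) ((cotModel E).prod 𝓘(ℝ, E × (E →L[ℝ] ℝ))) ∞
      (fun γ => TotalSpace.mk' (E × (E →L[ℝ] ℝ))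
        (E := fun γ : Cotangent E G => TangentSpace (cotModel E) γ) γ (B γ)))
    (γ : Cotangent E G) :
    frameCoord Γ γ (mlieBracket (cotModel E) A B γ)
      = mvfderiv (cotModel E) (fieldFrame Γ B) γ (A γ)
        - mvfderiv (cotModel E) (fieldFrame Γ A) γ (B γ)
        + frameBracket G Γ (momentum γ) (fieldFrame Γ A γ) (fieldFrame Γ B γ) := by
  have hfst : ∀ {C : ∀ γ : Cotangent E G, TangentSpace (cotModel E) γ},
      ContMDiff (cotModel E) ((cotModel E).prod 𝓘(ℝ, E × (E →L[ℝ] ℝ))) ∞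
        (fun γ => TotalSpace.mk' (E × (E →L[ℝ] ℝ))
          (E := fun γ : Cotangent E G => TangentSpace (cotModel E) γ) γ (C γ)) →
      ∀ v : TangentSpace (cotModel E) γ,
        mvfderiv (cotModel E) (pullMC E (cotModel E) (fun δ : Cotangent E G => δ.1) C) γ v
          = (mvfderiv (cotModel E) (fieldFrame Γ C) γ v).1 := fun hC v =>
    mvfderiv_clm_comp (ContinuousLinearMap.fst ℝ E (E →L[ℝ] ℝ))
      ((contMDiff_fieldFrame hC).mdifferentiableAt (by simp)) v
  -- The base component is the Maurer-Cartan equation for the projection T*G → G.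
  have h1 : toLie γ.1 (dProj γ (mlieBracket (cotModel E) A B γ))
      = (mvfderiv (cotModel E) (fieldFrame Γ B) γ (A γ)).1
        - (mvfderiv (cotModel E) (fieldFrame Γ A) γ (B γ)).1
        + lieE G (fieldFrame Γ A γ).1 (fieldFrame Γ B γ).1 := by
    have h := pullMC_mlieBracket contMDiff_cotProj hA hB γ
    rw [hfst hA, hfst hB] at h
    exact h
  refine Prod.ext h1 ?_
  rw [frameCoord_snd, h1]
  -- The fibre component is the commutator formula for the momentum map. Differentiating the
  -- momentum inside `p ∘ Γ` produces the mixed terms and the products of `Γ` in the curvature.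
  have h2 : dMom γ (mlieBracket (cotModel E) A B γ)
      = mvfderiv (cotModel E) (fun γ => dMom γ (B γ)) γ (A γ)
        - mvfderiv (cotModel E) (fun γ => dMom γ (A γ)) γ (B γ) :=
    mvfderiv_mlieBracket_vector contMDiff_momentum.contMDiffAt hA hB
  rw [h2]
  ext w
  have h3 := mvfderiv_dMom (Γ := Γ) hB γ (A γ) w
  have h4 := mvfderiv_dMom (Γ := Γ) hA γ (B γ) w
  rw [dMom_apply (Γ := Γ)] at h3 h4
  generalize mvfderiv (cotModel E) (fun γ => dMom γ (B γ)) γ (A γ) = x at *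
  generalize mvfderiv (cotModel E) (fun γ => dMom γ (A γ)) γ (B γ) = y at *
  generalize mvfderiv (cotModel E) (fieldFrame Γ B) γ (A γ) = b' at *
  generalize mvfderiv (cotModel E) (fieldFrame Γ A) γ (B γ) = a' at *
  simp only [frameBracket, Prod.snd_add, Prod.snd_sub, sub_apply, add_apply,
    ContinuousLinearMap.comp_apply, map_add, map_sub, h3, h4]
  ring

/-- The condition on the symbol `J` and the coefficient `Γ` for the integrability of the almost
complex structure of `T*G`. -/
def SymbolIntegrable (G : Type*) [TopologicalSpace G] [ChartedSpace E G] [Group G]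
    [LieGroup 𝓘(ℝ, E) ∞ G] (Γ : E →L[ℝ] E →L[ℝ] E)
    (J : DoubleSpace E →ₗ[ℝ] DoubleSpace E) : Prop :=
  ∀ (p : E →L[ℝ] ℝ) (a a' : DoubleSpace E),
    J (frameBracket G Γ p a a' - frameBracket G Γ p (-J a) (-J a'))
      = -(frameBracket G Γ p a (-J a') + frameBracket G Γ p (-J a) a')

/-- Integrability is tested on the frame fields of `a` and `-J a`, which are the real and imaginary
parts of a section of the holomorphic bundle. -/
theorem symbolIntegrable_of_isIntegrable (hD : HasCoeff D Γ) (hJ : HasSymbol 𝒥 J)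
    (hJJ : ∀ a, J (J a) = -a) (h : IsIntegrable (cotModel E) (cotACS 𝒥 D)) :
    SymbolIntegrable G Γ J := by
  intro p a a'
  let F : DoubleSpace E → Cₛ^∞⟮cotModel E; E × (E →L[ℝ] ℝ),
      fun γ : Cotangent E G => TangentSpace (cotModel E) γ⟯ := fun a =>
    ⟨cotField a.1 a.2 (Γ a.1), contMDiff_cotField _ _ _⟩
  have hF : ∀ a, fieldFrame Γ (F a) = fun _ => a := fun a =>
    funext fun γ => frameCoord_cotField a γ
  have hFJ : ∀ (a : DoubleSpace E) (γ : Cotangent E G),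
      cotACS 𝒥 D γ (F a γ) = -F (-J a) γ ∧ cotACS 𝒥 D γ (F (-J a) γ) = F a γ := by
    intro a γ
    have hFa : ∀ a, frameCoord Γ γ (F a γ) = a := fun a => frameCoord_cotField a γ
    constructor
    · apply frameCoord_injective (Γ := Γ)
      rw [frameCoord_cotACS hD hJ, ContinuousLinearMap.map_neg, hFa, hFa, neg_neg]
    · apply frameCoord_injective (Γ := Γ)
      rw [frameCoord_cotACS hD hJ, hFa, hFa, map_neg, hJJ, neg_neg]
  -- The structure equations depend on the point only through its momentum, so the covectors at `1`
  -- suffice to realize every `p`.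
  let γ : Cotangent E G := cotOf (1, p)
  have hp : momentum γ = p := momentum_cotOf 1 p
  have hbr : ∀ a b, frameCoord Γ γ (mlieBracket (cotModel E) (F a) (F b) γ)
      = frameBracket G Γ p a b := by
    intro a b
    rw [frameCoord_mlieBracket (F a).contMDiff (F b).contMDiff, hF, hF, mvfderiv_const,
      mvfderiv_const, hp, zero_apply, zero_apply, sub_zero, zero_add]
  have h1 := congrArg (frameCoord Γ γ)
    (h (F a) (F (-J a)) (F a') (F (-J a')) (hFJ a) (hFJ a') γ).1
  rw [frameCoord_cotACS hD hJ, ContinuousLinearMap.map_neg, ContinuousLinearMap.map_sub,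
    ContinuousLinearMap.map_add, hbr, hbr, hbr, hbr] at h1
  exact h1

theorem sub_rearrange {V : Type*} [AddCommGroup V] (x y z t u v : V) :
    x - y + u - (-z - -t + v) = x - y + z - t + (u - v) := by abel

theorem add_rearrange {V : Type*} [AddCommGroup V] (x y z t u v : V) :
    -x - t + u + (y - -z + v) = -x + z + y - t + (u + v) := by abel

theorem neg_rearrange {V : Type*} [AddCommGroup V] (x y z t u : V) :
    x - y + -z - -t + -u = -(-x + y + z - t + u) := by abel

-- For a section A + iB of the holomorphic bundle the coordinates of B are `-J` of those of A. As
-- `J` is constant the same holds for their derivatives, so the derivative terms of the bracket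
-- satisfy the eigenvalue equation by themselves and only the frame brackets need `h`.
set_option maxHeartbeats 1000000 in
theorem isIntegrable_of_symbolIntegrable (hD : HasCoeff D Γ) (hJ : HasSymbol 𝒥 J)
    (hJJ : ∀ a, J (J a) = -a) (h : SymbolIntegrable G Γ J) :
    IsIntegrable (cotModel E) (cotACS 𝒥 D) := by
  intro A B A' B' hAB hAB' γ
  let Jc : DoubleSpace E →L[ℝ] DoubleSpace E := J.toContinuousLinearMap
  have hB : ∀ {C C' : Cₛ^∞⟮cotModel E; E × (E →L[ℝ] ℝ),
      fun γ : Cotangent E G => TangentSpace (cotModel E) γ⟯},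
      (∀ γ, cotACS 𝒥 D γ (C γ) = -C' γ ∧ cotACS 𝒥 D γ (C' γ) = C γ) →
      fieldFrame Γ C' = fun γ => (-Jc) (fieldFrame Γ C γ) := by
    intro C C' hC
    funext γ
    have h1 := congrArg (frameCoord Γ γ) (hC γ).1
    rw [frameCoord_cotACS hD hJ, ContinuousLinearMap.map_neg] at h1
    exact neg_eq_iff_eq_neg.1 h1.symm
  have hdB : ∀ {C C' : Cₛ^∞⟮cotModel E; E × (E →L[ℝ] ℝ),
      fun γ : Cotangent E G => TangentSpace (cotModel E) γ⟯},
      (∀ γ, cotACS 𝒥 D γ (C γ) = -C' γ ∧ cotACS 𝒥 D γ (C' γ) = C γ) →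
      ∀ v : TangentSpace (cotModel E) γ,
        mvfderiv (cotModel E) (fieldFrame Γ C') γ v
          = -J (mvfderiv (cotModel E) (fieldFrame Γ C) γ v) := by
    intro C C' hC v
    rw [hB hC]
    exact mvfderiv_clm_comp (-Jc) ((contMDiff_fieldFrame C.contMDiff).mdifferentiableAt (by simp)) v
  have hB1 : fieldFrame Γ B γ = -J (fieldFrame Γ A γ) := congrFun (hB hAB) γ
  have hB2 : fieldFrame Γ B' γ = -J (fieldFrame Γ A' γ) := congrFun (hB hAB') γ
  have hd1 := hdB hAB
  have hd2 := hdB hAB'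
  have e1 : frameCoord Γ γ (mlieBracket (cotModel E) A A' γ - mlieBracket (cotModel E) B B' γ)
      = (mvfderiv (cotModel E) (fieldFrame Γ A') γ (A γ)
        - mvfderiv (cotModel E) (fieldFrame Γ A) γ (A' γ)
        + J (mvfderiv (cotModel E) (fieldFrame Γ A') γ (B γ))
        - J (mvfderiv (cotModel E) (fieldFrame Γ A) γ (B' γ)))
        + (frameBracket G Γ (momentum γ) (fieldFrame Γ A γ) (fieldFrame Γ A' γ)
          - frameBracket G Γ (momentum γ) (-J (fieldFrame Γ A γ)) (-J (fieldFrame Γ A' γ))) := by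
    rw [ContinuousLinearMap.map_sub, frameCoord_mlieBracket A.contMDiff A'.contMDiff,
      frameCoord_mlieBracket B.contMDiff B'.contMDiff, hd1, hd2, hB1, hB2]
    exact sub_rearrange _ _ _ _ _ _
  have e2 : frameCoord Γ γ (mlieBracket (cotModel E) A B' γ + mlieBracket (cotModel E) B A' γ)
      = (-J (mvfderiv (cotModel E) (fieldFrame Γ A') γ (A γ))
        + J (mvfderiv (cotModel E) (fieldFrame Γ A) γ (A' γ))
        + mvfderiv (cotModel E) (fieldFrame Γ A') γ (B γ)
        - mvfderiv (cotModel E) (fieldFrame Γ A) γ (B' γ))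
        + (frameBracket G Γ (momentum γ) (fieldFrame Γ A γ) (-J (fieldFrame Γ A' γ))
          + frameBracket G Γ (momentum γ) (-J (fieldFrame Γ A γ)) (fieldFrame Γ A' γ)) := by
    rw [ContinuousLinearMap.map_add, frameCoord_mlieBracket A.contMDiff B'.contMDiff,
      frameCoord_mlieBracket B.contMDiff A'.contMDiff, hd1, hd2, hB1, hB2]
    exact add_rearrange _ _ _ _ _ _
  have h1 : frameCoord Γ γ (cotACS 𝒥 D γ
      (mlieBracket (cotModel E) A A' γ - mlieBracket (cotModel E) B B' γ))
      = frameCoord Γ γ (-(mlieBracket (cotModel E) A B' γ + mlieBracket (cotModel E) B A' γ)) := by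
    rw [frameCoord_cotACS hD hJ, ContinuousLinearMap.map_neg, e1, e2, map_add, h]
    simp only [map_add, map_sub, hJJ]
    exact neg_rearrange _ _ _ _ _
  -- Applying `J` to the first equation gives the second.
  refine ⟨frameCoord_injective γ h1, frameCoord_injective (Γ := Γ) γ ?_⟩
  rw [frameCoord_cotACS hD hJ]
  rw [frameCoord_cotACS hD hJ, ContinuousLinearMap.map_neg] at h1
  have h2 := congrArg J h1
  rw [hJJ, map_neg] at h2
  exact (neg_injective h2).symm

end Integrability

end GenCplx

namespace GenCplx

/-! ### Real and imaginary parts in the complexification -/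

section Complexification

variable {V : Type*} [AddCommGroup V] [Module ℝ V]

/-- The element `x + i y` of `V^ℂ`. -/
def mkC (x y : V) : ℂ ⊗[ℝ] V := (1 : ℂ) ⊗ₜ[ℝ] x + Complex.I ⊗ₜ[ℝ] y

theorem one_tmul_eq_mkC (x : V) : (1 : ℂ) ⊗ₜ[ℝ] x = mkC x 0 := by simp [mkC]

theorem mkC_zero : mkC (0 : V) 0 = 0 := by simp [mkC]

theorem mkC_add (x y x' y' : V) : mkC x y + mkC x' y' = mkC (x + x') (y + y') := by
  simp only [mkC, TensorProduct.tmul_add]; abel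

theorem mkC_neg (x y : V) : -mkC x y = mkC (-x) (-y) := by
  simp only [mkC, TensorProduct.tmul_neg]; abel

theorem mkC_sub (x y x' y' : V) : mkC x y - mkC x' y' = mkC (x - x') (y - y') := by
  rw [sub_eq_add_neg, mkC_neg, mkC_add, sub_eq_add_neg, sub_eq_add_neg]

theorem smul_mkC (c : ℂ) (x y : V) :
    c • mkC x y = mkC (c.re • x - c.im • y) (c.im • x + c.re • y) := by
  have h1 : ∀ (c : ℂ) (x : V), c ⊗ₜ[ℝ] x = (1 : ℂ) ⊗ₜ[ℝ] (c.re • x)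
      + Complex.I ⊗ₜ[ℝ] (c.im • x) := by
    intro c x
    rw [← TensorProduct.smul_tmul, ← TensorProduct.smul_tmul, ← TensorProduct.add_tmul]
    congr 1
    apply Complex.ext <;> simp
  rw [mkC, smul_add, TensorProduct.smul_tmul', TensorProduct.smul_tmul', h1, h1 (c • Complex.I)]
  simp [mkC, TensorProduct.tmul_add, TensorProduct.tmul_sub, TensorProduct.tmul_neg]
  abel

theorem exists_eq_mkC (w : ℂ ⊗[ℝ] V) : ∃ x y, w = mkC x y := by
  induction w using TensorProduct.induction_on with
  | zero => exact ⟨0, 0, mkC_zero.symm⟩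
  | tmul c x =>
    refine ⟨c.re • x, c.im • x, ?_⟩
    have := smul_mkC c x 0
    simpa [← one_tmul_eq_mkC, TensorProduct.smul_tmul'] using this
  | add a b ha hb =>
    obtain ⟨x, y, rfl⟩ := ha
    obtain ⟨x', y', rfl⟩ := hb
    exact ⟨_, _, mkC_add ..⟩

/-- The real part `V^ℂ → V`. -/
def reC : ℂ ⊗[ℝ] V →ₗ[ℝ] V :=
  (TensorProduct.lid ℝ V).toLinearMap ∘ₗ LinearMap.rTensor V Complex.reLm

/-- The imaginary part `V^ℂ → V`. -/
def imC : ℂ ⊗[ℝ] V →ₗ[ℝ] V :=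
  (TensorProduct.lid ℝ V).toLinearMap ∘ₗ LinearMap.rTensor V Complex.imLm

@[simp] theorem reC_mkC (x y : V) : reC (mkC x y) = x := by simp [reC, mkC]

@[simp] theorem imC_mkC (x y : V) : imC (mkC x y) = y := by simp [imC, mkC]

theorem mkC_inj {x y x' y' : V} : mkC x y = mkC x' y' ↔ x = x' ∧ y = y' := by
  constructor
  · intro h
    exact ⟨by simpa using congrArg reC h, by simpa using congrArg imC h⟩
  · rintro ⟨rfl, rfl⟩
    rfl

theorem conj_mkC (x y : V) : conj (mkC x y) = mkC x (-y) := by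
  have h : ∀ (c : ℂ) (x : V), conj (c ⊗ₜ[ℝ] x) = (starRingEnd ℂ c) ⊗ₜ[ℝ] x := fun c x => rfl
  simp [mkC, h, TensorProduct.tmul_neg, TensorProduct.neg_tmul]

theorem conj_conj (x : ℂ ⊗[ℝ] V) : conj (conj x) = x := by
  obtain ⟨x, y, rfl⟩ := exists_eq_mkC x
  simp [conj_mkC]

theorem mem_map_conj {F : Submodule ℂ (ℂ ⊗[ℝ] V)} {x : ℂ ⊗[ℝ] V} :
    x ∈ F.map conj ↔ conj x ∈ F := by
  constructor
  · rintro ⟨y, hy, rfl⟩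
    rwa [conj_conj]
  · intro h
    exact ⟨_, h, conj_conj x⟩

theorem tau_tau (s : Kind) (x : ℂ ⊗[ℝ] V) : tau s (tau s x) = x := by
  cases s
  · exact conj_conj x
  · rfl

theorem mem_tauSubmodule {s : Kind} {F : Submodule ℂ (ℂ ⊗[ℝ] V)} {x : ℂ ⊗[ℝ] V} :
    x ∈ tauSubmodule s F ↔ tau s x ∈ F := by
  cases s
  · exact mem_map_conj
  · rfl

theorem tau_one_tmul (s : Kind) (x : V) : tau s ((1 : ℂ) ⊗ₜ[ℝ] x) = (1 : ℂ) ⊗ₜ[ℝ] x := by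
  cases s
  · change conj _ = _
    rw [one_tmul_eq_mkC, conj_mkC, neg_zero]
  · rfl

theorem complexify_mkC (B : V →ₗ[ℝ] V →ₗ[ℝ] V) (x y x' y' : V) :
    complexify B (mkC x y) (mkC x' y') = mkC (B x x' - B y y') (B x y' + B y x') := by
  have h : ∀ (c d : ℂ) (x y : V), complexify B (c ⊗ₜ[ℝ] x) (d ⊗ₜ[ℝ] y) = (c * d) ⊗ₜ[ℝ] B x y := by
    intro c d x y
    simp [complexify, TensorProduct.smul_tmul']
  simp only [mkC, map_add, LinearMap.add_apply, h, one_mul, mul_one, Complex.I_mul_I,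
    TensorProduct.neg_tmul, TensorProduct.tmul_sub, TensorProduct.tmul_add]
  abel

theorem mem_realPart_iff {F : Submodule ℂ (ℂ ⊗[ℝ] V)} {v : V} :
    v ∈ realPart F ↔ (1 : ℂ) ⊗ₜ[ℝ] v ∈ F := by
  refine ⟨fun h => h.1, fun h => ⟨h, mem_map_conj.2 ?_⟩⟩
  rwa [one_tmul_eq_mkC, conj_mkC, neg_zero, ← one_tmul_eq_mkC]

/-- A subspace whose sum with its conjugate is everything contains vectors of arbitrary real
part. -/
theorem exists_mkC_mem {F : Submodule ℂ (ℂ ⊗[ℝ] V)} (hF : F ⊔ F.map conj = ⊤) (x : V) :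
    ∃ y, mkC x y ∈ F := by
  have hx : mkC x 0 ∈ F ⊔ F.map conj := hF ▸ Submodule.mem_top
  obtain ⟨u, hu, v, hv, huv⟩ := Submodule.mem_sup.1 hx
  obtain ⟨u1, u2, rfl⟩ := exists_eq_mkC u
  obtain ⟨v1, v2, rfl⟩ := exists_eq_mkC v
  rw [mem_map_conj, conj_mkC] at hv
  rw [mkC_add, mkC_inj] at huv
  refine ⟨u2 - v2, ?_⟩
  have := F.add_mem hu hv
  rwa [mkC_add, huv.1, ← sub_eq_add_neg] at this

theorem sup_conj_eq_top {F : Submodule ℂ (ℂ ⊗[ℝ] V)} (hF : ∀ x, ∃ y, mkC x y ∈ F) :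
    F ⊔ F.map conj = ⊤ := by
  have h1 : ∀ x : V, mkC x 0 ∈ F ⊔ F.map conj := by
    intro x
    -- A vector plus its conjugate is twice its real part.
    obtain ⟨y, hy⟩ := hF ((1 / 2 : ℝ) • x)
    refine Submodule.mem_sup.2 ⟨_, hy, _, Submodule.mem_map_of_mem hy, ?_⟩
    rw [conj_mkC, mkC_add, ← add_smul]
    norm_num
  refine eq_top_iff.2 fun w _ => ?_
  obtain ⟨x, y, rfl⟩ := exists_eq_mkC w
  have h2 := Submodule.add_mem _ (h1 x) (Submodule.smul_mem _ Complex.I (h1 y))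
  simpa [smul_mkC, mkC_add] using h2

theorem tauSubmodule_sup_conj (s : Kind) {F : Submodule ℂ (ℂ ⊗[ℝ] V)} (hF : F ⊔ F.map conj = ⊤) :
    tauSubmodule s F ⊔ (tauSubmodule s F).map conj = ⊤ := by
  cases s
  · refine sup_conj_eq_top fun x => ?_
    obtain ⟨y, hy⟩ := exists_mkC_mem hF x
    exact ⟨-y, mem_map_conj.2 (by rwa [conj_mkC, neg_neg])⟩
  · exact hF

end Complexification

/-! ### The holomorphic space of a generalized complex structure -/

section Double

variable {V : Type*} [AddCommGroup V] [Module ℝ V] [TopologicalSpace V]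

theorem proj₁_mkC (a b : DoubleSpace V) : proj₁ (mkC a b) = mkC a.1 b.1 := by
  simp [proj₁, mkC]

theorem proj₂_mkC (a b : DoubleSpace V) (x y : V) :
    proj₂ (mkC a b) (mkC x y) = ⟨a.2 x - b.2 y, a.2 y + b.2 x⟩ := by
  have h : ∀ (c d : ℂ) (a : DoubleSpace V) (x : V),
      proj₂ (c ⊗ₜ[ℝ] a) (d ⊗ₜ[ℝ] x) = c * d * (a.2 x : ℂ) := by
    intro c d a x
    simp [proj₂, Module.Dual.baseChange]
    ring
  simp only [mkC, map_add, LinearMap.add_apply, h, one_mul, mul_one, Complex.I_mul_I]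
  apply Complex.ext <;> simp [sub_eq_add_neg, add_comm]

/-- The i-eigenspace consists of the vectors a − iJa, so each of its elements is determined by its
real part. -/
theorem mkC_mem_holSpace {J : DoubleSpace V →ₗ[ℝ] DoubleSpace V} (hJ : ∀ a, J (J a) = -a)
    (a b : DoubleSpace V) : mkC a b ∈ holSpace J ↔ b = -J a := by
  have h : J.baseChange ℂ (mkC a b) = mkC (J a) (J b) := by simp [mkC]
  rw [holSpace, Module.End.mem_eigenspace_iff, h, smul_mkC, mkC_inj]
  simp only [Complex.I_re, Complex.I_im, zero_smul, one_smul, zero_sub, add_zero]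
  constructor
  · rintro ⟨h1, -⟩
    rw [h1, neg_neg]
  · rintro rfl
    simp [hJ]

theorem exists_of_mem_holSpace {J : DoubleSpace V →ₗ[ℝ] DoubleSpace V} (hJ : ∀ a, J (J a) = -a)
    {w : ℂ ⊗[ℝ] DoubleSpace V} (hw : w ∈ holSpace J) : ∃ a, w = mkC a (-J a) := by
  obtain ⟨a, b, rfl⟩ := exists_eq_mkC w
  exact ⟨a, by rw [(mkC_mem_holSpace hJ a b).1 hw]⟩

theorem holSpace_injective {J J' : DoubleSpace V →ₗ[ℝ] DoubleSpace V} (hJ : ∀ a, J (J a) = -a)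
    (hJ' : ∀ a, J' (J' a) = -a) (h : holSpace J = holSpace J') : J = J' := by
  refine LinearMap.ext fun a => ?_
  have h1 := (mkC_mem_holSpace hJ a (-J a)).2 rfl
  rw [h] at h1
  exact neg_injective ((mkC_mem_holSpace hJ' a _).1 h1)

/-- Points of the holomorphic space of `J` are orthogonal, up to the action of `τ`. -/
theorem IsGenCplx.proj₂_tau {s : Kind} {J : DoubleSpace V →ₗ[ℝ] DoubleSpace V}
    (hJ : IsGenCplx s J) {w w' : ℂ ⊗[ℝ] DoubleSpace V} (hw : w ∈ holSpace J)
    (hw' : w' ∈ holSpace J) :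
    proj₂ w (tau s (proj₁ w')) + tauScalar s (proj₂ w' (tau s (proj₁ w))) = 0 := by
  obtain ⟨a, rfl⟩ := exists_of_mem_holSpace hJ.sq hw
  obtain ⟨b, rfl⟩ := exists_of_mem_holSpace hJ.sq hw'
  rw [proj₁_mkC, proj₁_mkC]
  have h1 := hJ.compat
  cases s
  · have h2 := h1 a b
    have h3 := h1 a (J b)
    rw [hJ.sq] at h3
    simp only [gCan, Prod.fst_neg, Prod.snd_neg, neg_apply, map_neg] at h2 h3
    simp only [tau, tauScalar, conj_mkC, proj₂_mkC, Prod.fst_neg, Prod.snd_neg,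
      neg_apply, neg_neg]
    apply Complex.ext <;> simp <;> linarith
  · have h2 := h1 a b
    have h3 := h1 a (J b)
    rw [hJ.sq] at h3
    simp only [gCan, Prod.fst_neg, Prod.snd_neg, neg_apply, map_neg] at h2 h3
    simp only [tau, tauScalar, proj₂_mkC, Prod.fst_neg, Prod.snd_neg,
      neg_apply, map_neg, neg_neg]
    apply Complex.ext <;> simp <;> linarith

theorem sup_conj_map_proj₁ {J : DoubleSpace V →ₗ[ℝ] DoubleSpace V} (hJ : ∀ a, J (J a) = -a) :
    (holSpace J).map proj₁ ⊔ ((holSpace J).map proj₁).map conj = ⊤ :=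
  sup_conj_eq_top fun x => ⟨(-J (x, 0)).1, _, (mkC_mem_holSpace hJ (x, 0) _).2 rfl,
    proj₁_mkC _ _⟩

/-- `α` is skew-symmetric, up to the action of `τ`. -/
def TauSkew (s : Kind) {F : Submodule ℂ (ℂ ⊗[ℝ] V)} (α : F →ₗ[ℂ] tauSubmodule s F →ₗ[ℂ] ℂ) :
    Prop :=
  ∀ X Y : F, α X ⟨tau s Y, tau_mem s Y.2⟩ + tauScalar s (α Y ⟨tau s X, tau_mem s X.2⟩) = 0

/-- The imaginary part of `α` on the real part of `F` is non-degenerate. -/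
def ImNondegenerate (s : Kind) {F : Submodule ℂ (ℂ ⊗[ℝ] V)}
    (α : F →ₗ[ℂ] tauSubmodule s F →ₗ[ℂ] ℂ) : Prop :=
  ∀ (x : V) (hx : x ∈ realPart F),
    (∀ (y : V) (hy : y ∈ realPart F),
      (α ⟨(1 : ℂ) ⊗ₜ[ℝ] x, mem_of_mem_realPart hx⟩
        ⟨(1 : ℂ) ⊗ₜ[ℝ] y, tau_mem_of_mem_realPart s hy⟩).im = 0) → x = 0

section LTau

variable {s : Kind} {F : Submodule ℂ (ℂ ⊗[ℝ] V)} {α : F →ₗ[ℂ] tauSubmodule s F →ₗ[ℂ] ℂ}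

theorem tauSkew_of_holSpace_eq {J : DoubleSpace V →ₗ[ℝ] DoubleSpace V} (hJ : IsGenCplx s J)
    (hF : F = (holSpace J).map proj₁)
    (hL : (holSpace J : Set (ℂ ⊗[ℝ] DoubleSpace V)) = LTau s F α) : TauSkew s α := by
  rintro ⟨X, hX⟩ ⟨Y, hY⟩
  obtain ⟨w, hw, rfl⟩ := hF.le hX
  obtain ⟨w', hw', rfl⟩ := hF.le hY
  have h := hJ.proj₂_tau hw hw'
  obtain ⟨_, h1⟩ : w ∈ LTau s F α := hL.subset hw
  obtain ⟨_, h2⟩ : w' ∈ LTau s F α := hL.subset hw'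
  rw [← h1, ← h2]
  exact h

theorem LTau_unique {α' : F →ₗ[ℂ] tauSubmodule s F →ₗ[ℂ] ℂ}
    {L : Submodule ℂ (ℂ ⊗[ℝ] DoubleSpace V)} (hF : F = L.map proj₁)
    (h : (L : Set (ℂ ⊗[ℝ] DoubleSpace V)) = LTau s F α)
    (h' : (L : Set (ℂ ⊗[ℝ] DoubleSpace V)) = LTau s F α') : α = α' := by
  refine LinearMap.ext fun X => LinearMap.ext fun Y => ?_
  obtain ⟨X, hX⟩ := X
  obtain ⟨w, hw, rfl⟩ := hF.le hX
  obtain ⟨_, h1⟩ : w ∈ LTau s F α := h.subset hw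
  obtain ⟨_, h2⟩ : w ∈ LTau s F α' := h'.subset hw
  rw [← h1, ← h2]

end LTau

end Double

/-! ### From the endomorphism to the form: existence of `α` and non-degeneracy -/

section FiniteDimensional

set_option linter.unusedSectionVars false

variable {V : Type*} [AddCommGroup V] [Module ℝ V] [TopologicalSpace V]
  [IsTopologicalAddGroup V] [ContinuousSMul ℝ V] [T2Space V] [FiniteDimensional ℝ V]

/-- Any complex linear functional on `V^ℂ` is the projection of a point of `(V ⊕ V*)^ℂ` with a
prescribed vector part. -/
theorem exists_proj_eq (X : ℂ ⊗[ℝ] V) (ξ : Module.Dual ℂ (ℂ ⊗[ℝ] V)) :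
    ∃ w : ℂ ⊗[ℝ] DoubleSpace V, proj₁ w = X ∧ proj₂ w = ξ := by
  obtain ⟨x, y, rfl⟩ := exists_eq_mkC X
  let l : V →ₗ[ℝ] ℂ := ξ.restrictScalars ℝ ∘ₗ TensorProduct.mk ℝ ℂ V 1
  let p : V →L[ℝ] ℝ := LinearMap.toContinuousLinearMap (Complex.reLm ∘ₗ l)
  let q : V →L[ℝ] ℝ := LinearMap.toContinuousLinearMap (Complex.imLm ∘ₗ l)
  have hp : ∀ v, p v = (ξ (1 ⊗ₜ v)).re := fun v => rfl
  have hq : ∀ v, q v = (ξ (1 ⊗ₜ v)).im := fun v => rfl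
  refine ⟨mkC (x, p) (y, q), proj₁_mkC _ _, LinearMap.ext fun Z => ?_⟩
  obtain ⟨z, t, rfl⟩ := exists_eq_mkC Z
  have hI : mkC z t = (1 : ℂ) ⊗ₜ[ℝ] z + Complex.I • ((1 : ℂ) ⊗ₜ[ℝ] t) := by
    simp [mkC, TensorProduct.smul_tmul']
  rw [proj₂_mkC, hI, map_add, map_smul]
  apply Complex.ext <;> simp [hp, hq] <;> ring

theorem mem_of_forall_dual {F : Submodule ℂ (ℂ ⊗[ℝ] V)} {X : ℂ ⊗[ℝ] V}
    (h : ∀ η : Module.Dual ℂ (ℂ ⊗[ℝ] V), (∀ Y ∈ F, η Y = 0) → η X = 0) : X ∈ F := by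
  by_contra hX
  obtain ⟨f, hf, hF⟩ := Submodule.exists_dual_map_eq_bot_of_notMem hX inferInstance
  refine hf (h f fun Y hY => ?_)
  have : f Y ∈ F.map f := Submodule.mem_map_of_mem hY
  rwa [hF, Submodule.mem_bot] at this

theorem eq_zero_of_forall_real {X : ℂ ⊗[ℝ] V}
    (h : ∀ p : V →L[ℝ] ℝ, proj₂ (mkC ((0 : V), p) 0) X = 0) : X = 0 := by
  obtain ⟨x, y, rfl⟩ := exists_eq_mkC X
  have h1 : ∀ v : V, (∀ p : V →L[ℝ] ℝ, p v = 0) → v = 0 := by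
    intro v hv
    exact (Module.forall_dual_apply_eq_zero_iff ℝ v).1
      fun φ => hv (LinearMap.toContinuousLinearMap φ)
  have h2 : ∀ p : V →L[ℝ] ℝ, p x = 0 ∧ p y = 0 := by
    intro p
    have := h p
    rw [proj₂_mkC, Complex.ext_iff] at this
    simpa using this
  rw [h1 x fun p => (h2 p).1, h1 y fun p => (h2 p).2, mkC_zero]

variable {s : Kind}

/-- Isotropy shows that an element of the holomorphic space with zero vector part has a covector
part vanishing on τ(F). Hence the restriction of ξ to τ(F) depends only on X, linearly. The reverse
inclusion is the maximality of the holomorphic space among isotropic subspaces. -/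
theorem exists_LTau_eq {J : DoubleSpace V →ₗ[ℝ] DoubleSpace V} (hJ : IsGenCplx s J)
    {F : Submodule ℂ (ℂ ⊗[ℝ] V)} (hF : F = (holSpace J).map proj₁) :
    ∃ α : F →ₗ[ℂ] tauSubmodule s F →ₗ[ℂ] ℂ,
      (holSpace J : Set (ℂ ⊗[ℝ] DoubleSpace V)) = LTau s F α := by
  let f : holSpace J →ₗ[ℂ] F :=
    proj₁.restrict fun w hw => hF.ge (Submodule.mem_map_of_mem hw)
  have hf : ∀ w, (f w : ℂ ⊗[ℝ] V) = proj₁ (w : ℂ ⊗[ℝ] DoubleSpace V) := fun _ => rfl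
  have hfs : LinearMap.range f = ⊤ := by
    refine LinearMap.range_eq_top.2 fun X => ?_
    obtain ⟨w, hw, hwX⟩ := hF.le X.2
    exact ⟨⟨w, hw⟩, Subtype.ext hwX⟩
  obtain ⟨g, hg⟩ := f.exists_rightInverse_of_surjective hfs
  let β : holSpace J →ₗ[ℂ] tauSubmodule s F →ₗ[ℂ] ℂ :=
    LinearMap.lcomp ℂ ℂ (tauSubmodule s F).subtype ∘ₗ proj₂ ∘ₗ (holSpace J).subtype
  have hβ : ∀ w Y, β w Y = proj₂ (w : ℂ ⊗[ℝ] DoubleSpace V) Y := fun _ _ => rfl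
  have hgf : ∀ w, f (g (f w)) = f w := fun w => LinearMap.congr_fun hg (f w)
  have hker : ∀ w, f w = 0 → β w = 0 := by
    intro w hw
    refine LinearMap.ext fun Y => ?_
    obtain ⟨w', hw', hY⟩ := hF.le (mem_tauSubmodule.1 Y.2)
    have h := hJ.proj₂_tau w.2 hw'
    have h0 : tau s (proj₁ (w : ℂ ⊗[ℝ] DoubleSpace V)) = 0 := by
      rw [← hf, hw]
      cases s
      · exact map_zero _
      · rfl
    rw [hY, tau_tau, h0, map_zero] at h
    have h1 : tauScalar s 0 = 0 := by cases s <;> simp [tauScalar]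
    rwa [h1, add_zero] at h
  have hαf : ∀ w, β (g (f w)) = β w := by
    intro w
    rw [← sub_eq_zero, ← map_sub]
    exact hker _ (by rw [map_sub, hgf, sub_self])
  refine ⟨β ∘ₗ g, Set.Subset.antisymm (fun w hw => ?_) ?_⟩
  · refine ⟨hF.ge (Submodule.mem_map_of_mem hw), fun Y => ?_⟩
    exact (LinearMap.congr_fun (hαf ⟨w, hw⟩) Y).symm
  · rintro w ⟨hX, hα⟩
    -- subtract a point of the holomorphic space with the same projection
    set u := g ⟨proj₁ w, hX⟩ with hu
    have hpu : proj₁ (u : ℂ ⊗[ℝ] DoubleSpace V) = proj₁ w :=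
      congrArg Subtype.val (LinearMap.congr_fun hg ⟨proj₁ w, hX⟩)
    have hd1 : proj₁ (w - (u : ℂ ⊗[ℝ] DoubleSpace V)) = 0 := by rw [map_sub, hpu, sub_self]
    have hd2 : ∀ Y ∈ tauSubmodule s F, proj₂ (w - (u : ℂ ⊗[ℝ] DoubleSpace V)) Y = 0 := by
      intro Y hY
      rw [map_sub, LinearMap.sub_apply, sub_eq_zero]
      exact hα ⟨Y, hY⟩
    suffices h : w - (u : ℂ ⊗[ℝ] DoubleSpace V) ∈ holSpace J by simpa using Submodule.add_mem _ h u.2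
    obtain ⟨a, b, hab⟩ := exists_eq_mkC (w - (u : ℂ ⊗[ℝ] DoubleSpace V))
    rw [hab] at hd1 hd2 ⊢
    rw [proj₁_mkC, ← mkC_zero, mkC_inj] at hd1
    obtain ⟨ha, hb⟩ := hd1
    rw [mkC_mem_holSpace hJ.sq]
    -- the point is orthogonal to `c - i J c` or its conjugate for any `c`
    have key : ∀ c : DoubleSpace V, b.2 c.1 = -(J a).2 c.1 - c.2 (J a).1 := by
      intro c
      have hY : tau s (mkC c.1 (-J c).1) ∈ tauSubmodule s F :=
        tau_mem s (hF.ge ⟨_, (mkC_mem_holSpace hJ.sq c _).2 rfl, proj₁_mkC _ _⟩)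
      have h := hd2 _ hY
      have hc := hJ.compat
      cases s
      · have h3 := hc a c
        simp only [tau, conj_mkC, proj₂_mkC, Complex.ext_iff, Complex.zero_re, Complex.zero_im,
          Prod.fst_neg, neg_neg] at h
        simp only [gCan, ha, map_zero] at h3
        linarith [h.2]
      · have h3 := hc a c
        simp only [tau, proj₂_mkC, Complex.ext_iff, Complex.zero_re, Complex.zero_im,
          Prod.fst_neg, map_neg] at h
        simp only [gCan, ha, map_zero] at h3
        linarith [h.2]
    -- Pure covectors in place of `c` kill the vector part of J a; pure vectors then identify the
    -- covector part of b with that of −J a.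
    have h1 : (J a).1 = 0 := by
      refine (Module.forall_dual_apply_eq_zero_iff ℝ _).1 fun φ => ?_
      have := key (0, LinearMap.toContinuousLinearMap φ)
      simpa using this
    refine Prod.ext (by rw [hb, Prod.fst_neg, h1, neg_zero]) (ContinuousLinearMap.ext fun v => ?_)
    have := key (v, 0)
    simpa using this

/-- If Im α(x, ·) vanishes on Δ, then Re α(x, u) depends only on Re u and so defines a real covector
p. The real vector x + p lies in the holomorphic space, which contains no nonzero real vector. -/
theorem imNondegenerate_of_holSpace_eq {J : DoubleSpace V →ₗ[ℝ] DoubleSpace V}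
    (hJ : IsGenCplx s J) {F : Submodule ℂ (ℂ ⊗[ℝ] V)} (hF : F = (holSpace J).map proj₁)
    {α : F →ₗ[ℂ] tauSubmodule s F →ₗ[ℂ] ℂ}
    (hL : (holSpace J : Set (ℂ ⊗[ℝ] DoubleSpace V)) = LTau s F α) : ImNondegenerate s α := by
  intro x hx h
  have hsup : tauSubmodule s F ⊔ (tauSubmodule s F).map conj = ⊤ :=
    tauSubmodule_sup_conj s (by rw [hF]; exact sup_conj_map_proj₁ hJ.sq)
  let X : F := ⟨(1 : ℂ) ⊗ₜ[ℝ] x, mem_of_mem_realPart hx⟩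
  let S : tauSubmodule s F →ₗ[ℝ] V := reC ∘ₗ (tauSubmodule s F).subtype.restrictScalars ℝ
  let r : tauSubmodule s F →ₗ[ℝ] ℝ := Complex.reLm ∘ₗ (α X).restrictScalars ℝ
  have hS : LinearMap.range S = ⊤ := by
    refine LinearMap.range_eq_top.2 fun v => ?_
    obtain ⟨y, hy⟩ := exists_mkC_mem hsup v
    exact ⟨⟨_, hy⟩, reC_mkC _ _⟩
  obtain ⟨g, hg⟩ := S.exists_rightInverse_of_surjective hS
  -- An element of τ(F) with zero real part is iy with y in Δ, and Re α(x, iy) = −Im α(x, y).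
  have hker : ∀ u, S u = 0 → r u = 0 := by
    rintro ⟨u, hu⟩ h0
    obtain ⟨u1, y, rfl⟩ := exists_eq_mkC u
    have h1 : u1 = 0 := by rw [← reC_mkC u1 y]; exact h0
    subst h1
    have hIy : mkC 0 y = Complex.I • ((1 : ℂ) ⊗ₜ[ℝ] y) := by simp [mkC, TensorProduct.smul_tmul']
    have hy1 : (1 : ℂ) ⊗ₜ[ℝ] y ∈ tauSubmodule s F := by
      have := Submodule.smul_mem _ (-Complex.I) hu
      rwa [hIy, smul_smul, neg_mul, Complex.I_mul_I, neg_neg, one_smul] at this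
    have hy : y ∈ realPart F := by
      rw [mem_realPart_iff]
      rwa [mem_tauSubmodule, tau_one_tmul] at hy1
    have hu' : (⟨mkC 0 y, hu⟩ : tauSubmodule s F) = Complex.I • ⟨(1 : ℂ) ⊗ₜ[ℝ] y, hy1⟩ :=
      Subtype.ext hIy
    change (α X _).re = 0
    rw [hu', map_smul]
    simpa [X] using h y hy
  let p : V →L[ℝ] ℝ := LinearMap.toContinuousLinearMap (r ∘ₗ g)
  have hp : ∀ u, p (S u) = r u := by
    intro u
    change r (g (S u)) = r u
    rw [← sub_eq_zero, ← map_sub]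
    exact hker _ (by rw [map_sub, sub_eq_zero]; exact LinearMap.congr_fun hg (S u))
  have hmem : mkC (x, p) 0 ∈ LTau s F α := by
    have hx1 : proj₁ (mkC (x, p) 0) = (1 : ℂ) ⊗ₜ[ℝ] x := by
      rw [proj₁_mkC, one_tmul_eq_mkC]; rfl
    refine ⟨by rw [hx1]; exact X.2, fun Y => ?_⟩
    have hX : (⟨proj₁ (mkC (x, p) 0), by rw [hx1]; exact X.2⟩ : F) = X := Subtype.ext hx1
    rw [hX]
    have h1 : p (S Y) = (α X Y).re := hp Y
    -- Multiplication by −i moves imaginary parts to real parts, so the identity for real parts also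
    -- yields the one for imaginary parts.
    have h2 : p (S (-Complex.I • Y)) = (α X (-Complex.I • Y)).re := hp _
    have hSY : ∀ Y, S Y = reC (Y : ℂ ⊗[ℝ] V) := fun _ => rfl
    rw [hSY] at h1 h2
    obtain ⟨Y, hY⟩ := Y
    obtain ⟨y, z, rfl⟩ := exists_eq_mkC Y
    rw [map_smul, SetLike.val_smul] at h2
    simp [smul_mkC] at h1 h2
    rw [proj₂_mkC]
    apply Complex.ext <;> simp [h1, h2]
  have h1 : mkC (x, p) 0 ∈ holSpace J := hL.superset hmem
  rw [mkC_mem_holSpace hJ.sq] at h1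
  have h2 : J (x, p) = 0 := by rw [← neg_eq_zero, ← h1]
  have h3 := hJ.sq (x, p)
  rw [h2, map_zero] at h3
  exact congrArg Prod.fst (neg_eq_zero.1 h3.symm)

/-- `L^τ(F, α)` as a complex subspace. -/
def LTauSubmodule (s : Kind) (F : Submodule ℂ (ℂ ⊗[ℝ] V))
    (α : F →ₗ[ℂ] tauSubmodule s F →ₗ[ℂ] ℂ) : Submodule ℂ (ℂ ⊗[ℝ] DoubleSpace V) where
  carrier := LTau s F α
  zero_mem' := by
    refine ⟨by rw [map_zero]; exact F.zero_mem, fun Y => ?_⟩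
    have : (⟨proj₁ (0 : ℂ ⊗[ℝ] DoubleSpace V), by rw [map_zero]; exact F.zero_mem⟩ : F) = 0 :=
      Subtype.ext (map_zero _)
    rw [this]
    simp
  add_mem' := by
    rintro w w' ⟨h, e⟩ ⟨h', e'⟩
    have hs : proj₁ (w + w') ∈ F := by rw [map_add]; exact F.add_mem h h'
    refine ⟨hs, fun Y => ?_⟩
    have : (⟨proj₁ (w + w'), hs⟩ : F) = ⟨proj₁ w, h⟩ + ⟨proj₁ w', h'⟩ :=
      Subtype.ext (map_add _ _ _)
    rw [this, map_add, map_add, LinearMap.add_apply, LinearMap.add_apply, e, e']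
  smul_mem' := by
    rintro c w ⟨h, e⟩
    have hs : proj₁ (c • w) ∈ F := by rw [map_smul]; exact F.smul_mem c h
    refine ⟨hs, fun Y => ?_⟩
    have : (⟨proj₁ (c • w), hs⟩ : F) = c • ⟨proj₁ w, h⟩ := Subtype.ext (map_smul _ _ _)
    rw [this, map_smul, map_smul, LinearMap.smul_apply, LinearMap.smul_apply, e]

@[simp] theorem mem_LTauSubmodule {s : Kind} {F : Submodule ℂ (ℂ ⊗[ℝ] V)}
    {α : F →ₗ[ℂ] tauSubmodule s F →ₗ[ℂ] ℂ} {w : ℂ ⊗[ℝ] DoubleSpace V} :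
    w ∈ LTauSubmodule s F α ↔ w ∈ LTau s F α := Iff.rfl

/-! ### From the form to the endomorphism -/

section Construction

variable {F : Submodule ℂ (ℂ ⊗[ℝ] V)} {α : F →ₗ[ℂ] tauSubmodule s F →ₗ[ℂ] ℂ}

theorem mem_LTau_of_proj {w : ℂ ⊗[ℝ] DoubleSpace V} {X : F} (hX : proj₁ w = X)
    (h : ∀ Y : tauSubmodule s F, proj₂ w Y = α X Y) : w ∈ LTau s F α := by
  have hw : proj₁ w ∈ F := hX ▸ X.2
  refine ⟨hw, fun Y => ?_⟩
  rw [h Y]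
  congr 2
  exact Subtype.ext hX.symm

theorem exists_mem_LTau (X : F) : ∃ w ∈ LTau s F α, proj₁ w = X := by
  obtain ⟨ξ, hξ⟩ := LinearMap.exists_extend (α X)
  obtain ⟨w, hw1, hw2⟩ := exists_proj_eq (X : ℂ ⊗[ℝ] V) ξ
  exact ⟨w, mem_LTau_of_proj hw1 fun Y => by rw [hw2]; exact LinearMap.congr_fun hξ Y, hw1⟩

theorem map_proj₁_LTauSubmodule : (LTauSubmodule s F α).map proj₁ = F := by
  refine le_antisymm ?_ fun X hX => ?_
  · rintro _ ⟨w, ⟨h, -⟩, rfl⟩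
    exact h
  · obtain ⟨w, hw, e⟩ := exists_mem_LTau (α := α) ⟨X, hX⟩
    exact ⟨w, hw, e⟩

theorem TauSkew.proj₂_tau (hα : TauSkew s α) {w w' : ℂ ⊗[ℝ] DoubleSpace V}
    (hw : w ∈ LTau s F α) (hw' : w' ∈ LTau s F α) :
    proj₂ w (tau s (proj₁ w')) + tauScalar s (proj₂ w' (tau s (proj₁ w))) = 0 := by
  obtain ⟨h, e⟩ := hw
  obtain ⟨h', e'⟩ := hw'
  have := hα ⟨_, h⟩ ⟨_, h'⟩
  rwa [← e, ← e'] at this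

theorem tauScalar_eq_zero {s : Kind} {z : ℂ} : tauScalar s z = 0 ↔ z = 0 := by
  cases s <;> simp [tauScalar]

/-- `L^τ(F, α)` is maximal isotropic. -/
theorem TauSkew.mem_LTau (hα : TauSkew s α) {w : ℂ ⊗[ℝ] DoubleSpace V}
    (h : ∀ w' ∈ LTau s F α,
      proj₂ w (tau s (proj₁ w')) + tauScalar s (proj₂ w' (tau s (proj₁ w))) = 0) :
    w ∈ LTau s F α := by
  have hX : proj₁ w ∈ F := by
    rw [← tau_tau s (proj₁ w), ← mem_tauSubmodule]
    refine mem_of_forall_dual fun η hη => ?_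
    -- Covectors annihilating τ(F) belong to L^τ(F, α); orthogonality to all of them forces the
    -- vector part of `w` into F.
    obtain ⟨w', hw1, hw2⟩ := exists_proj_eq (0 : ℂ ⊗[ℝ] V) η
    have h1 := h w' (mem_LTau_of_proj (X := 0) hw1 fun Y => by rw [hw2, hη _ Y.2]; simp)
    have h0 : tau s (0 : ℂ ⊗[ℝ] V) = 0 := by
      cases s
      · exact map_zero _
      · rfl
    rwa [hw1, hw2, h0, map_zero, zero_add, tauScalar_eq_zero] at h1
  refine ⟨hX, fun Y => ?_⟩
  obtain ⟨w', hw', hY⟩ := exists_mem_LTau (α := α) ⟨_, mem_tauSubmodule.1 Y.2⟩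
  have h1 := h w' hw'
  have h2 := hα ⟨_, hX⟩ ⟨_, mem_tauSubmodule.1 Y.2⟩
  obtain ⟨h', e'⟩ := hw'
  have h3 : proj₂ w' (tau s (proj₁ w)) =
      α ⟨_, mem_tauSubmodule.1 Y.2⟩ ⟨tau s (proj₁ w), tau_mem s hX⟩ := by
    rw [e' ⟨tau s (proj₁ w), tau_mem s hX⟩]
    congr 2
    exact Subtype.ext hY
  rw [h3, hY] at h1
  have h4 := add_right_cancel (h1.trans h2.symm)
  have h5 : (⟨tau s (tau s Y), tau_mem s (mem_tauSubmodule.1 Y.2)⟩ : tauSubmodule s F) = Y :=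
    Subtype.ext (tau_tau s _)
  exact (congrArg (proj₂ w) (tau_tau s _)).symm.trans
    (h4.trans (congrArg (α ⟨proj₁ w, hX⟩) h5))

/-- For a real vector x + p in L^τ(F, α), α(x, y) = p(y) is real for y in Δ, hence x = 0. Then p
vanishes on τ(F), whose real parts fill V. -/
theorem ImNondegenerate.eq_zero_of_mem (hF : F ⊔ F.map conj = ⊤) (hn : ImNondegenerate s α)
    {a : DoubleSpace V} (ha : mkC a 0 ∈ LTau s F α) : a = 0 := by
  obtain ⟨h, e⟩ := ha
  have h1 : proj₁ (mkC a 0) = (1 : ℂ) ⊗ₜ[ℝ] a.1 := by rw [proj₁_mkC, one_tmul_eq_mkC]; rfl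
  have hx : a.1 ∈ realPart F := mem_realPart_iff.2 (h1 ▸ h)
  have hx0 : a.1 = 0 := by
    refine hn a.1 hx fun y hy => ?_
    have h2 := e ⟨_, tau_mem_of_mem_realPart s hy⟩
    have h3 : (⟨proj₁ (mkC a 0), h⟩ : F) = ⟨_, mem_of_mem_realPart hx⟩ := Subtype.ext h1
    rw [h3] at h2
    rw [← h2]
    change (proj₂ (mkC a 0) ((1 : ℂ) ⊗ₜ[ℝ] y)).im = 0
    rw [one_tmul_eq_mkC, proj₂_mkC]
    simp
  refine Prod.ext hx0 (ContinuousLinearMap.ext fun v => ?_)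
  obtain ⟨y, hy⟩ := exists_mkC_mem (tauSubmodule_sup_conj s hF) v
  have h2 := e ⟨_, hy⟩
  have h3 : (⟨proj₁ (mkC a 0), h⟩ : F) = 0 :=
    Subtype.ext (h1.trans (by rw [hx0, TensorProduct.tmul_zero]; rfl))
  rw [h3, map_zero, LinearMap.zero_apply, proj₂_mkC, Complex.ext_iff] at h2
  simpa using h2.1

/-- The canonical pairing on V ⊕ V* is perfect because V is reflexive. -/
theorem exists_pair_eq (φ : DoubleSpace V →ₗ[ℝ] ℝ) : ∃ a : DoubleSpace V,
    ∀ b, φ b = a.2 b.1 + b.2 a.1 := by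
  let ψ : Module.Dual ℝ V →ₗ[ℝ] ℝ :=
    φ ∘ₗ LinearMap.inr ℝ V (V →L[ℝ] ℝ) ∘ₗ (LinearMap.toContinuousLinearMap (𝕜 := ℝ)).toLinearMap
  obtain ⟨x, hx⟩ := (Module.evalEquiv ℝ V).surjective ψ
  refine ⟨(x, LinearMap.toContinuousLinearMap (φ ∘ₗ LinearMap.inl ℝ V (V →L[ℝ] ℝ))), fun b => ?_⟩
  have h1 : ψ b.2.toLinearMap = b.2 x := by rw [← hx]; rfl
  have h2 : ψ b.2.toLinearMap = φ (0, b.2) := rfl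
  have h3 : φ b = φ (b.1, 0) + φ (0, b.2) := by rw [← map_add]; simp
  rw [h3, ← h2, h1]
  rfl

/-- The subspaces `L^τ(F, α)` with `α` skew-symmetric and `Im α` non-degenerate are transverse to
their conjugates. -/
theorem exists_mkC_mem_LTau (hF : F ⊔ F.map conj = ⊤) (hα : TauSkew s α)
    (hn : ImNondegenerate s α) (a : DoubleSpace V) : ∃ b, mkC a b ∈ LTau s F α := by
  let R : LTauSubmodule s F α →ₗ[ℝ] DoubleSpace V :=
    reC ∘ₗ (LTauSubmodule s F α).subtype.restrictScalars ℝ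
  suffices hR : LinearMap.range R = ⊤ by
    obtain ⟨⟨w, hw⟩, hwa⟩ := LinearMap.range_eq_top.1 hR a
    obtain ⟨x, y, rfl⟩ := exists_eq_mkC w
    have : x = a := by rw [← hwa]; exact (reC_mkC x y).symm
    exact ⟨y, this ▸ hw⟩
  -- Otherwise some nonzero functional kills all real parts. The vector `c` representing it is
  -- orthogonal to L^τ(F, α), hence belongs to it by maximality, and being real it is zero.
  by_contra hR
  obtain ⟨φ, hφ, hker⟩ := Submodule.exists_le_ker_of_lt_top _ (lt_top_iff_ne_top.2 hR)
  obtain ⟨c, hc⟩ := exists_pair_eq φ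
  have h0 : ∀ x y, mkC x y ∈ LTau s F α → c.2 x.1 + x.2 c.1 = 0 := by
    intro x y hxy
    rw [← hc]
    have := hker ⟨(⟨_, hxy⟩ : LTauSubmodule s F α), rfl⟩
    have hx : R ⟨_, hxy⟩ = x := reC_mkC _ _
    rwa [hx] at this
  -- Closure under multiplication by −i turns imaginary parts into real parts.
  have h1 : ∀ x y, mkC x y ∈ LTau s F α → c.2 y.1 + y.2 c.1 = 0 := by
    intro x y hxy
    refine h0 y (-x) ?_
    have := (LTauSubmodule s F α).smul_mem (-Complex.I) hxy
    rw [smul_mkC] at this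
    simpa using this
  have hcL : mkC c 0 ∈ LTau s F α := by
    refine hα.mem_LTau fun w hw => ?_
    obtain ⟨x, y, rfl⟩ := exists_eq_mkC w
    have e0 := h0 x y hw
    have e1 := h1 x y hw
    rw [proj₁_mkC, proj₁_mkC]
    cases s
    · simp only [tau, tauScalar, conj_mkC, proj₂_mkC]
      apply Complex.ext <;> simp <;> linarith
    · simp only [tau, tauScalar, proj₂_mkC]
      apply Complex.ext <;> simp <;> linarith
  have hc0 := hn.eq_zero_of_mem hF hcL
  refine hφ (LinearMap.ext fun b => ?_)
  rw [hc, hc0]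
  simp

/-- Every a is the real part of exactly one a + i f(a) in L^τ(F, α), and J = −f. Multiplication by
−i gives f(f a) = −a, and isotropy gives compatibility with the metric. -/
theorem exists_isGenCplx (hF : F ⊔ F.map conj = ⊤) (hα : TauSkew s α)
    (hn : ImNondegenerate s α) : ∃ J : DoubleSpace V →ₗ[ℝ] DoubleSpace V, IsGenCplx s J ∧
      F = (holSpace J).map proj₁ ∧
      (holSpace J : Set (ℂ ⊗[ℝ] DoubleSpace V)) = LTau s F α := by
  choose f hf using exists_mkC_mem_LTau hF hα hn
  -- Two elements with the same real part differ by i times a real vector, which then lies in the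
  -- subspace and vanishes.
  have huniq : ∀ {a b}, mkC a b ∈ LTau s F α → b = f a := by
    intro a b hab
    have h1 := (LTauSubmodule s F α).sub_mem hab (hf a)
    rw [mkC_sub, sub_self] at h1
    have h2 := (LTauSubmodule s F α).smul_mem (-Complex.I) h1
    rw [smul_mkC] at h2
    exact sub_eq_zero.1 (hn.eq_zero_of_mem hF (a := b - f a) (by simpa using h2))
  have hadd : ∀ a b, f (a + b) = f a + f b := fun a b => by
    have := (LTauSubmodule s F α).add_mem (hf a) (hf b)
    rw [mkC_add] at this
    exact (huniq this).symm
  have hsmul : ∀ (c : ℝ) a, f (c • a) = c • f a := fun c a => by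
    have := (LTauSubmodule s F α).smul_mem (c : ℂ) (hf a)
    rw [smul_mkC] at this
    exact (huniq (by simpa using this)).symm
  let J : DoubleSpace V →ₗ[ℝ] DoubleSpace V :=
    { toFun := fun a => -f a
      map_add' := fun a b => by rw [hadd, neg_add]
      map_smul' := fun c a => by rw [hsmul, smul_neg]; rfl }
  have hJf : ∀ a, J a = -f a := fun _ => rfl
  have hff : ∀ a, f (f a) = -a := fun a => by
    have := (LTauSubmodule s F α).smul_mem (-Complex.I) (hf a)
    rw [smul_mkC] at this
    exact (huniq (by simpa using this)).symm
  have hneg : ∀ a, f (-a) = -f a := fun a => by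
    rw [← neg_one_smul ℝ a, hsmul, neg_one_smul ℝ (f a)]
  have hJJ : ∀ a, J (J a) = -a := fun a => by rw [hJf, hJf, hneg, hff, neg_neg]
  have hmem : ∀ w, w ∈ holSpace J ↔ w ∈ LTau s F α := by
    intro w
    obtain ⟨a, b, rfl⟩ := exists_eq_mkC w
    rw [mkC_mem_holSpace hJJ, hJf, neg_neg]
    exact ⟨fun h => h ▸ hf a, huniq⟩
  refine ⟨J, ⟨hJJ, ?_⟩, ?_, Set.ext hmem⟩
  · have key := fun a b => hα.proj₂_tau (hf a) (hf b)
    simp only [proj₁_mkC] at key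
    cases s
    · intro a b
      have h := key a b
      simp only [tau, tauScalar, conj_mkC, proj₂_mkC, Complex.ext_iff] at h
      simp at h
      simp only [gCan, hJf, Prod.fst_neg, Prod.snd_neg, map_neg, neg_apply]
      linarith [h.2]
    · intro a b
      have h := key a b
      simp only [tau, tauScalar, proj₂_mkC, Complex.ext_iff] at h
      simp at h
      simp only [gCan, hJf, Prod.fst_neg, Prod.snd_neg, map_neg, neg_apply]
      linarith [h.2]
  · have : holSpace J = LTauSubmodule s F α := SetLike.ext hmem
    rw [this, map_proj₁_LTauSubmodule]

end Construction

end FiniteDimensional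

end GenCplx

namespace GenCplx

/-! ### Closedness under the frame bracket and admissible triples -/

section Triples

set_option linter.unusedSectionVars false

variable {V : Type*} [LieRing V] [LieAlgebra ℝ V] [TopologicalSpace V]
  [IsTopologicalAddGroup V] [ContinuousSMul ℝ V] [T2Space V] [FiniteDimensional ℝ V]

theorem lie_mkC (x y x' y' : V) :
    ⁅mkC x y, mkC x' y'⁆ = mkC (⁅x, x'⁆ - ⁅y, y'⁆) (⁅x, y'⁆ + ⁅y, x'⁆) := by
  simp only [mkC, lie_add, add_lie, LieAlgebra.ExtendScalars.bracket_tmul, one_mul, mul_one,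
    Complex.I_mul_I, TensorProduct.neg_tmul, TensorProduct.tmul_sub, TensorProduct.tmul_add]
  abel

theorem lie_zero_tensor (X : ℂ ⊗[ℝ] V) : ⁅X, (0 : ℂ ⊗[ℝ] V)⁆ = 0 := by
  obtain ⟨x, y, rfl⟩ := exists_eq_mkC X
  rw [← mkC_zero, lie_mkC]
  simp only [lie_zero, sub_zero, add_zero]

/-- `B p` is the bracket of the frame of `T*G` determined by `Γ`, at points with momentum `p`. -/
structure IsFrameBracket (Γ : V →ₗ[ℝ] V →ₗ[ℝ] V)
    (B : (V →L[ℝ] ℝ) → DoubleSpace V → DoubleSpace V → DoubleSpace V) : Prop where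
  fst : ∀ p a b, (B p a b).1 = ⁅a.1, b.1⁆
  snd : ∀ p a b v, (B p a b).2 v = a.2 (Γ b.1 v) - b.2 (Γ a.1 v)
    + p (Γ a.1 (Γ b.1 v) - Γ b.1 (Γ a.1 v) - Γ ⁅a.1, b.1⁆ v)

/-- The complex bilinear extension of `B`. -/
def bracketC (B : DoubleSpace V → DoubleSpace V → DoubleSpace V) (w w' : ℂ ⊗[ℝ] DoubleSpace V) :
    ℂ ⊗[ℝ] DoubleSpace V :=
  mkC (B (reC w) (reC w') - B (imC w) (imC w')) (B (reC w) (imC w') + B (imC w) (reC w'))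

theorem bracketC_mkC (B : DoubleSpace V → DoubleSpace V → DoubleSpace V)
    (a b a' b' : DoubleSpace V) :
    bracketC B (mkC a b) (mkC a' b') = mkC (B a a' - B b b') (B a b' + B b a') := by
  simp only [bracketC, reC_mkC, imC_mkC]

/-- The curvature of the complex bilinear extension of `Γ`. -/
def curvC (Γ : V →ₗ[ℝ] V →ₗ[ℝ] V) (X Y Z : ℂ ⊗[ℝ] V) : ℂ ⊗[ℝ] V :=
  complexify Γ X (complexify Γ Y Z) - complexify Γ Y (complexify Γ X Z) - complexify Γ ⁅X, Y⁆ Z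

variable {Γ : V →ₗ[ℝ] V →ₗ[ℝ] V}
  {B : (V →L[ℝ] ℝ) → DoubleSpace V → DoubleSpace V → DoubleSpace V}

theorem IsFrameBracket.proj₁_bracketC (hB : IsFrameBracket Γ B) (p : V →L[ℝ] ℝ)
    (w w' : ℂ ⊗[ℝ] DoubleSpace V) : proj₁ (bracketC (B p) w w') = ⁅proj₁ w, proj₁ w'⁆ := by
  obtain ⟨a, b, rfl⟩ := exists_eq_mkC w
  obtain ⟨a', b', rfl⟩ := exists_eq_mkC w'
  simp only [bracketC_mkC, proj₁_mkC, lie_mkC, Prod.fst_sub, Prod.fst_add, hB.fst]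

/-- This isolates the dependence on p: `mkC (0, p) 0` is the real covector p, and it is paired with
the curvature alone. -/
theorem IsFrameBracket.proj₂_bracketC (hB : IsFrameBracket Γ B) (p : V →L[ℝ] ℝ)
    (w w' : ℂ ⊗[ℝ] DoubleSpace V) (Z : ℂ ⊗[ℝ] V) :
    proj₂ (bracketC (B p) w w') Z = proj₂ w (complexify Γ (proj₁ w') Z)
      - proj₂ w' (complexify Γ (proj₁ w) Z)
      + proj₂ (mkC ((0 : V), p) 0) (curvC Γ (proj₁ w) (proj₁ w') Z) := by
  obtain ⟨a, b, rfl⟩ := exists_eq_mkC w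
  obtain ⟨a', b', rfl⟩ := exists_eq_mkC w'
  obtain ⟨x, y, rfl⟩ := exists_eq_mkC Z
  simp only [curvC, bracketC_mkC, proj₁_mkC, lie_mkC, complexify_mkC, mkC_sub, proj₂_mkC]
  apply Complex.ext
  · simp only [Complex.add_re, Complex.sub_re, Prod.snd_sub, Prod.snd_add, sub_apply, add_apply,
      hB.snd, map_sub, map_add, LinearMap.sub_apply, LinearMap.add_apply, Prod.snd_zero, zero_apply]
    ring
  · simp only [Complex.add_im, Complex.sub_im, Prod.snd_sub, Prod.snd_add, sub_apply, add_apply,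
      hB.snd, map_sub, map_add, LinearMap.sub_apply, LinearMap.add_apply, Prod.snd_zero, zero_apply]
    ring

variable {J : DoubleSpace V →ₗ[ℝ] DoubleSpace V}

/-- The real form of the closedness of the holomorphic space under the brackets `B p`. -/
def IsClosedUnder (J : DoubleSpace V →ₗ[ℝ] DoubleSpace V)
    (B : (V →L[ℝ] ℝ) → DoubleSpace V → DoubleSpace V → DoubleSpace V) : Prop :=
  ∀ (p : V →L[ℝ] ℝ) (a a' : DoubleSpace V),
    J (B p a a' - B p (-J a) (-J a')) = -(B p a (-J a') + B p (-J a) a')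

theorem isClosedUnder_iff (hJ : ∀ a, J (J a) = -a) :
    IsClosedUnder J B ↔ ∀ p, ∀ w ∈ holSpace J, ∀ w' ∈ holSpace J,
      bracketC (B p) w w' ∈ holSpace J := by
  constructor
  · intro h p w hw w' hw'
    obtain ⟨a, rfl⟩ := exists_of_mem_holSpace hJ hw
    obtain ⟨a', rfl⟩ := exists_of_mem_holSpace hJ hw'
    rw [bracketC_mkC, mkC_mem_holSpace hJ, h, neg_neg]
  · intro h p a a'
    have h1 := h p _ ((mkC_mem_holSpace hJ a _).2 rfl) _ ((mkC_mem_holSpace hJ a' _).2 rfl)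
    rw [bracketC_mkC, mkC_mem_holSpace hJ] at h1
    rw [h1, neg_neg]

variable {s : Kind}

/-- Flatness on τ(𝔨) removes p from the bracket, and the equation for ε says that the remaining
covector part is ε([X,Y], ·) on τ(𝔨). -/
theorem isClosedUnder_of_triple (hB : IsFrameBracket Γ B) (hJ : IsGenCplx s J)
    (T : AdmissibleTriple s V) (hΓ : T.𝒟 = Γ)
    (hL : (holSpace J : Set (ℂ ⊗[ℝ] DoubleSpace V)) = LTau s T.𝔨.toSubmodule T.ε) :
    IsClosedUnder J B := by
  subst hΓ
  rw [isClosedUnder_iff hJ.sq]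
  intro p w hw w' hw'
  obtain ⟨h, e⟩ : w ∈ LTau s T.𝔨.toSubmodule T.ε := hL.subset hw
  obtain ⟨h', e'⟩ : w' ∈ LTau s T.𝔨.toSubmodule T.ε := hL.subset hw'
  have hmem := T.𝔨.lie_mem h h'
  refine hL.superset (mem_LTau_of_proj (X := ⟨_, hmem⟩) (hB.proj₁_bracketC p w w') fun Y => ?_)
  have hc : curvC T.𝒟 (proj₁ w) (proj₁ w') Y = 0 := by
    rw [← neg_eq_zero, ← T.curv _ h _ h' _ Y.2, curvC]
    abel
  rw [hB.proj₂_bracketC, hc, map_zero, add_zero]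
  -- The equation for ε is stated for arguments τ(Z), so it is used with Z = τ(Y).
  have h1 := T.ε_eq ⟨_, h⟩ ⟨_, h'⟩ ⟨_, mem_tauSubmodule.1 Y.2⟩
  rw [← e, ← e'] at h1
  have h2 : (⟨tau s (tau s Y), tau_mem s (mem_tauSubmodule.1 Y.2)⟩ :
      tauSubmodule s T.𝔨.toSubmodule) = Y := Subtype.ext (tau_tau s _)
  simp only [tau_tau] at h1
  exact h1

theorem exists_symbol (hB : IsFrameBracket Γ B) (T : AdmissibleTriple s V) (hΓ : T.𝒟 = Γ) :
    ∃ J : DoubleSpace V →ₗ[ℝ] DoubleSpace V, IsGenCplx s J ∧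
      T.𝔨.toSubmodule = (holSpace J).map proj₁ ∧
      (holSpace J : Set (ℂ ⊗[ℝ] DoubleSpace V)) = LTau s T.𝔨.toSubmodule T.ε ∧
      IsClosedUnder J B := by
  obtain ⟨J, hJ, h1, h2⟩ := exists_isGenCplx T.sup_conj T.ε_tau T.nondegenerate
  exact ⟨J, hJ, h1, h2, isClosedUnder_of_triple hB hJ T hΓ h2⟩

theorem exists_triple (hB : IsFrameBracket Γ B) (hJ : IsGenCplx s J) (h : IsClosedUnder J B) :
    ∃ T : AdmissibleTriple s V, T.𝔨.toSubmodule = (holSpace J).map proj₁ ∧ T.𝒟 = Γ ∧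
      (holSpace J : Set (ℂ ⊗[ℝ] DoubleSpace V)) = LTau s T.𝔨.toSubmodule T.ε := by
  rw [isClosedUnder_iff hJ.sq] at h
  let 𝔨 : LieSubalgebra ℂ (ℂ ⊗[ℝ] V) :=
    { (holSpace J).map proj₁ with
      lie_mem' := by
        rintro _ _ ⟨w, hw, rfl⟩ ⟨w', hw', rfl⟩
        exact ⟨_, h 0 w hw w' hw', hB.proj₁_bracketC 0 w w'⟩ }
  have hF : 𝔨.toSubmodule = (holSpace J).map proj₁ := rfl
  obtain ⟨α, hL⟩ := exists_LTau_eq hJ hF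
  have hanti := tauSkew_of_holSpace_eq hJ hF hL
  have hnd := imNondegenerate_of_holSpace_eq hJ hF hL
  -- the components of the bracket
  have key : ∀ p, ∀ w ∈ holSpace J, ∀ w' ∈ holSpace J, ∀ X : 𝔨.toSubmodule,
      (X : ℂ ⊗[ℝ] V) = ⁅proj₁ w, proj₁ w'⁆ → ∀ Z : tauSubmodule s 𝔨.toSubmodule,
      proj₂ w (complexify Γ (proj₁ w') Z) - proj₂ w' (complexify Γ (proj₁ w) Z)
        + proj₂ (mkC ((0 : V), p) 0) (curvC Γ (proj₁ w) (proj₁ w') Z) = α X Z := by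
    intro p w hw w' hw' X hX Z
    obtain ⟨h1, e⟩ : bracketC (B p) w w' ∈ LTau s 𝔨.toSubmodule α := hL.subset (h p w hw w' hw')
    rw [← hB.proj₂_bracketC p, e]
    congr 2
    exact Subtype.ext ((hB.proj₁_bracketC p w w').trans hX.symm)
  have hdef : ∀ X ∈ 𝔨.toSubmodule, ∀ W ∈ tauSubmodule s 𝔨.toSubmodule,
      complexify Γ X W ∈ tauSubmodule s 𝔨.toSubmodule := by
    rintro _ ⟨w, hw, rfl⟩ W hW
    refine mem_of_forall_dual fun η hη => ?_
    -- Bracketing `w` with a pure covector η that annihilates τ(𝔨) gives zero vector part, so the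
    -- covector part −η(Γ_X ·) must vanish on τ(𝔨) as well.
    obtain ⟨w', hw1, hw2⟩ := exists_proj_eq (0 : ℂ ⊗[ℝ] V) η
    have hw' : w' ∈ holSpace J := hL.superset
      (mem_LTau_of_proj (X := 0) hw1 fun Y => by rw [hw2, hη _ Y.2]; simp)
    have h1 := key 0 w hw w' hw' 0 (by rw [hw1, lie_zero_tensor]; rfl) ⟨W, hW⟩
    have h2 : curvC Γ (proj₁ w) 0 W = 0 := by simp [curvC, lie_zero_tensor]
    rw [hw1, hw2, h2, map_zero, map_zero, LinearMap.zero_apply, map_zero, map_zero,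
      LinearMap.zero_apply, zero_sub, add_zero, neg_eq_zero] at h1
    exact h1
  have hcurv : ∀ X ∈ 𝔨.toSubmodule, ∀ Y ∈ 𝔨.toSubmodule, ∀ Z ∈ tauSubmodule s 𝔨.toSubmodule,
      curvC Γ X Y Z = 0 := by
    rintro _ ⟨w, hw, rfl⟩ _ ⟨w', hw', rfl⟩ Z hZ
    refine eq_zero_of_forall_real fun p => ?_
    have hX : ⁅proj₁ w, proj₁ w'⁆ ∈ 𝔨.toSubmodule := 𝔨.lie_mem ⟨w, hw, rfl⟩ ⟨w', hw', rfl⟩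
    -- The right side of `key` does not involve p; comparison with p = 0 shows that every real
    -- covector kills the curvature term.
    have h1 := key p w hw w' hw' ⟨_, hX⟩ rfl ⟨Z, hZ⟩
    have h2 := key 0 w hw w' hw' ⟨_, hX⟩ rfl ⟨Z, hZ⟩
    have h3 : mkC ((0 : V), (0 : V →L[ℝ] ℝ)) 0 = 0 := mkC_zero
    rw [h3, map_zero, LinearMap.zero_apply, ← h1] at h2
    exact (add_left_cancel h2).symm
  refine ⟨{ 𝔨 := 𝔨, 𝒟 := Γ, ε := α, sup_conj := sup_conj_map_proj₁ hJ.sq, 𝒟_mem := hdef,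
            curv := fun X hX Y hY Z hZ => ?_, ε_tau := hanti, ε_eq := ?_,
            nondegenerate := hnd }, rfl, rfl, hL⟩
  · have h1 := hcurv X hX Y hY Z hZ
    rw [← neg_eq_zero, curvC] at h1
    rw [← h1]
    abel
  · rintro ⟨X, hX⟩ ⟨Y, hY⟩ ⟨Z, hZ⟩
    obtain ⟨w, hw, rfl⟩ := hX
    obtain ⟨w', hw', rfl⟩ := hY
    obtain ⟨_, e⟩ : w ∈ LTau s 𝔨.toSubmodule α := hL.subset hw
    obtain ⟨_, e'⟩ : w' ∈ LTau s 𝔨.toSubmodule α := hL.subset hw'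
    rw [← e, ← e', ← key 0 w hw w' hw' _ rfl]
    have h3 : mkC ((0 : V), (0 : V →L[ℝ] ℝ)) 0 = 0 := mkC_zero
    rw [h3, map_zero, LinearMap.zero_apply, add_zero]

end Triples

end GenCplx

namespace GenCplx

/-! ### The bijection between integrable pairs and admissible triples -/

section Correspondence

set_option linter.unusedSectionVars false

variable {E : Type*} [NormedAddCommGroup E] [NormedSpace ℝ E] [FiniteDimensional ℝ E]
  {G : Type*} [TopologicalSpace G] [ChartedSpace E G] [Group G] [LieGroup 𝓘(ℝ, E) ∞ G]
  {s : Kind}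

theorem t2Space_groupLieAlgebra : T2Space (GroupLieAlgebra 𝓘(ℝ, E) G) :=
  inferInstanceAs (T2Space E)

theorem finiteDimensional_groupLieAlgebra : @FiniteDimensional ℝ (GroupLieAlgebra 𝓘(ℝ, E) G) _
    LieRing.toAddCommGroup LieAlgebra.toModule :=
  inferInstanceAs (FiniteDimensional ℝ E)

theorem isTopologicalAddGroup_groupLieAlgebra :
    @IsTopologicalAddGroup (GroupLieAlgebra 𝓘(ℝ, E) G) _ LieRing.toAddCommGroup.toAddGroup :=
  inferInstanceAs (IsTopologicalAddGroup E)

theorem continuousSMul_groupLieAlgebra : @ContinuousSMul ℝ (GroupLieAlgebra 𝓘(ℝ, E) G)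
    (@LieAlgebra.toModule ℝ (GroupLieAlgebra 𝓘(ℝ, E) G) _ _ _).toSMul _ _ :=
  inferInstanceAs (ContinuousSMul ℝ E)

attribute [local instance] t2Space_groupLieAlgebra finiteDimensional_groupLieAlgebra
  isTopologicalAddGroup_groupLieAlgebra continuousSMul_groupLieAlgebra

variable (G) in
/-- A bilinear map of the model space, as a bilinear map of the Lie algebra. -/
def lieCoeff (Γ : E →L[ℝ] E →L[ℝ] E) : GroupLieAlgebra 𝓘(ℝ, E) G →ₗ[ℝ]
    GroupLieAlgebra 𝓘(ℝ, E) G →ₗ[ℝ] GroupLieAlgebra 𝓘(ℝ, E) G :=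
  LinearMap.mk₂ ℝ (fun u v => Γ u v) (fun u u' v => Γ.map_add₂ u u' v)
    (fun c u v => Γ.map_smul₂ c u v) (fun u v v' => (Γ u).map_add v v')
    (fun c u v => (Γ u).map_smul c v)

theorem lieCoeff_surjective (𝒟 : GroupLieAlgebra 𝓘(ℝ, E) G →ₗ[ℝ]
    GroupLieAlgebra 𝓘(ℝ, E) G →ₗ[ℝ] GroupLieAlgebra 𝓘(ℝ, E) G) :
    ∃ Γ : E →L[ℝ] E →L[ℝ] E, lieCoeff G Γ = 𝒟 := by
  let Γ₀ : E →ₗ[ℝ] E →ₗ[ℝ] E := LinearMap.mk₂ ℝ (fun u v => 𝒟 u v)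
    (fun u u' v => 𝒟.map_add₂ u u' v) (fun c u v => 𝒟.map_smul₂ c u v)
    (fun u v v' => (𝒟 u).map_add v v') (fun c u v => (𝒟 u).map_smul c v)
  exact ⟨LinearMap.toContinuousLinearMap
    ((LinearMap.toContinuousLinearMap (𝕜 := ℝ)).toLinearMap ∘ₗ Γ₀), rfl⟩

theorem lieCoeff_injective {Γ Γ' : E →L[ℝ] E →L[ℝ] E} (h : lieCoeff G Γ = lieCoeff G Γ') :
    Γ = Γ' :=
  ContinuousLinearMap.ext fun u => ContinuousLinearMap.ext fun v =>
    LinearMap.congr_fun (LinearMap.congr_fun h u) v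

theorem isFrameBracket_frameBracket (Γ : E →L[ℝ] E →L[ℝ] E) :
    @IsFrameBracket (GroupLieAlgebra 𝓘(ℝ, E) G) _ _ (instTopologicalSpaceTangentSpace _ _)
      (lieCoeff G Γ) (frameBracket (E := E) G Γ) where
  fst _ _ _ := rfl
  snd _ _ _ _ := rfl

/-- The triple `T` is determined by the pair `P`. -/
def Matches (P : IntegrablePair E G s) (T : AdmissibleTriple s (GroupLieAlgebra 𝓘(ℝ, E) G)) :
    Prop :=
  T.𝔨.toSubmodule = (holSpace (P.𝒥.toFun (1 : G))).map proj₁ ∧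
  (∀ X Y : VField E G, IsLeftInvariantVField X → IsLeftInvariantVField Y → ∀ g : G,
    P.D.toFun Y g (X g) = mulInvariantVectorField (I := 𝓘(ℝ, E)) (T.𝒟 (X 1) (Y 1)) g) ∧
  (holSpace (P.𝒥.toFun (1 : G)) : Set _) = LTau s T.𝔨.toSubmodule T.ε

/-- Left-invariant fields have constant coordinates, so the derivative term of the connection drops
out and only its coefficient remains. -/
theorem restrict_iff {D : LinearConnection E G} {Γ : E →L[ℝ] E →L[ℝ] E} (hD : HasCoeff D Γ)
    (𝒟 : GroupLieAlgebra 𝓘(ℝ, E) G →ₗ[ℝ]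
      GroupLieAlgebra 𝓘(ℝ, E) G →ₗ[ℝ] GroupLieAlgebra 𝓘(ℝ, E) G) :
    (∀ X Y : VField E G, IsLeftInvariantVField X → IsLeftInvariantVField Y → ∀ g : G,
      D.toFun Y g (X g) = mulInvariantVectorField (I := 𝓘(ℝ, E)) (𝒟 (X 1) (Y 1)) g)
      ↔ 𝒟 = lieCoeff G Γ := by
  have h1 : ∀ u : E, leftField (G := G) u (1 : G) = u := fun u => ofLie_one (E := E) u
  constructor
  · intro h
    suffices h3 : ∀ u v : E, Γ u v = 𝒟 u v from
      LinearMap.ext fun u => LinearMap.ext fun v => (h3 u v).symm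
    intro u v
    have h2 := h (leftField (E := E) u) (leftField (E := E) v)
      (isLeftInvariant_leftField (E := E) u) (isLeftInvariant_leftField (E := E) v) 1
    rw [hD.apply_leftField, leftField_apply, toLie_ofLie] at h2
    exact ofLie_injective (1 : G) (h2.trans
      (congrArg₂ (fun a b : E => ofLie (E := E) (1 : G) (𝒟 a b)) (h1 u) (h1 v)))
  · rintro rfl X Y hX hY g
    obtain ⟨u, rfl⟩ := hX.exists_eq
    obtain ⟨v, rfl⟩ := hY.exists_eq
    rw [hD.apply_leftField, h1, h1, leftField_apply, toLie_ofLie]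
    rfl

theorem exists_matches (P : IntegrablePair E G s) : ∃ T, Matches P T := by
  obtain ⟨Γ, hΓ⟩ := P.leftInvariant_D.exists_hasCoeff
  have hJ := P.leftInvariant_𝒥.hasSymbol
  have hJg := P.𝒥.isGenCplx 1
  have hB := isFrameBracket_frameBracket (G := G) Γ
  have hc := symbolIntegrable_of_isIntegrable hΓ hJ hJg.sq P.integrable
  obtain ⟨T, h1, h2, h3⟩ := exists_triple hB (J := P.𝒥.toFun 1) (s := s) hJg hc
  exact ⟨T, h1, (restrict_iff hΓ T.𝒟).2 h2, h3⟩

theorem exists_matches_triple (T : AdmissibleTriple s (GroupLieAlgebra 𝓘(ℝ, E) G)) :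
    ∃ P : IntegrablePair E G s, Matches P T := by
  obtain ⟨Γ, hΓ⟩ := lieCoeff_surjective T.𝒟
  have hB := isFrameBracket_frameBracket (G := G) Γ
  obtain ⟨J, hJ, h1, h3, hint⟩ := exists_symbol (s := s) hB T hΓ.symm
  have hD := hasCoeff_connOfCoeff (G := G) Γ
  have h𝒥 := hasSymbol_genCplxOfSymbol (E := E) (G := G) J hJ
  have hone := h𝒥.toFun_one
  refine ⟨⟨genCplxOfSymbol (E := E) (G := G) J hJ, connOfCoeff Γ, h𝒥.isLeftInvariant,
    hD.isLeftInvariant, isIntegrable_of_symbolIntegrable hD h𝒥 hJ.sq hint⟩, ?_,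
    (restrict_iff hD T.𝒟).2 hΓ.symm, ?_⟩
  · change _ = (holSpace ((genCplxOfSymbol (E := E) (G := G) J hJ).toFun 1)).map proj₁
    rw [hone]
    exact h1
  · exact (congrArg (fun K : DoubleSpace E →ₗ[ℝ] DoubleSpace E =>
      (holSpace K : Set (ℂ ⊗[ℝ] DoubleSpace E))) hone).trans h3

theorem AdmissibleTriple.ext_of_LTau {𝔤 : Type*} [LieRing 𝔤] [LieAlgebra ℝ 𝔤] [TopologicalSpace 𝔤]
    {T T' : AdmissibleTriple s 𝔤} {L : Submodule ℂ (ℂ ⊗[ℝ] DoubleSpace 𝔤)}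
    (h : T.𝔨.toSubmodule = L.map proj₁) (h' : T'.𝔨.toSubmodule = L.map proj₁) (hD : T.𝒟 = T'.𝒟)
    (hL : (L : Set (ℂ ⊗[ℝ] DoubleSpace 𝔤)) = LTau s T.𝔨.toSubmodule T.ε)
    (hL' : (L : Set (ℂ ⊗[ℝ] DoubleSpace 𝔤)) = LTau s T'.𝔨.toSubmodule T'.ε) : T = T' := by
  obtain ⟨𝔨, 𝒟, ε, _⟩ := T
  obtain ⟨𝔨', 𝒟', ε', _⟩ := T'
  obtain rfl : 𝔨 = 𝔨' := LieSubalgebra.toSubmodule_injective (h.trans h'.symm)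
  obtain rfl : 𝒟 = 𝒟' := hD
  obtain rfl : ε = ε' := LTau_unique h hL hL'
  rfl

theorem Matches.triple_unique {P : IntegrablePair E G s}
    {T T' : AdmissibleTriple s (GroupLieAlgebra 𝓘(ℝ, E) G)} (h : Matches P T)
    (h' : Matches P T') : T = T' := by
  obtain ⟨Γ, hΓ⟩ := P.leftInvariant_D.exists_hasCoeff
  exact AdmissibleTriple.ext_of_LTau h.1 h'.1
    (((restrict_iff hΓ _).1 h.2.1).trans ((restrict_iff hΓ _).1 h'.2.1).symm) h.2.2 h'.2.2

/-- A left-invariant structure is determined by its value at the identity, which its holomorphic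
space there determines; a left-invariant connection is determined by its coefficient. -/
theorem Matches.pair_unique {P P' : IntegrablePair E G s}
    {T : AdmissibleTriple s (GroupLieAlgebra 𝓘(ℝ, E) G)} (h : Matches P T)
    (h' : Matches P' T) : P = P' := by
  obtain ⟨Γ, hΓ⟩ := P.leftInvariant_D.exists_hasCoeff
  obtain ⟨Γ', hΓ'⟩ := P'.leftInvariant_D.exists_hasCoeff
  have hΓΓ' : Γ = Γ' := lieCoeff_injective (G := G)
    (((restrict_iff hΓ _).1 h.2.1).symm.trans ((restrict_iff hΓ' _).1 h'.2.1))
  have hJJ' : P.𝒥.toFun (1 : G) = P'.𝒥.toFun (1 : G) :=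
    holSpace_injective (P.𝒥.isGenCplx 1).sq (P'.𝒥.isGenCplx 1).sq
      (SetLike.coe_injective (h.2.2.trans h'.2.2.symm))
  have h1 := P.leftInvariant_𝒥.hasSymbol
  have h2 := P'.leftInvariant_𝒥.hasSymbol
  rw [hJJ'] at h1
  exact IntegrablePair.ext (h1.unique h2) (hΓ.unique (hΓΓ' ▸ hΓ'))

end Correspondence

end GenCplx

end

theorem proposition4p2 {E : Type*} [NormedAddCommGroup E] [NormedSpace ℝ E]
    [FiniteDimensional ℝ E] {G : Type*} [TopologicalSpace G] [ChartedSpace E G] [Group G]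
    [LieGroup 𝓘(ℝ, E) ∞ G] (s : GenCplx.Kind) :
    ∃ Φ : GenCplx.IntegrablePair E G s ≃
        GenCplx.AdmissibleTriple s (GroupLieAlgebra 𝓘(ℝ, E) G),
      ∀ P : GenCplx.IntegrablePair E G s,
        -- the subalgebra is the fibre at `e` of the projection of the holomorphic bundle
        (Φ P).𝔨.toSubmodule = (GenCplx.holSpace (P.𝒥.toFun (1 : G))).map GenCplx.proj₁ ∧
        -- the bilinear map is the restriction of `D` to left-invariant vector fields
        (∀ X Y : GenCplx.VField E G,
          GenCplx.IsLeftInvariantVField X → GenCplx.IsLeftInvariantVField Y →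
            ∀ g : G, P.D.toFun Y g (X g)
              = mulInvariantVectorField (I := 𝓘(ℝ, E)) ((Φ P).𝒟 (X 1) (Y 1)) g) ∧
        -- the fibre at `e` of the holomorphic bundle is `L^τ(𝔨, ε)`
        (GenCplx.holSpace (P.𝒥.toFun (1 : G)) : Set _)
          = GenCplx.LTau s (Φ P).𝔨.toSubmodule (Φ P).ε := by
  -- The relation `Matches` is total and single-valued in both directions, so the two choice
  -- functions are mutually inverse.
  choose f hf using GenCplx.exists_matches (E := E) (G := G) (s := s)
  choose g hg using GenCplx.exists_matches_triple (E := E) (G := G) (s := s)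
  exact ⟨⟨f, g, fun P => (hg (f P)).pair_unique (hf P), fun T => (hf (g T)).triple_unique (hg T)⟩,
    hf⟩
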